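/- Let $(M,g)$ be a complete (connected, second countable, boundaryless, smooth) Riemannian manifold, $\varphi\in C^\infty(M)$, $p>1$, $q>0$, $\delta=q(p-1)-1$, and let $d\mu=e^{-\varphi}dV_g$. Write $u^q:=|u|^{q-1}u$ and $\mathcal L_{p,\varphi}v=e^{\varphi}\operatorname{div}(e^{-\varphi}|\nabla v|^{p-2}\nabla v)$. Let $J\subseteq\mathbb R$ be a nondegenerate interval (of any kind, bounded or not) and let $u:M\times J\to\mathbb R$ be a (sign-changing) solution of $\partial_t u=\mathcal L_{p,\varphi}u^q$ in the following sense: $t\mapsto u(\cdot,t)$ is differentiable on $J$ as a curve in $L^{q+1}(M,\mu)$, with derivative $u_t$, and for every $t\in J$ and every $\psi\in C_c^\infty(M)$ $$\int_M u_t\,\psi\,d\mu=-\int_M|\nabla u^q|^{p-2}\langle\nabla u^q,\nabla\psi\rangle\,d\mu .$$ Assume that for every $t\in J$: $u(\cdot,t)$ and $u_t(\cdot,t)$ belong to $W^{1,q+1}_{0;\varphi}(M)$ (the functions in $L^{q+1}(\mu)$ with weak gradient in $L^{q+1}(\mu)$ that are limits of functions of $C_c^\infty(M)$ in the norm $(\int|f|^{q+1}d\mu+\int|\nabla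 f|^{q+1}d\mu)^{1/(q+1)}$), and $u^q(\cdot,t)$ has a weak gradient, which is in $L^p(\mu)$. Put $$I(t)=\int_M|u|^{q+1}\,d\mu,\qquad D(t)=-\int_M|\nabla u^q|^p\,d\mu,$$ $J_+=\{t\in J: I(t)>0\}$, and $N=D/I$ on $J_+$ (the parabolic frequency). Then: 1. $N'\ge\delta N^2$ on $J_+$, in the following sense: for every $t\in J_+$ (which is an interior point of $J_+$ relative to $J$), $\liminf_{s\to t}\frac{N(s)-N(t)}{s-t}\ge\delta N(t)^2$ (with $s\in J$, from both sides if $t$ is not an endpoint of $J$); in particular $N'(t)\ge\delta N(t)^2$ for every $t\in J_+$ at which $N$ is differentiable. Moreover $N$ is differentiable at every $t\in J_+$ at which $u_t$ is continuous as a curve in $L^{q+1}(\mu)$ and $u^q$ is differentiable as a curve in $L^{(q+1)/q}(\mu)$. 2. If $\delta\ge0$, then $N$ is nondecreasing on $J_+$. 3. If $\delta=0$, then $J_+$ is convex and $\log I$ is convex on $J_+$. 4. If $\delta\ne0$, then $J_+$ is convex and $-\delta^{-1}I^{-\delta/(q+1)}$ is convex on $J_+$; if $\delta<0$, this function is convex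 on all of $J$. No curvature assumption is made. -/

import Mathlib

open MeasureTheory Filter Set Topology Bundle
open scoped Manifold ContDiff ENNReal

namespace ParabolicFrequency

noncomputable section

section Riemannian

variable (n : ℕ) {M : Type*} [MetricSpace M] [MeasurableSpace M] [BorelSpace M]
  [ChartedSpace (EuclideanSpace ℝ (Fin n)) M]
  [RiemannianBundle (fun x : M => TangentSpace (𝓡 n) x)]

/-- For a chart `e` of `M`, the tangent vector of `M` at `e.symm y` whose coordinates in the
chart `e` are `w`. -/
def coordVector (e : OpenPartialHomeomorph M (EuclideanSpace ℝ (Fin n)))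
    (y w : EuclideanSpace ℝ (Fin n)) : TangentSpace (𝓡 n) (e.symm y) :=
  mfderiv (𝓡 n) (𝓡 n) e.symm y w

/-- The function `√ det (g_ij)` in the chart `e`, with `g_ij = ⟨∂_i, ∂_j⟩`. -/
def volumeDensity (e : OpenPartialHomeomorph M (EuclideanSpace ℝ (Fin n)))
    (y : EuclideanSpace ℝ (Fin n)) : ℝ :=
  √(Matrix.gram ℝ (fun i : Fin n => coordVector n e y (EuclideanSpace.single i 1))).det

/-- The measure `√ det (g_ij) dy` of the chart `e`, carried to `M`; it lives on `e.source`. -/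
def chartVolume (e : OpenPartialHomeomorph M (EuclideanSpace ℝ (Fin n))) : Measure M :=
  ((volume.restrict e.target).withDensity
    (fun y => ENNReal.ofReal (volumeDensity n e y))).map e.symm

variable (M) in
/-- The Riemannian volume measure `dV_g`: the measures `√ det (g_ij) dy` of the smooth charts
agree on overlaps, and `dV_g` is obtained by gluing them, that is, it is the smallest measure
that is above all of them. -/
def riemannianVolume : Measure M :=
  ⨆ e ∈ IsManifold.maximalAtlas (𝓡 n) ∞ M, chartVolume n e

/-- The weighted measure `e^{-φ} dV_g`. -/
def weightedVolume (φ : M → ℝ) : Measure M :=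
  (riemannianVolume n M).withDensity (fun x => ENNReal.ofReal (Real.exp (-φ x)))

/-- The Riemannian gradient of a (differentiable) function. -/
def grad (f : M → ℝ) (x : M) : TangentSpace (𝓡 n) x :=
  haveI : FiniteDimensional ℝ (TangentSpace (𝓡 n) x) :=
    inferInstanceAs (FiniteDimensional ℝ (EuclideanSpace ℝ (Fin n)))
  haveI : CompleteSpace (TangentSpace (𝓡 n) x) := FiniteDimensional.complete ℝ _
  (InnerProductSpace.toDual ℝ (TangentSpace (𝓡 n) x)).symm (mfderiv (𝓡 n) 𝓘(ℝ, ℝ) f x)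

/-- The vector field `X` is the weak gradient of `f`: in every smooth chart, `f` and the
components `⟨X, ∂_w⟩` are locally integrable, and `⟨X, ∂_w⟩` is the weak partial derivative of
`f` in the direction `w`. -/
structure IsWeakGrad (f : M → ℝ) (X : ∀ x : M, TangentSpace (𝓡 n) x) : Prop where
  locInt : ∀ e ∈ IsManifold.maximalAtlas (𝓡 n) ∞ M,
    LocallyIntegrableOn (fun y => f (e.symm y)) e.target volume
  locInt_grad : ∀ e ∈ IsManifold.maximalAtlas (𝓡 n) ∞ M, ∀ w : EuclideanSpace ℝ (Fin n),
    LocallyIntegrableOn (fun y => inner ℝ (X (e.symm y)) (coordVector n e y w)) e.target volume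
  integral_eq : ∀ e ∈ IsManifold.maximalAtlas (𝓡 n) ∞ M, ∀ w : EuclideanSpace ℝ (Fin n),
    ∀ ψ : EuclideanSpace ℝ (Fin n) → ℝ, ContDiff ℝ ∞ ψ → HasCompactSupport ψ →
      tsupport ψ ⊆ e.target →
      ∫ y in e.target, f (e.symm y) * fderiv ℝ ψ y w =
        -∫ y in e.target, inner ℝ (X (e.symm y)) (coordVector n e y w) * ψ y

open Classical in
/-- The weak gradient of `f` (unique almost everywhere), and `0` if there is none. -/
def weakGrad (f : M → ℝ) : ∀ x : M, TangentSpace (𝓡 n) x :=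
  if h : ∃ X, IsWeakGrad n f X then h.choose else fun _ => 0

/-- `f ∈ W^{1,r}_{0;φ}(M)`: `f` and its weak gradient are in `L^r(e^{-φ} dV_g)`, and `f` is the
limit of smooth compactly supported functions in the norm of `W^{1,r}_φ(M)`. -/
def MemW₀ (φ : M → ℝ) (r : ℝ) (f : M → ℝ) : Prop :=
  ∃ X : ∀ x : M, TangentSpace (𝓡 n) x, IsWeakGrad n f X ∧
    MemLp f (ENNReal.ofReal r) (weightedVolume n φ) ∧
    MemLp (fun x => ‖X x‖) (ENNReal.ofReal r) (weightedVolume n φ) ∧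
    ∃ ψ : ℕ → M → ℝ,
      (∀ k, ContMDiff (𝓡 n) 𝓘(ℝ, ℝ) ∞ (ψ k) ∧ HasCompactSupport (ψ k)) ∧
      Tendsto (fun k => eLpNorm (fun x => f x - ψ k x) (ENNReal.ofReal r) (weightedVolume n φ))
        atTop (𝓝 0) ∧
      Tendsto (fun k => eLpNorm (fun x => ‖X x - grad n (ψ k) x‖) (ENNReal.ofReal r)
        (weightedVolume n φ)) atTop (𝓝 0)

/-- `w = L_{p,φ} v` in the weak sense, where
`L_{p,φ} v = e^φ div (e^{-φ} |∇v|^{p-2} ∇v)` is the weighted `p`-Laplacian. -/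
def IsWeightedPLaplacian (φ : M → ℝ) (p : ℝ) (v w : M → ℝ) : Prop :=
  ∀ ψ : M → ℝ, ContMDiff (𝓡 n) 𝓘(ℝ, ℝ) ∞ ψ → HasCompactSupport ψ →
    ∫ x, w x * ψ x ∂(weightedVolume n φ) =
      -∫ x, ‖weakGrad n v x‖ ^ (p - 2) * inner ℝ (weakGrad n v x) (grad n ψ x)
        ∂(weightedVolume n φ)

end Riemannian

/-- The signed power `u^q = |u|^{q-1} u`. -/
def spow (q r : ℝ) : ℝ := |r| ^ (q - 1) * r

/-- The curve `s ↦ u s`, `s ∈ J`, has at the time `t` the derivative `w` in `L^r(μ)`. -/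
def HasLpDerivAt {X : Type*} [MeasurableSpace X] (μ : Measure X) (r : ℝ) (J : Set ℝ)
    (u : ℝ → X → ℝ) (w : X → ℝ) (t : ℝ) : Prop :=
  Tendsto (fun s => eLpNorm (fun x => (u s x - u t x) / (s - t) - w x) (ENNReal.ofReal r) μ)
    (𝓝[J \ {t}] t) (𝓝 0)

/-- The curve `s ↦ u s`, `s ∈ J`, is continuous at the time `t` in `L^r(μ)`. -/
def LpContinuousAt {X : Type*} [MeasurableSpace X] (μ : Measure X) (r : ℝ) (J : Set ℝ)
    (u : ℝ → X → ℝ) (t : ℝ) : Prop :=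
  Tendsto (fun s => eLpNorm (fun x => u s x - u t x) (ENNReal.ofReal r) μ) (𝓝[J] t) (𝓝 0)

section Frequency

variable (n : ℕ) {M : Type*} [MetricSpace M] [MeasurableSpace M] [BorelSpace M]
  [ChartedSpace (EuclideanSpace ℝ (Fin n)) M]
  [RiemannianBundle (fun x : M => TangentSpace (𝓡 n) x)]

/-- The assumption on `u` and its time derivative `ut`: for every `t ∈ J`,
`u, u_t ∈ W^{1,q+1}_{0;φ}(M)` and `∇u^q ∈ L^p(e^{-φ} dV_g)`. -/
def StandingAssumption (φ : M → ℝ) (p q : ℝ) (J : Set ℝ) (u ut : ℝ → M → ℝ) : Prop :=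
  ∀ t ∈ J, MemW₀ n φ (q + 1) (u t) ∧ MemW₀ n φ (q + 1) (ut t) ∧
    (∃ X, IsWeakGrad n (fun x => spow q (u t x)) X) ∧
    MemLp (fun x => ‖weakGrad n (fun x => spow q (u t x)) x‖) (ENNReal.ofReal p)
      (weightedVolume n φ)

/-- `u` solves `∂_t u = L_{p,φ} u^q` on `M × J`, with time derivative `∂_t u = ut`: the
derivative in time is taken in `L^{q+1}(e^{-φ} dV_g)`, and at each time the equation holds in
the weak sense. -/
def IsSolution (φ : M → ℝ) (p q : ℝ) (J : Set ℝ) (u ut : ℝ → M → ℝ) : Prop :=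
  ∀ t ∈ J, HasLpDerivAt (weightedVolume n φ) (q + 1) J u (ut t) t ∧
    IsWeightedPLaplacian n φ p (fun x => spow q (u t x)) (ut t)

/-- `I(t) = ∫ |u|^{q+1} e^{-φ} dV_g`. -/
def energyI (φ : M → ℝ) (q : ℝ) (u : ℝ → M → ℝ) (t : ℝ) : ℝ :=
  ∫ x, |u t x| ^ (q + 1) ∂(weightedVolume n φ)

/-- `D(t) = -∫ |∇u^q|^p e^{-φ} dV_g`. -/
def energyD (φ : M → ℝ) (p q : ℝ) (u : ℝ → M → ℝ) (t : ℝ) : ℝ :=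
  -∫ x, ‖weakGrad n (fun x => spow q (u t x)) x‖ ^ p ∂(weightedVolume n φ)

/-- The parabolic frequency `N(t) = D(t) / I(t)`. -/
def frequency (φ : M → ℝ) (p q : ℝ) (u : ℝ → M → ℝ) (t : ℝ) : ℝ :=
  energyD n φ p q u t / energyI n φ q u t

/-- The times `t ∈ J` with `u(·, t) ≢ 0`, that is, those at which the frequency is defined. -/
def posTimes (φ : M → ℝ) (q : ℝ) (J : Set ℝ) (u : ℝ → M → ℝ) : Set ℝ :=
  {t ∈ J | 0 < energyI n φ q u t}

end Frequency

end

end ParabolicFrequency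

open MeasureTheory Filter Set Topology Bundle
open scoped Manifold ContDiff ENNReal

/-! Write v = u^q, W = |∇v|^(p-2) ∇v and g(t) = ‖∇v(t)‖_p, so that D = -g^p. Everything is read off
from two quantities with separate times, G(s,t) = ∫ u(s) v(t) dμ and P(s,t) = ∫ u_t(s) v(t) dμ = -∫
⟨W(s), ∇v(t)⟩ dμ. Freezing the second time avoids every time derivative of ∇v and of D. One has I' =
(q+1) P(t,t) = (q+1) D and ∂_s G = P, and two Hölder inequalities, G(s,t) ≤ I(s)^(1/(q+1))
I(t)^(q/(q+1)) and P(s,t) ≥ -g(s)^(p-1) g(t), both equalities at s = t. These facts are collected in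
`EnergyRelations`.

The core is that H = g I^(-q/(q+1)), which is ‖∇v‖_p / ‖v‖_((q+1)/q), is nonincreasing
(`antitoneOn_normalized_diss`). H is lower semicontinuous. If H(t) < H(s) for some t < s, let b be
the last minimum point of H on [t,s]. The function F(τ) = I(τ)^(1/(q+1)) - I(b)^(-q/(q+1)) G(τ,b)
vanishes at b and is nonnegative by the first Hölder inequality, whereas the second one gives F'(τ)
≤ -g(τ)^(p-1) (H(τ) - H(b)) < 0 after b, a contradiction.

Since N I^(-δ/(q+1)) = -H^p, this quotient is nondecreasing. Together with I' = (q+1) N I this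
yields N' ≥ δ N² for lower derivatives. Up to a constant, the same quotient is the derivative of log
I (if δ = 0) or of -δ⁻¹ I^(-δ/(q+1)) (if δ ≠ 0), whence the convexity.

The analytic difficulty is the formula for P: the equation at time s has to be tested with v(t),
which is neither smooth nor compactly supported and lies in L^((q+1)/q) with gradient in L^p
(`integral_mul_eq_neg_integral_inner`). Locally, mollification in a chart allows test functions ζ
T(v) with T smooth and bounded together with T' (`weak_divergence_comp`). Globally, completeness
provides cutoffs whose gradients tend to 0 uniformly (`exists_cutoffs`). The cutoff error vanishes
once T(v) is in L^p, which is arranged by truncations T that vanish near 0 and near infinity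
(`exists_truncations`). Removing the truncation loses only the set {v = 0}, and the integral of ⟨W,
∇v⟩ over it is zero by a test with c⁻¹ arctan(c v). -/

namespace ParabolicFrequency

noncomputable section

/-! ### The metric in charts: Gram matrix, volume density, change of charts -/

section Charts

set_option linter.unusedSectionVars false

variable {n : ℕ} {M : Type*} [MetricSpace M]
  [ChartedSpace (EuclideanSpace ℝ (Fin n)) M] 

section
variable [IsManifold (𝓡 n) ∞ M]
variable {e e' : OpenPartialHomeomorph M (EuclideanSpace ℝ (Fin n))}

theorem contMDiffOn_chart_symm (he : e ∈ IsManifold.maximalAtlas (𝓡 n) ∞ M) :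
    ContMDiffOn (𝓡 n) (𝓡 n) ∞ e.symm e.target := contMDiffOn_symm_of_mem_maximalAtlas he

theorem contMDiffOn_chart (he : e ∈ IsManifold.maximalAtlas (𝓡 n) ∞ M) :
    ContMDiffOn (𝓡 n) (𝓡 n) ∞ e e.source := contMDiffOn_of_mem_maximalAtlas he

theorem mdifferentiableAt_chart_symm (he : e ∈ IsManifold.maximalAtlas (𝓡 n) ∞ M)
    {y : EuclideanSpace ℝ (Fin n)} (hy : y ∈ e.target) :
    MDifferentiableAt (𝓡 n) (𝓡 n) e.symm y :=
  ((contMDiffOn_chart_symm he).contMDiffAt (e.open_target.mem_nhds hy)).mdifferentiableAt (by simp)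

theorem mdifferentiableAt_chart (he : e ∈ IsManifold.maximalAtlas (𝓡 n) ∞ M)
    {x : M} (hx : x ∈ e.source) :
    MDifferentiableAt (𝓡 n) (𝓡 n) e x :=
  ((contMDiffOn_chart he).contMDiffAt (e.open_source.mem_nhds hx)).mdifferentiableAt (by simp)
end

variable [RiemannianBundle (fun x : M => TangentSpace (𝓡 n) x)]
variable {e e' : OpenPartialHomeomorph M (EuclideanSpace ℝ (Fin n))}

theorem coordVector_smul (c : ℝ) (y w : EuclideanSpace ℝ (Fin n)) :
    coordVector n e y (c • w) = c • coordVector n e y w := by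
  unfold coordVector; exact map_smul _ _ _

theorem coordVector_sum {ι : Type*} (s : Finset ι) (y : EuclideanSpace ℝ (Fin n))
    (w : ι → EuclideanSpace ℝ (Fin n)) :
    coordVector n e y (∑ i ∈ s, w i) = ∑ i ∈ s, coordVector n e y (w i) := by
  unfold coordVector; exact map_sum _ _ _

theorem coordVector_eq_sum (y w : EuclideanSpace ℝ (Fin n)) :
    coordVector n e y w = ∑ i, w i • coordVector n e y (EuclideanSpace.single i 1) := by
  conv_lhs => rw [← (EuclideanSpace.basisFun (Fin n) ℝ).sum_repr w, coordVector_sum]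
  simp [coordVector_smul]

/-- The inner product of the metric at `x`, on the model space. -/
def metricAt (x : M) (a b : EuclideanSpace ℝ (Fin n)) : ℝ :=
  inner ℝ (show TangentSpace (𝓡 n) x from a) (show TangentSpace (𝓡 n) x from b)

variable [IsManifold (𝓡 n) ∞ M]

theorem inner_coordVector_change (he : e ∈ IsManifold.maximalAtlas (𝓡 n) ∞ M)
    (he' : e' ∈ IsManifold.maximalAtlas (𝓡 n) ∞ M) {y : EuclideanSpace ℝ (Fin n)}
    (hy : y ∈ e.target) (hy' : e.symm y ∈ e'.source) (w w' : EuclideanSpace ℝ (Fin n)) :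
    inner ℝ (coordVector n e y w) (coordVector n e y w') =
      inner ℝ (coordVector n e' (e' (e.symm y)) (fderiv ℝ (fun z => e' (e.symm z)) y w))
        (coordVector n e' (e' (e.symm y)) (fderiv ℝ (fun z => e' (e.symm z)) y w')) := by
  have hev : e.symm =ᶠ[𝓝 y] fun z => e'.symm (e' (e.symm z)) := by
    filter_upwards [(e.continuousAt_symm hy).preimage_mem_nhds (e'.open_source.mem_nhds hy')]
      with z hz
    exact (e'.left_inv hz).symm
  have h1 := hev.mfderiv_eq (I := 𝓡 n) (I' := 𝓡 n)
  have hd : MDifferentiableAt (𝓡 n) (𝓡 n) (fun z => e' (e.symm z)) y :=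
    MDifferentiableAt.comp y (mdifferentiableAt_chart he' hy') (mdifferentiableAt_chart_symm he hy)
  have h2 := mfderiv_comp (I := 𝓡 n) (I' := 𝓡 n) (I'' := 𝓡 n) y (g := e'.symm)
    (f := fun z => e' (e.symm z)) (mdifferentiableAt_chart_symm he' (e'.map_source hy')) hd
  have h3 : ∀ w, coordVector n e y w =
    coordVector n e' (e' (e.symm y)) (fderiv ℝ (fun z => e' (e.symm z)) y w) := by
    intro w
    have := congrArg (fun T => T w) (h1.trans h2)
    rw [← mfderiv_eq_fderiv]
    exact this
  -- All tangent spaces are the model space. With the metric written as a function of the base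
  -- point, that point can be rewritten although the types of the vectors depend on it.
  change metricAt (e.symm y) _ _ = metricAt (e'.symm (e' (e.symm y))) _ _
  rw [e'.left_inv hy']
  rw [h3 w, h3 w']

variable [IsContMDiffRiemannianBundle (𝓡 n) ∞ (EuclideanSpace ℝ (Fin n))
      (fun x : M => TangentSpace (𝓡 n) x)]

/-- The coordinate field is the tangent map of `e.symm` applied to a constant field, hence
continuous into the tangent bundle, and the metric is continuous there. -/
theorem continuousOn_inner_coordVector (he : e ∈ IsManifold.maximalAtlas (𝓡 n) ∞ M)
    (w w' : EuclideanSpace ℝ (Fin n)) :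
    ContinuousOn (fun y => inner ℝ (coordVector n e y w) (coordVector n e y w')) e.target := by
  have key : ∀ w : EuclideanSpace ℝ (Fin n), ContinuousOn
      (fun y => (⟨e.symm y, coordVector n e y w⟩ : TangentBundle (𝓡 n) M)) e.target := by
    intro w
    have h := (contMDiffOn_chart_symm he).continuousOn_tangentMapWithin (by simp)
      e.open_target.uniqueMDiffOn
    have h2 : ContinuousOn (fun y => (⟨y, w⟩ : TangentBundle (𝓡 n) (EuclideanSpace ℝ (Fin n))))
      e.target := by
      apply Continuous.continuousOn
      exact (tangentBundleModelSpaceHomeomorph (𝓡 n)).symm.continuous.comp (by fun_prop : Continuous fun y : EuclideanSpace ℝ (Fin n) => (⟨y, w⟩ : ModelProd _ _))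
    refine (h.comp h2 (fun y hy => hy)).congr fun y hy => ?_
    simp only [Function.comp, tangentMapWithin, coordVector]
    rw [mfderivWithin_of_mem_nhds (e.open_target.mem_nhds hy)]
  have : IsContinuousRiemannianBundle (EuclideanSpace ℝ (Fin n))
      (fun x : M => TangentSpace (𝓡 n) x) := by
    obtain ⟨g, hg, hg'⟩ := IsContMDiffRiemannianBundle.exists_contMDiff (IB := 𝓡 n) (n := ∞)
      (F := EuclideanSpace ℝ (Fin n)) (E := fun x : M => TangentSpace (𝓡 n) x)
    exact ⟨g, hg.continuous, hg'⟩
  exact ContinuousOn.inner_bundle (F := EuclideanSpace ℝ (Fin n)) (key w) (key w')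


theorem mdifferentiable_chart_of_mem (he : e ∈ IsManifold.maximalAtlas (𝓡 n) ∞ M) :
    e.MDifferentiable (𝓡 n) (𝓡 n) :=
  ⟨fun _ hx => (mdifferentiableAt_chart he hx).mdifferentiableWithinAt,
    fun _ hy => (mdifferentiableAt_chart_symm he hy).mdifferentiableWithinAt⟩

theorem coordVector_bijective (he : e ∈ IsManifold.maximalAtlas (𝓡 n) ∞ M)
    {y : EuclideanSpace ℝ (Fin n)} (hy : y ∈ e.target) :
    Function.Bijective (coordVector n e y) :=
  (mdifferentiable_chart_of_mem he).symm.mfderiv_bijective (x := y) hy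

/-- The matrix of the metric in the chart `e`. -/
def metricMatrix (e : OpenPartialHomeomorph M (EuclideanSpace ℝ (Fin n)))
    (y : EuclideanSpace ℝ (Fin n)) : Matrix (Fin n) (Fin n) ℝ :=
  Matrix.gram ℝ (fun i : Fin n => coordVector n e y (EuclideanSpace.single i 1))

theorem metricMatrix_posDef (he : e ∈ IsManifold.maximalAtlas (𝓡 n) ∞ M)
    {y : EuclideanSpace ℝ (Fin n)} (hy : y ∈ e.target) : (metricMatrix e y).PosDef := by
  apply Matrix.posDef_gram_of_linearIndependent
  refine Fintype.linearIndependent_iff.2 fun g hg i => ?_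
  have h1 := coordVector_eq_sum (e := e) y (WithLp.toLp 2 g)
  simp only at h1
  rw [hg] at h1
  have h0 : coordVector n e y 0 = 0 := by
    have := coordVector_smul (e := e) 0 y 0
    simpa using this
  have := congrArg (fun v : EuclideanSpace ℝ (Fin n) => v i)
    ((coordVector_bijective he hy).1 (h1.trans h0.symm))
  simpa using this

theorem continuousOn_metricMatrix (he : e ∈ IsManifold.maximalAtlas (𝓡 n) ∞ M) :
    ContinuousOn (metricMatrix (n := n) e) e.target :=
  continuousOn_pi.2 fun i => continuousOn_pi.2 fun j =>
    continuousOn_inner_coordVector he (EuclideanSpace.single i 1) (EuclideanSpace.single j 1)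

theorem continuousOn_metricMatrix_inv (he : e ∈ IsManifold.maximalAtlas (𝓡 n) ∞ M) :
    ContinuousOn (fun y => (metricMatrix (n := n) e y)⁻¹) e.target := by
  have h := continuousOn_metricMatrix (n := n) he
  simp_rw [Matrix.inv_def, Ring.inverse_eq_inv']
  refine ContinuousOn.smul (ContinuousOn.inv₀ ?_ fun y hy => (metricMatrix_posDef he hy).det_pos.ne') ?_
  · exact fun y hy => (Continuous.matrix_det continuous_id).continuousAt.comp_continuousWithinAt (h y hy)
  · exact fun y hy => (Continuous.matrix_adjugate continuous_id).continuousAt.comp_continuousWithinAt (h y hy)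

theorem volumeDensity_pos (he : e ∈ IsManifold.maximalAtlas (𝓡 n) ∞ M)
    {y : EuclideanSpace ℝ (Fin n)} (hy : y ∈ e.target) : 0 < volumeDensity n e y :=
  Real.sqrt_pos.2 (metricMatrix_posDef he hy).det_pos

theorem continuousOn_volumeDensity (he : e ∈ IsManifold.maximalAtlas (𝓡 n) ∞ M) :
    ContinuousOn (volumeDensity n e) e.target := fun y hy =>
  (Real.continuous_sqrt.comp (Continuous.matrix_det continuous_id)).continuousAt.comp_continuousWithinAt
    (continuousOn_metricMatrix he y hy)

/-- The components of the tangent vector `V` in the chart `e`. -/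
def components (e : OpenPartialHomeomorph M (EuclideanSpace ℝ (Fin n)))
    (y : EuclideanSpace ℝ (Fin n)) (V : TangentSpace (𝓡 n) (e.symm y)) (i : Fin n) : ℝ :=
  ∑ j, (metricMatrix e y)⁻¹ i j * inner ℝ V (coordVector n e y (EuclideanSpace.single j 1))

/-- Raising an index: if V = ∑ a_i ∂_i, then the numbers ⟨V, ∂_j⟩ form the vector `metricMatrix e y`
a, and the inverse matrix recovers a. Only the numbers ⟨V, ∂_j⟩ enter, and these are what
`IsWeakGrad` controls. -/
theorem sum_components (he : e ∈ IsManifold.maximalAtlas (𝓡 n) ∞ M)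
    {y : EuclideanSpace ℝ (Fin n)} (hy : y ∈ e.target) (V : TangentSpace (𝓡 n) (e.symm y)) :
    ∑ i, components e y V i • coordVector n e y (EuclideanSpace.single i 1) = V := by
  obtain ⟨a, rfl⟩ := (coordVector_bijective he hy).2 V
  have hdet := (metricMatrix_posDef he hy).det_pos.ne'
  have : components e y (coordVector n e y a) = a := by
    have h1 : (fun j => inner ℝ (coordVector n e y a)
        (coordVector n e y (EuclideanSpace.single j 1))) = Matrix.mulVec (metricMatrix e y) a := by
      ext j
      rw [coordVector_eq_sum y a, sum_inner, Matrix.mulVec, dotProduct]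
      refine Finset.sum_congr rfl fun i _ => ?_
      rw [real_inner_smul_left, mul_comm, real_inner_comm]; rfl
    have h2 : components e y (coordVector n e y a) =
        Matrix.mulVec (metricMatrix e y)⁻¹ (Matrix.mulVec (metricMatrix e y) a) := by
      rw [← h1]; rfl
    rw [h2, Matrix.mulVec_mulVec, Matrix.nonsing_inv_mul _ (isUnit_iff_ne_zero.2 hdet),
      Matrix.one_mulVec]
  rw [this, ← coordVector_eq_sum]

theorem inner_eq_sum_components (he : e ∈ IsManifold.maximalAtlas (𝓡 n) ∞ M)
    {y : EuclideanSpace ℝ (Fin n)} (hy : y ∈ e.target) (V W : TangentSpace (𝓡 n) (e.symm y)) :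
    inner ℝ V W =
      ∑ i, components e y V i * inner ℝ W (coordVector n e y (EuclideanSpace.single i 1)) := by
  conv_lhs => rw [← sum_components he hy V, sum_inner]
  refine Finset.sum_congr rfl fun i _ => ?_
  rw [real_inner_smul_left, real_inner_comm]

/-- The Gram matrices satisfy g = Jᵀ g' J with J the Jacobian matrix of the transition map; take
determinants and square roots. -/
theorem volumeDensity_change (he : e ∈ IsManifold.maximalAtlas (𝓡 n) ∞ M)
    (he' : e' ∈ IsManifold.maximalAtlas (𝓡 n) ∞ M) {y : EuclideanSpace ℝ (Fin n)}
    (hy : y ∈ e.target) (hy' : e.symm y ∈ e'.source) :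
    volumeDensity n e y = |(fderiv ℝ (fun z => e' (e.symm z)) y).det| *
      volumeDensity n e' (e' (e.symm y)) := by
  set T := fderiv ℝ (fun z => e' (e.symm z)) y with hT
  set b := (EuclideanSpace.basisFun (Fin n) ℝ).toBasis with hb
  set J := LinearMap.toMatrix b b T.toLinearMap with hJ
  have hJe : ∀ k i, J k i = T (EuclideanSpace.single i 1) k := by
    intro k i
    rw [hJ, LinearMap.toMatrix_apply]
    simp [hb]
  have hG : metricMatrix e y = J.transpose * metricMatrix e' (e' (e.symm y)) * J := by
    ext i j
    have h := inner_coordVector_change he he' hy hy' (EuclideanSpace.single i 1)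
      (EuclideanSpace.single j 1)
    change inner ℝ (coordVector n e y _) _ = _
    rw [h, ← hT, coordVector_eq_sum _ (T (EuclideanSpace.single i 1)),
      coordVector_eq_sum _ (T (EuclideanSpace.single j 1)), inner_sum]
    rw [Matrix.mul_apply]
    refine Finset.sum_congr rfl fun l _ => ?_
    rw [real_inner_smul_right, sum_inner, Matrix.mul_apply, mul_comm, hJe]
    congr 1
    refine Finset.sum_congr rfl fun k _ => ?_
    rw [real_inner_smul_left, Matrix.transpose_apply, hJe]
    rfl
  have hdet : J.det = T.det := by
    rw [hJ, LinearMap.det_toMatrix]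
  change √(metricMatrix e y).det = _ * √(metricMatrix e' (e' (e.symm y))).det
  rw [hG, Matrix.det_mul, Matrix.det_mul, Matrix.det_transpose, hdet,
    show T.det * (metricMatrix e' (e' (e.symm y))).det * T.det =
      T.det ^ 2 * (metricMatrix e' (e' (e.symm y))).det by ring,
    Real.sqrt_mul (sq_nonneg _), Real.sqrt_sq_eq_abs]

end Charts

/-! ### The weighted volume in charts -/

section ChartMeasure

set_option linter.unusedSectionVars false

variable {n : ℕ} {M : Type*} [MetricSpace M] [MeasurableSpace M] [BorelSpace M]
  [ChartedSpace (EuclideanSpace ℝ (Fin n)) M] [IsManifold (𝓡 n) ∞ M]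
  [RiemannianBundle (fun x : M => TangentSpace (𝓡 n) x)]
  [IsContMDiffRiemannianBundle (𝓡 n) ∞ (EuclideanSpace ℝ (Fin n))
      (fun x : M => TangentSpace (𝓡 n) x)]
variable {e e' : OpenPartialHomeomorph M (EuclideanSpace ℝ (Fin n))}

theorem aemeasurable_chart_symm (ν : Measure (EuclideanSpace ℝ (Fin n))) :
    AEMeasurable e.symm (ν.restrict e.target) :=
  e.continuousOn_symm.aemeasurable e.open_target.measurableSet

theorem measurableSet_target_inter_preimage {s : Set M} (hs : MeasurableSet s) :
    MeasurableSet (e.target ∩ e.symm ⁻¹' s) := by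
  have h : Measurable (fun y : e.target => e.symm y) :=
    (continuousOn_iff_continuous_domRestrict.1 e.continuousOn_symm).measurable
  have := e.open_target.measurableSet.subtype_image (h hs)
  convert this using 1
  ext y
  simp [and_comm]

theorem chartVolume_apply {s : Set M} (hs : MeasurableSet s) :
    chartVolume n e s = ∫⁻ y in e.target ∩ e.symm ⁻¹' s, ENNReal.ofReal (volumeDensity n e y) := by
  have hm := measurableSet_target_inter_preimage (e := e) hs
  rw [chartVolume, Measure.map_apply_of_aemeasurable _ hs, withDensity_apply',
    Measure.restrict_restrict₀', inter_comm]
  · exact e.open_target.measurableSet.nullMeasurableSet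
  · exact (aemeasurable_chart_symm volume).mono_ac (withDensity_absolutelyContinuous _ _)

/-- Change of variables along the transition map, whose Jacobian is absorbed by
`volumeDensity_change`. This compatibility makes the supremum in `riemannianVolume` a gluing. -/
theorem chartVolume_apply_eq (he : e ∈ IsManifold.maximalAtlas (𝓡 n) ∞ M)
    (he' : e' ∈ IsManifold.maximalAtlas (𝓡 n) ∞ M) {s : Set M} (hs : MeasurableSet s)
    (h : s ⊆ e.source) (h' : s ⊆ e'.source) : chartVolume n e' s = chartVolume n e s := by
  rw [chartVolume_apply hs, chartVolume_apply hs]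
  set T := e.target ∩ e.symm ⁻¹' s
  have himg : e'.target ∩ e'.symm ⁻¹' s = (fun y => e' (e.symm y)) '' T := by
    ext z
    constructor
    · rintro ⟨hz, hzs⟩
      refine ⟨e (e'.symm z), ⟨e.map_source (h hzs), ?_⟩, ?_⟩
      · simpa [e.left_inv (h hzs)] using hzs
      · simp [e.left_inv (h hzs), e'.right_inv hz]
    · rintro ⟨y, ⟨hy, hys⟩, rfl⟩
      refine ⟨e'.map_source (h' hys), ?_⟩
      simpa [e'.left_inv (h' hys)] using hys
  have hinj : InjOn (fun y => e' (e.symm y)) T := by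
    rintro y ⟨hy, hys⟩ z ⟨hz, hzs⟩ hyz
    exact e.symm.injOn hy hz (e'.injOn (h' hys) (h' hzs) hyz)
  have hder : ∀ y ∈ T, HasFDerivWithinAt (fun y => e' (e.symm y))
      (fderiv ℝ (fun z => e' (e.symm z)) y) T y := by
    rintro y ⟨hy, hys⟩
    have : MDifferentiableAt (𝓡 n) (𝓡 n) (fun z => e' (e.symm z)) y :=
      MDifferentiableAt.comp y (mdifferentiableAt_chart he' (h' hys))
        (mdifferentiableAt_chart_symm he hy)
    exact this.differentiableAt.hasFDerivAt.hasFDerivWithinAt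
  rw [himg, lintegral_image_eq_lintegral_abs_det_fderiv_mul volume
    (measurableSet_target_inter_preimage hs) hder hinj]
  refine setLIntegral_congr_fun (measurableSet_target_inter_preimage hs) ?_
  rintro y ⟨hy, hys⟩
  dsimp only
  rw [← ENNReal.ofReal_mul (abs_nonneg _), ← volumeDensity_change he he' hy (h' hys)]

theorem chartVolume_compl_source : chartVolume n e e.sourceᶜ = 0 := by
  rw [chartVolume_apply e.open_source.measurableSet.compl]
  have : e.target ∩ e.symm ⁻¹' e.sourceᶜ = ∅ := by
    ext y
    simp only [mem_inter_iff, mem_preimage, mem_compl_iff, mem_empty_iff_false, iff_false, not_and,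
      not_not]
    exact fun hy => e.map_target hy
  rw [this, Measure.restrict_empty, lintegral_zero_measure]

/-- One inequality is built into the supremum. For the other a single upper bound must serve all
charts: it is `chartVolume n e` on the domain of `e`, plus `⊤` outside, which disappears on
restriction. -/
theorem riemannianVolume_restrict_source (he : e ∈ IsManifold.maximalAtlas (𝓡 n) ∞ M) :
    (riemannianVolume n M).restrict e.source = chartVolume n e := by
  have hms := e.open_source.measurableSet
  have hsub : chartVolume n e = (chartVolume n e).restrict e.source := by
    rw [← Measure.restrict_add_restrict_compl (μ := chartVolume n e) hms]
    have : (chartVolume n e).restrict e.sourceᶜ = 0 :=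
      Measure.restrict_eq_zero.2 chartVolume_compl_source
    rw [this, add_zero, Measure.restrict_restrict hms, inter_self]
  apply le_antisymm
  · have hle : riemannianVolume n M ≤
        chartVolume n e + (⊤ : Measure M).restrict e.sourceᶜ := by
      refine iSup₂_le fun e' he' => Measure.le_iff.2 fun s hs => ?_
      rw [← measure_inter_add_sdiff s hms, Measure.add_apply]
      refine add_le_add ?_ ?_
      · have h1 : s ∩ e.source = (s ∩ e.source ∩ e'.source) ∪ (s ∩ e.source ∩ e'.sourceᶜ) := by
          rw [← inter_union_distrib_left, union_compl_self, inter_univ]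
        calc chartVolume n e' (s ∩ e.source)
            ≤ chartVolume n e' (s ∩ e.source ∩ e'.source) + chartVolume n e' e'.sourceᶜ := by
              conv_lhs => rw [h1]
              exact (measure_union_le _ _).trans (add_le_add_right
                (measure_mono inter_subset_right) _)
          _ = chartVolume n e (s ∩ e.source ∩ e'.source) := by
              rw [chartVolume_compl_source, add_zero]
              exact chartVolume_apply_eq he he' ((hs.inter hms).inter e'.open_source.measurableSet)
                (fun x hx => hx.1.2) (fun x hx => hx.2)
          _ ≤ chartVolume n e s := measure_mono fun x hx => hx.1.1
      · rw [Measure.restrict_apply hs]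
        exact (le_top : chartVolume n e' ≤ ⊤) _
    calc (riemannianVolume n M).restrict e.source
        ≤ (chartVolume n e + (⊤ : Measure M).restrict e.sourceᶜ).restrict e.source :=
          Measure.restrict_mono_measure hle _
      _ = chartVolume n e := by
          rw [Measure.restrict_add, Measure.restrict_restrict hms, inter_compl_self,
            Measure.restrict_empty, add_zero, ← hsub]
  · rw [hsub]
    exact Measure.restrict_mono_measure
      (le_iSup₂ (f := fun e (_ : e ∈ IsManifold.maximalAtlas (𝓡 n) ∞ M) => chartVolume n e) e he) _

/-- The density of the weighted volume in the chart `e`. -/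
def weightedDensity (e : OpenPartialHomeomorph M (EuclideanSpace ℝ (Fin n))) (φ : M → ℝ)
    (y : EuclideanSpace ℝ (Fin n)) : ℝ :=
  volumeDensity n e y * Real.exp (-φ (e.symm y))

variable {φ : M → ℝ}

theorem continuousOn_weightedDensity (he : e ∈ IsManifold.maximalAtlas (𝓡 n) ∞ M)
    (hφ : Continuous φ) : ContinuousOn (weightedDensity e φ) e.target :=
  (continuousOn_volumeDensity he).mul
    (Real.continuous_exp.comp_continuousOn (hφ.neg.comp_continuousOn e.continuousOn_symm))

theorem weightedDensity_pos (he : e ∈ IsManifold.maximalAtlas (𝓡 n) ∞ M)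
    {y : EuclideanSpace ℝ (Fin n)} (hy : y ∈ e.target) : 0 < weightedDensity e φ y :=
  mul_pos (volumeDensity_pos he hy) (Real.exp_pos _)

/-- The inverse of the chart `e` as a map defined on its target. -/
def chartEmb (e : OpenPartialHomeomorph M (EuclideanSpace ℝ (Fin n))) (y : e.target) : M := e.symm y

theorem measurableEmbedding_chartEmb : MeasurableEmbedding (chartEmb e) := by
  have h : chartEmb e = Subtype.val ∘ e.toHomeomorphSourceTarget.symm := by
    ext y; rfl
  rw [h]
  exact (MeasurableEmbedding.subtype_coe e.open_source.measurableSet).comp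
    e.toHomeomorphSourceTarget.symm.measurableEmbedding

/-- The weighted volume in the chart `e`, on the target of `e`. -/
def chartMeasure (e : OpenPartialHomeomorph M (EuclideanSpace ℝ (Fin n))) (φ : M → ℝ) :
    Measure e.target :=
  Measure.comap Subtype.val (volume.withDensity fun y => ENNReal.ofReal (weightedDensity e φ y))

/-- Phrased with a measurable embedding of the subtype `e.target`, so that integrals can be
transferred for arbitrary functions, measurable or not. -/
theorem weightedVolume_restrict_source (he : e ∈ IsManifold.maximalAtlas (𝓡 n) ∞ M)
    (hφ : Continuous φ) :
    (weightedVolume n φ).restrict e.source =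
      (chartMeasure e φ).map (chartEmb e) := by
  have hms := e.open_source.measurableSet
  have hmt := e.open_target.measurableSet
  have hae : AEMeasurable e.symm ((volume.restrict e.target).withDensity
      fun y => ENNReal.ofReal (volumeDensity n e y)) :=
    (aemeasurable_chart_symm volume).mono_ac (withDensity_absolutelyContinuous _ _)
  have hgm : Measurable fun x => ENNReal.ofReal (Real.exp (-φ x)) :=
    (Real.continuous_exp.comp hφ.neg).measurable.ennreal_ofReal
  have hvm : AEMeasurable (fun y => ENNReal.ofReal (volumeDensity n e y))
      (volume.restrict e.target) :=
    ((continuousOn_volumeDensity he).aemeasurable hmt).ennreal_ofReal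
  rw [weightedVolume, restrict_withDensity hms, riemannianVolume_restrict_source he]
  ext s hs
  have hm := measurableSet_target_inter_preimage (e := e) hs
  rw [withDensity_apply _ hs, ← lintegral_indicator hs, chartVolume,
    lintegral_map' (hgm.indicator hs).aemeasurable hae,
    lintegral_withDensity_eq_lintegral_mul_non_measurable₀ _ hvm
      (Eventually.of_forall fun _ => ENNReal.ofReal_lt_top),
    measurableEmbedding_chartEmb.map_apply, chartMeasure, comap_subtype_coe_apply hmt,
    withDensity_apply _ ?_]
  · have himg : Subtype.val '' (chartEmb e ⁻¹' s) = e.target ∩ e.symm ⁻¹' s := by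
      ext y; simp [chartEmb, and_comm]
    rw [himg, ← lintegral_indicator hm, ← lintegral_indicator hmt]
    congr 1
    ext y
    by_cases hy : y ∈ e.target
    · by_cases hys : e.symm y ∈ s
      · rw [indicator_of_mem hy, indicator_of_mem (show y ∈ e.target ∩ e.symm ⁻¹' s from ⟨hy, hys⟩),
          Pi.mul_apply, indicator_of_mem hys, weightedDensity,
          ENNReal.ofReal_mul (volumeDensity_pos he hy).le]
      · rw [indicator_of_mem hy, indicator_of_notMem (fun h => hys h.2),
          Pi.mul_apply, indicator_of_notMem hys, mul_zero]
    · rw [indicator_of_notMem hy, indicator_of_notMem (fun h => hy h.1)]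
  · have : Subtype.val '' (chartEmb e ⁻¹' s) = e.target ∩ e.symm ⁻¹' s := by
      ext y; simp [chartEmb, and_comm]
    rw [this]; exact hm

theorem map_val_chartMeasure :
    (chartMeasure e φ).map Subtype.val =
      (volume.restrict e.target).withDensity fun y => ENNReal.ofReal (weightedDensity e φ y) := by
  rw [chartMeasure, map_comap_subtype_coe e.open_target.measurableSet,
    restrict_withDensity e.open_target.measurableSet]

theorem aemeasurable_weightedDensity (he : e ∈ IsManifold.maximalAtlas (𝓡 n) ∞ M)
    (hφ : Continuous φ) :
    AEMeasurable (fun y => ENNReal.ofReal (weightedDensity e φ y)) (volume.restrict e.target) :=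
  ((continuousOn_weightedDensity he hφ).aemeasurable e.open_target.measurableSet).ennreal_ofReal

theorem setLIntegral_source (he : e ∈ IsManifold.maximalAtlas (𝓡 n) ∞ M) (hφ : Continuous φ)
    (f : M → ℝ≥0∞) :
    ∫⁻ x in e.source, f x ∂(weightedVolume n φ) =
      ∫⁻ y in e.target, ENNReal.ofReal (weightedDensity e φ y) * f (e.symm y) := by
  have hmt := e.open_target.measurableSet
  rw [weightedVolume_restrict_source he hφ, measurableEmbedding_chartEmb.lintegral_map]
  refine ((MeasurableEmbedding.subtype_coe hmt).lintegral_map (μ := chartMeasure e φ)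
    (fun y => f (e.symm y))).symm.trans ?_
  rw [map_val_chartMeasure,
    lintegral_withDensity_eq_lintegral_mul_non_measurable₀ _ (aemeasurable_weightedDensity he hφ)
      (Eventually.of_forall fun _ => ENNReal.ofReal_lt_top)]
  rfl

theorem setIntegral_source (he : e ∈ IsManifold.maximalAtlas (𝓡 n) ∞ M) (hφ : Continuous φ)
    (f : M → ℝ) :
    ∫ x in e.source, f x ∂(weightedVolume n φ) =
      ∫ y in e.target, weightedDensity e φ y * f (e.symm y) := by
  have hmt := e.open_target.measurableSet
  rw [weightedVolume_restrict_source he hφ, measurableEmbedding_chartEmb.integral_map]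
  refine ((MeasurableEmbedding.subtype_coe hmt).integral_map (μ := chartMeasure e φ)
    (fun y => f (e.symm y))).symm.trans ?_
  rw [map_val_chartMeasure,
    integral_withDensity_eq_integral_toReal_smul₀ (aemeasurable_weightedDensity he hφ)
      (Eventually.of_forall fun _ => ENNReal.ofReal_lt_top)]
  refine setIntegral_congr_fun hmt fun y hy => ?_
  simp only [smul_eq_mul]
  rw [ENNReal.toReal_ofReal (weightedDensity_pos he hy).le]

/-- The density is positive on the target, so the weighted volume and Lebesgue measure have the same
null sets there. -/
theorem aestronglyMeasurable_restrict_source (he : e ∈ IsManifold.maximalAtlas (𝓡 n) ∞ M)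
    (hφ : Continuous φ) {f : M → ℝ} :
    AEStronglyMeasurable f ((weightedVolume n φ).restrict e.source) ↔
      AEStronglyMeasurable (fun y => f (e.symm y)) (volume.restrict e.target) := by
  have hmt := e.open_target.measurableSet
  have h1 : AEStronglyMeasurable f ((weightedVolume n φ).restrict e.source) ↔
      AEStronglyMeasurable (fun y => f (e.symm y)) ((chartMeasure e φ).map Subtype.val) := by
    rw [weightedVolume_restrict_source he hφ,
      measurableEmbedding_chartEmb.aestronglyMeasurable_map_iff,
      (MeasurableEmbedding.subtype_coe hmt).aestronglyMeasurable_map_iff]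
    rfl
  rw [h1, map_val_chartMeasure]
  refine ⟨fun h => h.mono_ac (withDensity_absolutelyContinuous'
    (aemeasurable_weightedDensity he hφ) ?_), fun h => h.mono_ac
      (withDensity_absolutelyContinuous _ _)⟩
  filter_upwards [ae_restrict_mem hmt] with y hy
  simp [weightedDensity_pos he hy]

end ChartMeasure

/-! ### Convergence of mollifications in L^p -/

section Mollification

variable {E : Type*} [NormedAddCommGroup E] [InnerProductSpace ℝ E] [FiniteDimensional ℝ E]
  [MeasurableSpace E] [BorelSpace E]

theorem tendsto_eLpNorm_translate_sub {p : ℝ≥0∞} (hp : 1 ≤ p) (hp' : p ≠ ⊤) {g : E → ℝ}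
    (hg : MemLp g p volume) :
    Tendsto (fun t => eLpNorm (fun x => g (x - t) - g x) p volume) (𝓝 0) (𝓝 0) := by
  have : Fact (1 ≤ p) := ⟨hp⟩
  have : Fact (p ≠ ⊤) := ⟨hp'⟩
  have hc : Continuous fun t : E => (DomAddAct.mk (-t) : Eᵈᵃᵃ) +ᵥ hg.toLp g := by
    have h1 : Continuous fun t : E => (DomAddAct.mk (-t) : Eᵈᵃᵃ) :=
      DomAddAct.continuous_mk.comp continuous_neg
    exact h1.vadd continuous_const
  have hd : Tendsto (fun t : E => edist ((DomAddAct.mk (-t) : Eᵈᵃᵃ) +ᵥ hg.toLp g) (hg.toLp g))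
      (𝓝 0) (𝓝 0) := by
    have := (hc.edist continuous_const).tendsto (f := fun t : E =>
      edist ((DomAddAct.mk (-t) : Eᵈᵃᵃ) +ᵥ hg.toLp g) (hg.toLp g)) 0
    simpa using this
  refine hd.congr fun t => ?_
  rw [DomAddAct.mk_vadd_toLp, Lp.edist_toLp_toLp]
  congr 1
  ext x
  simp [sub_eq_neg_add]

/-- The convolution minus g is the average of g(x - t) - g(x) over the probability measure ρ(t) dt.
The p-th power of the average is at most the average of the p-th powers; integrating in x and
exchanging the integrals leaves the translation moduli for |t| < `rOut`. -/
theorem eLpNorm_convolution_sub_le {p : ℝ} (hp : 1 ≤ p) {g : E → ℝ}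
    (hg : MemLp g (ENNReal.ofReal p) volume) (φ : ContDiffBump (0 : E)) {C : ℝ≥0∞}
    (hC : ∀ t ∈ Metric.ball (0 : E) φ.rOut,
      eLpNorm (fun x => g (x - t) - g x) (ENNReal.ofReal p) volume ≤ C) :
    eLpNorm (fun x => (convolution (φ.normed volume) g (ContinuousLinearMap.lsmul ℝ ℝ) volume) x
      - g x) (ENNReal.ofReal p) volume ≤ C := by
  have hp0 : 0 < p := by linarith
  have hP0 : ENNReal.ofReal p ≠ 0 := by simpa using hp0
  have hP : (ENNReal.ofReal p).toReal = p := ENNReal.toReal_ofReal hp0.le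
  set ρ : E → ℝ := φ.normed volume with hρ
  have hρ0 : ∀ t, 0 ≤ ρ t := φ.nonneg_normed
  have hρc : Continuous ρ := φ.continuous_normed
  have hρi : Integrable ρ volume := φ.integrable_normed
  set ν : Measure E := volume.withDensity fun t => ENNReal.ofReal (ρ t) with hν
  have hprob : IsProbabilityMeasure ν := by
    constructor
    rw [hν, withDensity_apply _ MeasurableSet.univ, Measure.restrict_univ,
      ← ofReal_integral_eq_lintegral_ofReal hρi (Eventually.of_forall hρ0), φ.integral_normed,
      ENNReal.ofReal_one]
  have hloc : LocallyIntegrable g volume := hg.locallyIntegrable (by simpa using hp)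
  have hce : ConvolutionExists ρ g (ContinuousLinearMap.lsmul ℝ ℝ) volume :=
    HasCompactSupport.convolutionExists_left _ φ.hasCompactSupport_normed hρc hloc
  have hgs : ∀ x, AEStronglyMeasurable (fun t => g (x - t) - g x) ν := fun x =>
    ((hg.1.comp_quasiMeasurePreserving
      (quasiMeasurePreserving_sub_left volume x)).sub aestronglyMeasurable_const).mono_ac
        (withDensity_absolutelyContinuous _ _)
  have hpt : ∀ x, ‖convolution ρ g (ContinuousLinearMap.lsmul ℝ ℝ) volume x - g x‖ₑ ^ p ≤
      ∫⁻ t, ENNReal.ofReal (ρ t) * ‖g (x - t) - g x‖ₑ ^ p := by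
    intro x
    have h1 : convolution ρ g (ContinuousLinearMap.lsmul ℝ ℝ) volume x - g x =
        ∫ t, ρ t * (g (x - t) - g x) := by
      have : g x = ∫ t, ρ t * g x := by
        rw [integral_mul_const, φ.integral_normed, one_mul]
      conv_lhs => rw [this]
      rw [convolution_def, ← integral_sub (hce x) (hρi.mul_const _)]
      simp [mul_sub]
    have h2 : ‖∫ t, ρ t * (g (x - t) - g x)‖ₑ ≤ eLpNorm (fun t => g (x - t) - g x) 1 ν := by
      refine (enorm_integral_le_lintegral_enorm _).trans (le_of_eq ?_)
      rw [eLpNorm_one_eq_lintegral_enorm, hν, lintegral_withDensity_eq_lintegral_mul_non_measurable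
        _ hρc.measurable.ennreal_ofReal (Eventually.of_forall fun _ => ENNReal.ofReal_lt_top)]
      refine lintegral_congr fun t => ?_
      rw [enorm_mul, Pi.mul_apply, Real.enorm_of_nonneg (hρ0 t)]
    have h3 : eLpNorm (fun t => g (x - t) - g x) 1 ν ≤
        eLpNorm (fun t => g (x - t) - g x) (ENNReal.ofReal p) ν :=
      eLpNorm_le_eLpNorm_of_exponent_le (by simpa using hp) (hgs x)
    rw [h1]
    refine (ENNReal.rpow_le_rpow (h2.trans h3) hp0.le).trans (le_of_eq ?_)
    rw [eLpNorm_eq_lintegral_rpow_enorm_toReal hP0 ENNReal.ofReal_ne_top, hP, ← ENNReal.rpow_mul,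
      one_div, inv_mul_cancel₀ hp0.ne', ENNReal.rpow_one, hν,
      lintegral_withDensity_eq_lintegral_mul_non_measurable
        _ hρc.measurable.ennreal_ofReal (Eventually.of_forall fun _ => ENNReal.ofReal_lt_top)]
    rfl
  have hmeas : AEMeasurable (Function.uncurry fun x t =>
      ENNReal.ofReal (ρ t) * ‖g (x - t) - g x‖ₑ ^ p) ((volume : Measure E).prod volume) := by
    have h1 : AEStronglyMeasurable (fun z : E × E => g (z.1 - z.2)) (volume.prod volume) :=
      hg.1.comp_quasiMeasurePreserving (quasiMeasurePreserving_sub volume volume)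
    have h2 : AEStronglyMeasurable (fun z : E × E => g z.1) (volume.prod volume) :=
      hg.1.comp_quasiMeasurePreserving Measure.quasiMeasurePreserving_fst
    exact (hρc.measurable.ennreal_ofReal.comp measurable_snd).aemeasurable.mul
      ((h1.sub h2).enorm.pow_const p)
  rw [eLpNorm_eq_lintegral_rpow_enorm_toReal hP0 ENNReal.ofReal_ne_top, hP]
  have hfin : ∫⁻ x, ‖convolution ρ g (ContinuousLinearMap.lsmul ℝ ℝ) volume x - g x‖ₑ ^ p ≤ C ^ p := by
    calc ∫⁻ x, ‖convolution ρ g (ContinuousLinearMap.lsmul ℝ ℝ) volume x - g x‖ₑ ^ p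
        ≤ ∫⁻ x, ∫⁻ t, ENNReal.ofReal (ρ t) * ‖g (x - t) - g x‖ₑ ^ p := lintegral_mono hpt
      _ = ∫⁻ t, ∫⁻ x, ENNReal.ofReal (ρ t) * ‖g (x - t) - g x‖ₑ ^ p :=
          lintegral_lintegral_swap hmeas
      _ = ∫⁻ t, ENNReal.ofReal (ρ t) * ∫⁻ x, ‖g (x - t) - g x‖ₑ ^ p := by
          refine lintegral_congr fun t => ?_
          rw [lintegral_const_mul' _ _ ENNReal.ofReal_ne_top]
      _ ≤ ∫⁻ t, ENNReal.ofReal (ρ t) * C ^ p := by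
          refine lintegral_mono fun t => ?_
          by_cases ht : t ∈ Metric.ball (0 : E) φ.rOut
          · have := ENNReal.rpow_le_rpow (hC t ht) hp0.le
            rw [eLpNorm_eq_lintegral_rpow_enorm_toReal hP0 ENNReal.ofReal_ne_top, hP,
              ← ENNReal.rpow_mul, one_div, inv_mul_cancel₀ hp0.ne', ENNReal.rpow_one] at this
            dsimp only
            gcongr
          · have : ρ t = 0 := by
              rw [← Function.notMem_support, hρ, φ.support_normed_eq]; exact ht
            simp [this]
      _ = C ^ p := by
          rw [lintegral_mul_const _ hρc.measurable.ennreal_ofReal,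
            ← ofReal_integral_eq_lintegral_ofReal hρi (Eventually.of_forall hρ0), φ.integral_normed,
            ENNReal.ofReal_one, one_mul]
  refine (ENNReal.rpow_le_rpow hfin (by positivity)).trans (le_of_eq ?_)
  rw [← ENNReal.rpow_mul, one_div, mul_inv_cancel₀ hp0.ne', ENNReal.rpow_one]

/-- Mollifications converge in `L^p`. -/
theorem tendsto_eLpNorm_convolution_sub {p : ℝ} (hp : 1 ≤ p) {g : E → ℝ}
    (hg : MemLp g (ENNReal.ofReal p) volume) {φ : ℕ → ContDiffBump (0 : E)}
    (hφ : Tendsto (fun k => (φ k).rOut) atTop (𝓝 0)) :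
    Tendsto (fun k => eLpNorm (fun x => (convolution ((φ k).normed volume) g
      (ContinuousLinearMap.lsmul ℝ ℝ) volume) x - g x) (ENNReal.ofReal p) volume)
      atTop (𝓝 0) := by
  rw [ENNReal.tendsto_nhds_zero]
  intro ε hε
  have h := ENNReal.tendsto_nhds_zero.1
    (tendsto_eLpNorm_translate_sub (by simpa using hp) ENNReal.ofReal_ne_top hg) ε hε
  obtain ⟨δ, hδ, hδ'⟩ := Metric.eventually_nhds_iff_ball.1 h
  filter_upwards [hφ.eventually (gt_mem_nhds hδ)] with k hk
  exact eLpNorm_convolution_sub_le hp hg (φ k) fun t ht =>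
    hδ' t (Metric.ball_subset_ball hk.le ht)

end Mollification

/-! ### Hölder pairings -/

section Pairing

variable {α : Type*} [MeasurableSpace α] {μ : Measure α} {p q : ℝ}

theorem integrable_mul_of_memLp (hpq : p.HolderConjugate q) {f g : α → ℝ}
    (hf : MemLp f (ENNReal.ofReal p) μ) (hg : MemLp g (ENNReal.ofReal q) μ) :
    Integrable (fun x => f x * g x) μ := by
  have := hpq.ennrealOfReal
  exact hf.integrable_mul hg

theorem abs_integral_mul_le (hpq : p.HolderConjugate q) {f g : α → ℝ}
    (hf : MemLp f (ENNReal.ofReal p) μ) (hg : MemLp g (ENNReal.ofReal q) μ) :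
    |∫ x, f x * g x ∂μ| ≤ (eLpNorm f (ENNReal.ofReal p) μ).toReal *
      (eLpNorm g (ENNReal.ofReal q) μ).toReal := by
  have := hpq.ennrealOfReal
  have h1 : ‖∫ x, f x * g x ∂μ‖ₑ ≤
      eLpNorm f (ENNReal.ofReal p) μ * eLpNorm g (ENNReal.ofReal q) μ := by
    refine (enorm_integral_le_lintegral_enorm _).trans ?_
    rw [← eLpNorm_one_eq_lintegral_enorm]
    have h := eLpNorm_smul_le_mul_eLpNorm (p := ENNReal.ofReal p) (q := ENNReal.ofReal q) (r := 1)
      hg.1 hf.1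
    exact h
  have h2 := ENNReal.toReal_mono (ENNReal.mul_ne_top hf.2.ne hg.2.ne) h1
  rwa [ENNReal.toReal_mul, toReal_enorm, Real.norm_eq_abs] at h2

/-- Hölder's inequality on each term of f g - f₀ g₀ = (f - f₀)(g - g₀) + (f - f₀) g₀ + f₀ (g - g₀).
-/
theorem tendsto_integral_mul {ι : Type*} {l : Filter ι} (hpq : p.HolderConjugate q)
    {f : ι → α → ℝ} {g : ι → α → ℝ} {f₀ g₀ : α → ℝ}
    (hf : ∀ᶠ i in l, MemLp (f i) (ENNReal.ofReal p) μ)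
    (hg : ∀ᶠ i in l, MemLp (g i) (ENNReal.ofReal q) μ)
    (hf₀ : MemLp f₀ (ENNReal.ofReal p) μ) (hg₀ : MemLp g₀ (ENNReal.ofReal q) μ)
    (hft : Tendsto (fun i => eLpNorm (fun x => f i x - f₀ x) (ENNReal.ofReal p) μ) l (𝓝 0))
    (hgt : Tendsto (fun i => eLpNorm (fun x => g i x - g₀ x) (ENNReal.ofReal q) μ) l (𝓝 0)) :
    Tendsto (fun i => ∫ x, f i x * g i x ∂μ) l (𝓝 (∫ x, f₀ x * g₀ x ∂μ)) := by
  rw [tendsto_iff_norm_sub_tendsto_zero]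
  have h1 := (ENNReal.tendsto_toReal ENNReal.zero_ne_top).comp hft
  have h2 := (ENNReal.tendsto_toReal ENNReal.zero_ne_top).comp hgt
  simp only [ENNReal.toReal_zero] at h1 h2
  have hlim := ((h1.mul h2).add (h1.mul_const (eLpNorm g₀ (ENNReal.ofReal q) μ).toReal)).add
    (h2.const_mul (eLpNorm f₀ (ENNReal.ofReal p) μ).toReal)
  simp only [mul_zero, zero_mul, add_zero] at hlim
  refine squeeze_zero' (Eventually.of_forall fun _ => norm_nonneg _) ?_ hlim
  filter_upwards [hf, hg] with i hfi hgi
  have hfd := hfi.sub hf₀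
  have hgd := hgi.sub hg₀
  have heq : ∫ x, f i x * g i x ∂μ - ∫ x, f₀ x * g₀ x ∂μ =
      (∫ x, (f i x - f₀ x) * (g i x - g₀ x) ∂μ + ∫ x, (f i x - f₀ x) * g₀ x ∂μ) +
        ∫ x, f₀ x * (g i x - g₀ x) ∂μ := by
    have e1 := integrable_mul_of_memLp hpq hfd hgd
    have e2 := integrable_mul_of_memLp hpq hfd hg₀
    have e3 := integrable_mul_of_memLp hpq hf₀ hgd
    simp only [Pi.sub_apply] at e1 e2 e3
    have e12 : Integrable (fun x => (f i x - f₀ x) * (g i x - g₀ x) + (f i x - f₀ x) * g₀ x) μ :=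
      e1.add e2
    rw [← integral_add e1 e2, ← integral_add e12 e3, ← integral_sub
      (integrable_mul_of_memLp hpq hfi hgi) (integrable_mul_of_memLp hpq hf₀ hg₀)]
    congr 1
    ext x
    ring
  rw [heq, Real.norm_eq_abs]
  exact (abs_add_le _ _).trans (add_le_add ((abs_add_le _ _).trans (add_le_add
    (abs_integral_mul_le hpq hfd hgd) (abs_integral_mul_le hpq hfd hg₀)))
    (abs_integral_mul_le hpq hf₀ hgd))

end Pairing

/-! ### Testing a weak divergence equation in a Euclidean domain -/

section Local

variable {E : Type*} [NormedAddCommGroup E] [InnerProductSpace ℝ E] [FiniteDimensional ℝ E]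
  [MeasurableSpace E] [BorelSpace E]

/-- `F` is the weak derivative of `f` in the direction `w` on `Ω`. -/
def IsWeakDeriv (Ω : Set E) (w : E) (f F : E → ℝ) : Prop :=
  ∀ ψ : E → ℝ, ContDiff ℝ ∞ ψ → HasCompactSupport ψ → tsupport ψ ⊆ Ω →
    ∫ y in Ω, f y * fderiv ℝ ψ y w = -∫ y in Ω, F y * ψ y

theorem fderiv_convolution_apply {ρ g : E → ℝ} (hρ : ContDiff ℝ ∞ ρ) (hρs : HasCompactSupport ρ)
    (hg : LocallyIntegrable g volume) (x w : E) :
    fderiv ℝ (convolution ρ g (ContinuousLinearMap.lsmul ℝ ℝ) volume) x w =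
      ∫ t, fderiv ℝ ρ t w * g (x - t) := by
  have hder := hρs.hasFDerivAt_convolution_left (ContinuousLinearMap.lsmul ℝ ℝ)
    (hρ.of_le (by simp)) hg x
  have hce := HasCompactSupport.convolutionExists_left (ContinuousLinearMap.precompL E
      (ContinuousLinearMap.lsmul ℝ ℝ)) (hρs.fderiv ℝ) (hρ.continuous_fderiv (by simp)) hg x
  rw [hder.fderiv]
  exact ContinuousLinearMap.integral_apply hce w
-- The weak derivative is tested with z ↦ ρ(x - z). Its support lies in K by the hypothesis on the
-- ball, so cutting f and F off outside K changes nothing at x.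
theorem fderiv_mollification {Ω K : Set E} {w : E} {f F : E → ℝ}
    (hF : IsWeakDeriv Ω w f F) (hK : MeasurableSet K) (hKΩ : K ⊆ Ω)
    (hfK : IntegrableOn f K volume) (φ : ContDiffBump (0 : E)) {x : E}
    (hx : Metric.closedBall x φ.rOut ⊆ K) :
    fderiv ℝ (convolution (φ.normed volume) (K.indicator f) (ContinuousLinearMap.lsmul ℝ ℝ)
      volume) x w =
      convolution (φ.normed volume) (K.indicator F) (ContinuousLinearMap.lsmul ℝ ℝ) volume x := by
  set ρ : E → ℝ := φ.normed volume with hρ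
  have hρd : ContDiff ℝ ∞ ρ := φ.contDiff_normed
  have hρs : HasCompactSupport ρ := φ.hasCompactSupport_normed
  have hloc : LocallyIntegrable (K.indicator f) volume :=
    ((integrable_indicator_iff hK).2 hfK).locallyIntegrable
  set ψ : E → ℝ := fun z => ρ (x - z) with hψ
  have hψd : ContDiff ℝ ∞ ψ := hρd.comp (contDiff_const.sub contDiff_id)
  have hψf : ∀ z, fderiv ℝ ψ z w = -fderiv ℝ ρ (x - z) w := by
    intro z
    have h1 : HasFDerivAt ρ (fderiv ℝ ρ (x - z)) (x - z) :=
      (hρd.differentiable (by simp) _).hasFDerivAt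
    have h2 : HasFDerivAt ψ _ z := h1.comp z ((hasFDerivAt_id z).const_sub x)
    rw [h2.fderiv]
    simp
  have hψsupp : Function.support ψ ⊆ Metric.closedBall x φ.rOut := by
    intro z hz
    have : x - z ∈ Function.support ρ := hz
    rw [hρ, φ.support_normed_eq, mem_ball_zero_iff] at this
    rw [mem_closedBall_iff_norm, norm_sub_rev]
    exact this.le
  have hψt : tsupport ψ ⊆ Metric.closedBall x φ.rOut :=
    closure_minimal hψsupp Metric.isClosed_closedBall
  have hψc : HasCompactSupport ψ :=
    HasCompactSupport.of_support_subset_isCompact (isCompact_closedBall x φ.rOut) hψsupp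
  have e0 : ∫ t, fderiv ℝ ρ t w * K.indicator f (x - t) =
      ∫ z, fderiv ℝ ρ (x - z) w * K.indicator f z := by
    rw [← integral_sub_left_eq_self (fun t => fderiv ℝ ρ t w * K.indicator f (x - t)) volume x]
    simp only [sub_sub_cancel]
  have hw := hF ψ hψd hψc (hψt.trans (hx.trans hKΩ))
  have e1 : ∫ z, fderiv ℝ ρ (x - z) w * K.indicator f z = -∫ z in Ω, f z * fderiv ℝ ψ z w := by
    rw [setIntegral_eq_integral_of_forall_compl_eq_zero, ← integral_neg]
    · congr 1
      ext z
      by_cases hz : z ∈ K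
      · rw [indicator_of_mem hz, hψf]; ring
      · have : fderiv ℝ ψ z = 0 := by
          by_contra h
          exact hz (hx (hψt (support_fderiv_subset ℝ h)))
        rw [indicator_of_notMem hz, this]; simp
    · intro z hz
      have : fderiv ℝ ψ z = 0 := by
        by_contra h
        exact hz (hKΩ (hx (hψt (support_fderiv_subset ℝ h))))
      rw [this]; simp
  have e2 : ∫ t, ρ t * K.indicator F (x - t) = ∫ z, ρ (x - z) * K.indicator F z := by
    rw [← integral_sub_left_eq_self (fun t => ρ t * K.indicator F (x - t)) volume x]
    simp only [sub_sub_cancel]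
  rw [fderiv_convolution_apply hρd hρs hloc, e0, e1, hw, neg_neg, convolution_def]
  simp only [ContinuousLinearMap.lsmul_apply, smul_eq_mul]
  rw [e2, setIntegral_eq_integral_of_forall_compl_eq_zero]
  · congr 1
    ext z
    by_cases hz : z ∈ K
    · rw [indicator_of_mem hz, mul_comm]
    · have : ψ z = 0 := by
        by_contra h
        exact hz (hx (hψsupp h))
      rw [indicator_of_notMem hz, this]; simp
  · intro z hz
    have : ψ z = 0 := by
      by_contra h
      exact hz (hKΩ (hx (hψsupp h)))
    rw [this, mul_zero]

set_option maxHeartbeats 2000000 in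
/-- If `div W = h` weakly on `Ω` then the equation can be tested with `ζ T(f)`, `f` being a
function with weak derivatives. -/
theorem weak_divergence_comp {ι : Type*} [Fintype ι] {Ω : Set E} (hΩ : IsOpen Ω) {p q : ℝ}
    (hpq : p.HolderConjugate q) (b : ι → E) {h f : E → ℝ} {W F : ι → E → ℝ}
    (hh : LocallyIntegrableOn h Ω volume)
    (hW : ∀ i, ∀ K ⊆ Ω, IsCompact K → MemLp (W i) (ENNReal.ofReal q) (volume.restrict K))
    (hf : LocallyIntegrableOn f Ω volume)
    (hF : ∀ i, ∀ K ⊆ Ω, IsCompact K → MemLp (F i) (ENNReal.ofReal p) (volume.restrict K))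
    (hweak : ∀ i, IsWeakDeriv Ω (b i) f (F i))
    (hdiv : ∀ ψ : E → ℝ, ContDiff ℝ ∞ ψ → HasCompactSupport ψ → tsupport ψ ⊆ Ω →
      ∫ y in Ω, h y * ψ y = -∫ y in Ω, ∑ i, W i y * fderiv ℝ ψ y (b i))
    {T : ℝ → ℝ} (hT : ContDiff ℝ ∞ T) {C : ℝ} (hTC : ∀ s, |T s| ≤ C)
    (hTC' : ∀ s, |deriv T s| ≤ C) {ζ : E → ℝ} (hζ : ContDiff ℝ ∞ ζ) (hζc : HasCompactSupport ζ)
    (hζΩ : tsupport ζ ⊆ Ω) :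
    ∫ y in Ω, h y * (ζ y * T (f y)) =
      -∫ y in Ω, ∑ i, W i y * (ζ y * deriv T (f y) * F i y + T (f y) * fderiv ℝ ζ y (b i)) := by
  have hC : 0 ≤ C := (abs_nonneg _).trans (hTC 0)
  set K := tsupport ζ with hKdef
  have hKc : IsCompact K := hζc
  have hKm : MeasurableSet K := (isClosed_tsupport ζ).measurableSet
  obtain ⟨δ, hδ, hδΩ⟩ := hKc.exists_cthickening_subset_open hΩ hζΩ
  -- The data are only local on Ω. Cut off to a compact neighbourhood of the support of ζ they
  -- become global, and bump radii at most δ keep the mollifications on K unaffected by the cut.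
  set K' := Metric.cthickening δ K with hK'
  have hK'c : IsCompact K' := hKc.cthickening
  have hK'm : MeasurableSet K' := hK'c.isClosed.measurableSet
  have hKK' : K ⊆ K' := Metric.self_subset_cthickening K
  -- The ratio of the two radii is always 2: almost everywhere convergence of the mollifications
  -- requires it to stay bounded.
  let φ : ℕ → ContDiffBump (0 : E) := fun k =>
    ⟨δ / (k + 1) / 2, δ / (k + 1), by positivity, half_lt_self (by positivity)⟩
  have hφout : ∀ k, (φ k).rOut = δ / ((k : ℝ) + 1) := fun k => rfl
  have hφle : ∀ k, (φ k).rOut ≤ δ := fun k => by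
    rw [hφout]
    exact div_le_self hδ.le (by linarith [(Nat.cast_nonneg k : (0 : ℝ) ≤ k)])
  have hφ0 : Tendsto (fun k => (φ k).rOut) atTop (𝓝 0) := by
    simp only [hφout]
    simpa using (tendsto_one_div_add_atTop_nhds_zero_nat (𝕜 := ℝ)).const_mul δ |>.congr
      (fun k => by ring)
  have hball : ∀ x ∈ K, ∀ k, Metric.closedBall x (φ k).rOut ⊆ K' := fun x hx k z hz =>
    Metric.mem_cthickening_of_dist_le z x δ K hx ((Metric.mem_closedBall.1 hz).trans (hφle k))
  have hfK' : IntegrableOn f K' volume := hf.integrableOn_compact_subset hδΩ hK'c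
  have hf1 : Integrable (K'.indicator f) volume := (integrable_indicator_iff hK'm).2 hfK'
  have hF1 : ∀ i, MemLp (K'.indicator (F i)) (ENNReal.ofReal p) volume := fun i =>
    (memLp_indicator_iff_restrict hK'm).2 (hF i K' hδΩ hK'c)
  let v : ℕ → E → ℝ := fun k =>
    convolution ((φ k).normed volume) (K'.indicator f) (ContinuousLinearMap.lsmul ℝ ℝ) volume
  let G : ℕ → ι → E → ℝ := fun k i =>
    convolution ((φ k).normed volume) (K'.indicator (F i)) (ContinuousLinearMap.lsmul ℝ ℝ) volume
  have hvd : ∀ k, ContDiff ℝ ∞ (v k) := fun k =>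
    (φ k).hasCompactSupport_normed.contDiff_convolution_left _ (φ k).contDiff_normed
      hf1.locallyIntegrable
  have hGd : ∀ k i, ContDiff ℝ ∞ (G k i) := fun k i =>
    (φ k).hasCompactSupport_normed.contDiff_convolution_left _ (φ k).contDiff_normed
      ((hF1 i).locallyIntegrable (by simpa using hpq.lt.le))
  have hGc : ∀ k i, Continuous (G k i) := fun k i => (hGd k i).continuous
  have hvG : ∀ k i, ∀ y ∈ K, fderiv ℝ (v k) y (b i) = G k i y := fun k i y hy =>
    fderiv_mollification (hweak i) hK'm hδΩ hfK' (φ k) (hball y hy k)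
  have hvae : ∀ᵐ y ∂volume.restrict K, Tendsto (fun k => v k y) atTop (𝓝 (f y)) := by
    have := ContDiffBump.ae_convolution_tendsto_right_of_locallyIntegrable (K := 2) hφ0
      (Eventually.of_forall fun k => le_of_eq (by
        change δ / ((k : ℝ) + 1) = 2 * (δ / (k + 1) / 2); ring)) hf1.locallyIntegrable (μ := volume)
    filter_upwards [ae_restrict_of_ae this, ae_restrict_mem hKm] with y hy hyK
    rwa [indicator_of_mem (hKK' hyK)] at hy
  obtain ⟨Cζ, hCζ⟩ := hζ.continuous.bounded_above_of_compact_support hζc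
  simp only [Real.norm_eq_abs] at hCζ
  have hCζ0 : 0 ≤ Cζ := (abs_nonneg _).trans (hCζ 0)
  have hTd : ∀ s, HasDerivAt T (deriv T s) s := fun s =>
    (hT.differentiable (by simp) s).hasDerivAt
  have hT'c : Continuous (deriv T) := hT.continuous_deriv (by simp)
  have hζ0 : ∀ y ∉ K, ζ y = 0 := fun y hy => image_eq_zero_of_notMem_tsupport hy
  have hζ'0 : ∀ y ∉ K, fderiv ℝ ζ y = 0 := fun y hy => by
    by_contra h
    exact hy (support_fderiv_subset ℝ h)
  have hΩm := hΩ.measurableSet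
  -- the tested equation
  have htest : ∀ k, ∫ y in K, h y * (ζ y * T (v k y)) =
      -∫ y in K, ∑ i, W i y * (ζ y * deriv T (v k y) * G k i y +
        T (v k y) * fderiv ℝ ζ y (b i)) := by
    intro k
    have hs : Function.support (fun y => ζ y * T (v k y)) ⊆ Function.support ζ :=
      Function.support_mul_subset_left _ _
    have hts : tsupport (fun y => ζ y * T (v k y)) ⊆ K := closure_mono hs
    have := hdiv (fun y => ζ y * T (v k y)) (hζ.mul (hT.comp (hvd k)))
      (hζc.mul_right) (hts.trans hζΩ)
    have hfd : ∀ y w, fderiv ℝ (fun y => ζ y * T (v k y)) y w =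
        ζ y * deriv T (v k y) * fderiv ℝ (v k) y w + T (v k y) * fderiv ℝ ζ y w := by
      intro y w
      have h1 : HasFDerivAt ζ (fderiv ℝ ζ y) y := (hζ.differentiable (by simp) y).hasFDerivAt
      have h2 : HasFDerivAt (v k) (fderiv ℝ (v k) y) y :=
        ((hvd k).differentiable (by simp) y).hasFDerivAt
      have h3 := h1.mul ((hTd (v k y)).comp_hasFDerivAt y h2)
      have h4 : fderiv ℝ (fun y => ζ y * T (v k y)) y = _ := h3.fderiv
      rw [h4]
      simp
      ring
    rw [setIntegral_eq_of_subset_of_forall_sdiff_eq_zero hΩm hζΩ,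
      setIntegral_eq_of_subset_of_forall_sdiff_eq_zero hΩm hζΩ] at this
    · rw [this]
      congr 1
      refine setIntegral_congr_fun hKm fun y hy => ?_
      refine Finset.sum_congr rfl fun i _ => ?_
      rw [hfd, hvG k i y hy]
    · intro y hy
      refine Finset.sum_eq_zero fun i _ => ?_
      rw [hfd, hζ0 y hy.2, hζ'0 y hy.2]
      simp
    · intro y hy
      rw [hζ0 y hy.2]
      simp
  -- passing to the limit
  have hhK : Integrable h (volume.restrict K) := hh.integrableOn_compact_subset hζΩ hKc
  have hvm : ∀ k, AEStronglyMeasurable (v k) (volume.restrict K) := fun k =>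
    (hvd k).continuous.aestronglyMeasurable
  have hfm : AEStronglyMeasurable f (volume.restrict K) := (hfK'.mono_set hKK').1
  have hζm : AEStronglyMeasurable ζ (volume.restrict K) := hζ.continuous.aestronglyMeasurable
  have lim1 : Tendsto (fun k => ∫ y in K, h y * (ζ y * T (v k y))) atTop
      (𝓝 (∫ y in K, h y * (ζ y * T (f y)))) := by
    refine tendsto_integral_of_dominated_convergence (fun y => |h y| * (Cζ * C)) (fun k => ?_)
      (hhK.abs.mul_const _) (fun k => Eventually.of_forall fun y => ?_) ?_
    · exact hhK.1.mul (hζm.mul (hT.continuous.comp_aestronglyMeasurable (hvm k)))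
    · rw [Real.norm_eq_abs, abs_mul, abs_mul]
      gcongr
      exacts [hCζ y, hTC _]
    · filter_upwards [hvae] with y hy
      exact ((hT.continuous.tendsto _).comp hy).const_mul _ |>.const_mul _
  have hWK : ∀ i, MemLp (W i) (ENNReal.ofReal q) (volume.restrict K) := fun i => hW i K hζΩ hKc
  have hFK : ∀ i, MemLp (F i) (ENNReal.ofReal p) (volume.restrict K) := fun i => hF i K hζΩ hKc
  have hWi : ∀ i, Integrable (W i) (volume.restrict K) := fun i => by
    have : IsFiniteMeasure (volume.restrict K) := ⟨by simpa using hKc.measure_lt_top⟩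
    exact (hWK i).integrable (by simpa using hpq.symm.lt.le)
  have hWF : ∀ i, Integrable (fun y => F i y * W i y) (volume.restrict K) := fun i =>
    integrable_mul_of_memLp hpq (hFK i) (hWK i)
  have hGF : ∀ i, Tendsto (fun k => eLpNorm (fun y => G k i y - F i y) (ENNReal.ofReal p)
      (volume.restrict K)) atTop (𝓝 0) := by
    intro i
    have := tendsto_eLpNorm_convolution_sub hpq.lt.le (hF1 i) hφ0
    refine tendsto_of_tendsto_of_tendsto_of_le_of_le tendsto_const_nhds this (fun _ => zero_le)
      fun k => ?_
    refine le_trans (le_of_eq (eLpNorm_congr_ae ?_))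
      (eLpNorm_mono_measure _ Measure.restrict_le_self)
    filter_upwards [ae_restrict_mem hKm] with y hy
    rw [indicator_of_mem (hKK' hy)]
  have hGm : ∀ k i, MemLp (fun y => G k i y - F i y) (ENNReal.ofReal p) (volume.restrict K) := by
    intro k i
    refine MemLp.sub ?_ (hFK i)
    have : IsFiniteMeasure (volume.restrict K) := ⟨by simpa using hKc.measure_lt_top⟩
    obtain ⟨B, hB⟩ := hKc.exists_bound_of_continuousOn (hGc k i).continuousOn
    exact MemLp.of_bound (hGc k i).aestronglyMeasurable B
      ((ae_restrict_mem hKm).mono fun y hy => hB y hy)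
  have hDm : ∀ k, AEStronglyMeasurable (fun y => ζ y * deriv T (v k y)) (volume.restrict K) :=
    fun k => hζm.mul (hT'c.comp_aestronglyMeasurable (hvm k))
  have hbd : ∀ k y, |ζ y * deriv T (v k y)| ≤ Cζ * C := fun k y => by
    rw [abs_mul]
    exact mul_le_mul (hCζ y) (hTC' _) (abs_nonneg _) hCζ0
  have hPm : ∀ k i, MemLp (fun y => ζ y * deriv T (v k y) * (G k i y - F i y)) (ENNReal.ofReal p)
      (volume.restrict K) := fun k i => by
    refine (hGm k i).of_le_mul (c := Cζ * C) ((hDm k).mul (hGm k i).1)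
      (Eventually.of_forall fun y => ?_)
    rw [norm_mul]
    gcongr
    exact hbd k y
  -- The product ζ T'(v_k) G_k W is split as ζ T'(v_k) (G_k - F) W + ζ T'(v_k) F W. The first part
  -- tends to 0 by Hölder, since G_k → F in L^p and the other factor is bounded. In the second part,
  -- and in the term with the derivative of ζ, only v_k varies and dominated convergence applies.
  have limA : ∀ i, Tendsto (fun k => ∫ y in K, ζ y * deriv T (v k y) * (G k i y - F i y) * W i y)
      atTop (𝓝 0) := by
    intro i
    have hz : Tendsto (fun k => eLpNorm (fun y => ζ y * deriv T (v k y) * (G k i y - F i y) - 0)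
        (ENNReal.ofReal p) (volume.restrict K)) atTop (𝓝 0) := by
      have hl := ENNReal.Tendsto.const_mul (a := ENNReal.ofReal (Cζ * C)) (hGF i)
        (Or.inr ENNReal.ofReal_ne_top)
      rw [mul_zero] at hl
      refine tendsto_of_tendsto_of_tendsto_of_le_of_le tendsto_const_nhds hl (fun _ => zero_le)
        fun k => ?_
      refine eLpNorm_le_mul_eLpNorm_of_ae_le_mul (Eventually.of_forall fun y => ?_) _
      rw [sub_zero, norm_mul]
      gcongr
      exact hbd k y
    have := tendsto_integral_mul (g := fun _ => W i) (f₀ := fun _ => 0) hpq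
      (Eventually.of_forall fun k => hPm k i) (Eventually.of_forall fun _ => hWK i)
      MemLp.zero' (hWK i) hz (by simp)
    simpa using this
  have limB : ∀ i, Tendsto (fun k => ∫ y in K, ζ y * deriv T (v k y) * (F i y * W i y))
      atTop (𝓝 (∫ y in K, ζ y * deriv T (f y) * (F i y * W i y))) := by
    intro i
    refine tendsto_integral_of_dominated_convergence (fun y => Cζ * C * |F i y * W i y|)
      (fun k => (hDm k).mul (hWF i).1) ((hWF i).abs.const_mul _)
      (fun k => Eventually.of_forall fun y => ?_) ?_
    · rw [norm_mul, Real.norm_eq_abs, Real.norm_eq_abs]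
      gcongr
      exact hbd k y
    · filter_upwards [hvae] with y hy
      exact (((hT'c.tendsto _).comp hy).const_mul _).mul_const _
  have hζ'm : ∀ i, AEStronglyMeasurable (fun y => fderiv ℝ ζ y (b i)) (volume.restrict K) :=
    fun i => ((hζ.continuous_fderiv (by simp)).clm_apply continuous_const).aestronglyMeasurable
  have hζ'b : ∀ i, ∃ B, ∀ y, |fderiv ℝ ζ y (b i)| ≤ B := fun i => by
    obtain ⟨B, hB⟩ := ((hζ.continuous_fderiv (by simp)).clm_apply
      (continuous_const (y := b i))).bounded_above_of_compact_support
        ((hζc.fderiv ℝ).comp_left (g := fun L : E →L[ℝ] ℝ => L (b i)) rfl)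
    exact ⟨B, hB⟩
  have limC : ∀ i, Tendsto (fun k => ∫ y in K, T (v k y) * fderiv ℝ ζ y (b i) * W i y)
      atTop (𝓝 (∫ y in K, T (f y) * fderiv ℝ ζ y (b i) * W i y)) := by
    intro i
    obtain ⟨B, hB⟩ := hζ'b i
    refine tendsto_integral_of_dominated_convergence (fun y => C * B * |W i y|)
      (fun k => ((hT.continuous.comp_aestronglyMeasurable (hvm k)).mul (hζ'm i)).mul (hWi i).1)
      ((hWi i).abs.const_mul _) (fun k => Eventually.of_forall fun y => ?_) ?_
    · rw [norm_mul, norm_mul, Real.norm_eq_abs, Real.norm_eq_abs, Real.norm_eq_abs]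
      gcongr
      exacts [hTC _, hB y]
    · filter_upwards [hvae] with y hy
      exact (((hT.continuous.tendsto _).comp hy).mul_const _).mul_const _
  have intA : ∀ k i, Integrable (fun y => ζ y * deriv T (v k y) * (G k i y - F i y) * W i y)
      (volume.restrict K) := fun k i => integrable_mul_of_memLp hpq (hPm k i) (hWK i)
  have intB : ∀ i (g : E → ℝ), AEStronglyMeasurable g (volume.restrict K) →
      Integrable (fun y => ζ y * deriv T (g y) * (F i y * W i y)) (volume.restrict K) := by
    intro i g hg
    refine ((hWF i).const_mul (Cζ * C)).mono
      ((hζm.mul (hT'c.comp_aestronglyMeasurable hg)).mul (hWF i).1)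
      (Eventually.of_forall fun y => ?_)
    rw [norm_mul, norm_mul (Cζ * C), norm_mul, Real.norm_of_nonneg (mul_nonneg hCζ0 hC)]
    gcongr
    exacts [hCζ y, hTC' _]
  have intC : ∀ i (g : E → ℝ), AEStronglyMeasurable g (volume.restrict K) →
      Integrable (fun y => T (g y) * fderiv ℝ ζ y (b i) * W i y) (volume.restrict K) := by
    intro i g hg
    obtain ⟨B, hB⟩ := hζ'b i
    refine ((hWi i).const_mul (C * B)).mono
      (((hT.continuous.comp_aestronglyMeasurable hg).mul (hζ'm i)).mul (hWi i).1)
      (Eventually.of_forall fun y => ?_)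
    rw [norm_mul, norm_mul (C * B), norm_mul, Real.norm_of_nonneg
      (mul_nonneg hC ((abs_nonneg _).trans (hB 0)))]
    gcongr
    exacts [hTC _, hB y]
  have lim2 : Tendsto (fun k => -∫ y in K, ∑ i, W i y * (ζ y * deriv T (v k y) * G k i y +
        T (v k y) * fderiv ℝ ζ y (b i))) atTop
      (𝓝 (-∫ y in K, ∑ i, W i y * (ζ y * deriv T (f y) * F i y +
        T (f y) * fderiv ℝ ζ y (b i)))) := by
    have h1 : ∀ k, ∫ y in K, ∑ i, W i y * (ζ y * deriv T (v k y) * G k i y +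
        T (v k y) * fderiv ℝ ζ y (b i)) = ∑ i,
        ((∫ y in K, ζ y * deriv T (v k y) * (G k i y - F i y) * W i y) +
          (∫ y in K, ζ y * deriv T (v k y) * (F i y * W i y)) +
          ∫ y in K, T (v k y) * fderiv ℝ ζ y (b i) * W i y) := by
      intro k
      have hI : ∀ i, ∫ y in K, W i y * (ζ y * deriv T (v k y) * G k i y +
        T (v k y) * fderiv ℝ ζ y (b i)) =
        ((∫ y in K, ζ y * deriv T (v k y) * (G k i y - F i y) * W i y) +
          (∫ y in K, ζ y * deriv T (v k y) * (F i y * W i y)) +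
          ∫ y in K, T (v k y) * fderiv ℝ ζ y (b i) * W i y) := fun i => by
        have hAB : Integrable (fun y => ζ y * deriv T (v k y) * (G k i y - F i y) * W i y +
            ζ y * deriv T (v k y) * (F i y * W i y)) (volume.restrict K) :=
          (intA k i).add (intB i _ (hvm k))
        rw [← integral_add (intA k i) (intB i _ (hvm k)), ← integral_add hAB (intC i _ (hvm k))]
        congr 1
        ext y
        ring
      rw [integral_finsetSum]
      · exact Finset.sum_congr rfl fun i _ => hI i
      · intro i _
        refine (((intA k i).add (intB i _ (hvm k))).add (intC i _ (hvm k))).congr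
          (Eventually.of_forall fun y => ?_)
        simp only [Pi.add_apply]
        ring
    have h2 : ∫ y in K, ∑ i, W i y * (ζ y * deriv T (f y) * F i y +
        T (f y) * fderiv ℝ ζ y (b i)) = ∑ i,
        (0 + (∫ y in K, ζ y * deriv T (f y) * (F i y * W i y)) +
          ∫ y in K, T (f y) * fderiv ℝ ζ y (b i) * W i y) := by
      rw [integral_finsetSum]
      · refine Finset.sum_congr rfl fun i _ => ?_
        rw [zero_add, ← integral_add (intB i _ hfm) (intC i _ hfm)]
        congr 1
        ext y
        ring
      · intro i _
        refine ((intB i _ hfm).add (intC i _ hfm)).congr (Eventually.of_forall fun y => ?_)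
        simp only [Pi.add_apply]
        ring
    simp_rw [h1]
    rw [h2]
    exact (tendsto_finsetSum _ fun i _ => ((limA i).add (limB i)).add (limC i)).neg
  have hfin := tendsto_nhds_unique (lim1.congr htest) lim2
  rw [setIntegral_eq_of_subset_of_forall_sdiff_eq_zero hΩm hζΩ,
    setIntegral_eq_of_subset_of_forall_sdiff_eq_zero hΩm hζΩ]
  · exact hfin
  · intro y hy
    refine Finset.sum_eq_zero fun i _ => ?_
    rw [hζ0 y hy.2, hζ'0 y hy.2]
    simp
  · intro y hy
    rw [hζ0 y hy.2]
    simp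

end Local

/-! ### Gradients, transplanted test functions, measurability of vector fields -/

section Gradient

set_option linter.unusedSectionVars false

variable {n : ℕ} {M : Type*} [MetricSpace M] [MeasurableSpace M] [BorelSpace M]
  [ChartedSpace (EuclideanSpace ℝ (Fin n)) M] [IsManifold (𝓡 n) ∞ M]
  [RiemannianBundle (fun x : M => TangentSpace (𝓡 n) x)]
variable {e : OpenPartialHomeomorph M (EuclideanSpace ℝ (Fin n))}

theorem inner_grad (f : M → ℝ) (x : M) (V : TangentSpace (𝓡 n) x) :
    inner ℝ (grad n f x) V = (show ℝ from mfderiv (𝓡 n) 𝓘(ℝ, ℝ) f x V) := by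
  have : FiniteDimensional ℝ (TangentSpace (𝓡 n) x) :=
    inferInstanceAs (FiniteDimensional ℝ (EuclideanSpace ℝ (Fin n)))
  have : CompleteSpace (TangentSpace (𝓡 n) x) := FiniteDimensional.complete ℝ _
  exact InnerProductSpace.toDual_symm_apply

theorem inner_grad_coordVector (he : e ∈ IsManifold.maximalAtlas (𝓡 n) ∞ M)
    {y : EuclideanSpace ℝ (Fin n)} (hy : y ∈ e.target) {f : M → ℝ}
    (hf : MDifferentiableAt (𝓡 n) 𝓘(ℝ, ℝ) f (e.symm y)) (w : EuclideanSpace ℝ (Fin n)) :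
    inner ℝ (grad n f (e.symm y)) (coordVector n e y w) =
      fderiv ℝ (fun z => f (e.symm z)) y w := by
  rw [inner_grad]
  have h := mfderiv_comp (I := 𝓡 n) (I' := 𝓡 n) (I'' := 𝓘(ℝ, ℝ)) y (g := f) (f := e.symm) hf
    (mdifferentiableAt_chart_symm he hy)
  rw [← mfderiv_eq_fderiv]
  exact (congrArg (fun L => L w) h).symm

theorem grad_add {f g : M → ℝ} {x : M} (hf : MDifferentiableAt (𝓡 n) 𝓘(ℝ, ℝ) f x)
    (hg : MDifferentiableAt (𝓡 n) 𝓘(ℝ, ℝ) g x) :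
    grad n (fun z => f z + g z) x = grad n f x + grad n g x := by
  refine ext_inner_right ℝ fun V => ?_
  rw [inner_add_left, inner_grad, inner_grad, inner_grad]
  have := mfderiv_add hf hg
  exact congrArg (fun L => L V) this

theorem grad_mul {f g : M → ℝ} {x : M} (hf : MDifferentiableAt (𝓡 n) 𝓘(ℝ, ℝ) f x)
    (hg : MDifferentiableAt (𝓡 n) 𝓘(ℝ, ℝ) g x) :
    grad n (fun z => f z * g z) x = f x • grad n g x + g x • grad n f x := by
  refine ext_inner_right ℝ fun V => ?_
  rw [inner_add_left, real_inner_smul_left, real_inner_smul_left, inner_grad, inner_grad, inner_grad]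
  have := (hf.hasMFDerivAt.mul hg.hasMFDerivAt).mfderiv
  have h2 := congrArg (fun L => L V) this
  exact h2

theorem grad_of_notMem_tsupport {f : M → ℝ} {x : M} (hx : x ∉ tsupport f) : grad n f x = 0 := by
  refine ext_inner_right ℝ fun V => ?_
  rw [inner_grad, inner_zero_left]
  have h : f =ᶠ[𝓝 x] fun _ => 0 := notMem_tsupport_iff_eventuallyEq.1 hx
  have := h.mfderiv_eq (I := 𝓡 n) (I' := 𝓘(ℝ, ℝ))
  rw [this, mfderiv_const]
  rfl


/-- Extension by zero is smooth because the support lies in the image of a compact subset of the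
target, which is closed in M and contained in the chart domain. -/
theorem contMDiff_transplant (he : e ∈ IsManifold.maximalAtlas (𝓡 n) ∞ M)
    {ψ : EuclideanSpace ℝ (Fin n) → ℝ} (hψ : ContDiff ℝ ∞ ψ) (hc : HasCompactSupport ψ)
    (hs : tsupport ψ ⊆ e.target) :
    ContMDiff (𝓡 n) 𝓘(ℝ, ℝ) ∞ (e.source.indicator fun x => ψ (e x)) ∧
      HasCompactSupport (e.source.indicator fun x => ψ (e x)) ∧
      tsupport (e.source.indicator fun x => ψ (e x)) ⊆ e.source := by
  have hK : IsCompact (e.symm '' tsupport ψ) :=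
    hc.isCompact.image_of_continuousOn (e.continuousOn_symm.mono hs)
  have hsub : Function.support (e.source.indicator fun x => ψ (e x)) ⊆ e.symm '' tsupport ψ := by
    intro x hx
    have hxs : x ∈ e.source := by
      by_contra h
      exact hx (indicator_of_notMem h _)
    rw [Function.mem_support, indicator_of_mem hxs] at hx
    exact ⟨e x, subset_tsupport _ hx, e.left_inv hxs⟩
  have hts : tsupport (e.source.indicator fun x => ψ (e x)) ⊆ e.source := by
    refine (closure_minimal hsub hK.isClosed).trans ?_
    rintro _ ⟨y, hy, rfl⟩
    exact e.map_target (hs hy)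
  refine ⟨contMDiff_of_tsupport fun x hx => ?_, HasCompactSupport.of_support_subset_isCompact hK hsub,
    hts⟩
  have hxs := hts hx
  have h1 : ContMDiffAt (𝓡 n) 𝓘(ℝ, ℝ) ∞ (fun x => ψ (e x)) x :=
    hψ.contMDiff.contMDiffAt.comp x
      ((contMDiffOn_chart he).contMDiffAt (e.open_source.mem_nhds hxs))
  refine h1.congr_of_eventuallyEq ?_
  filter_upwards [e.open_source.mem_nhds hxs] with z hz
  exact indicator_of_mem hz _

theorem contDiff_transplant (he : e ∈ IsManifold.maximalAtlas (𝓡 n) ∞ M)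
    {ζ : M → ℝ} (hζ : ContMDiff (𝓡 n) 𝓘(ℝ, ℝ) ∞ ζ) (hc : HasCompactSupport ζ)
    (hs : tsupport ζ ⊆ e.source) :
    ContDiff ℝ ∞ (e.target.indicator fun y => ζ (e.symm y)) ∧
      HasCompactSupport (e.target.indicator fun y => ζ (e.symm y)) ∧
      tsupport (e.target.indicator fun y => ζ (e.symm y)) ⊆ e.target := by
  have hK : IsCompact (e '' tsupport ζ) :=
    hc.isCompact.image_of_continuousOn (e.continuousOn.mono hs)
  have hsub : Function.support (e.target.indicator fun y => ζ (e.symm y)) ⊆ e '' tsupport ζ := by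
    intro y hy
    have hyt : y ∈ e.target := by
      by_contra h
      exact hy (indicator_of_notMem h _)
    rw [Function.mem_support, indicator_of_mem hyt] at hy
    exact ⟨e.symm y, subset_tsupport _ hy, e.right_inv hyt⟩
  have hts : tsupport (e.target.indicator fun y => ζ (e.symm y)) ⊆ e.target := by
    refine (closure_minimal hsub hK.isClosed).trans ?_
    rintro _ ⟨y, hy, rfl⟩
    exact e.map_source (hs hy)
  refine ⟨contMDiff_iff_contDiff.1 (contMDiff_of_tsupport fun y hy => ?_),
    HasCompactSupport.of_support_subset_isCompact hK hsub, hts⟩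
  have hyt := hts hy
  have h1 : ContMDiffAt (𝓡 n) 𝓘(ℝ, ℝ) ∞ (fun y => ζ (e.symm y)) y :=
    hζ.contMDiffAt.comp y
      ((contMDiffOn_chart_symm he).contMDiffAt (e.open_target.mem_nhds hyt))
  refine h1.congr_of_eventuallyEq ?_
  filter_upwards [e.open_target.mem_nhds hyt] with z hz
  exact indicator_of_mem hz _

variable [IsContMDiffRiemannianBundle (𝓡 n) ∞ (EuclideanSpace ℝ (Fin n))
      (fun x : M => TangentSpace (𝓡 n) x)]

/-- The components of the vector field `X` in every smooth chart are measurable. -/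
def ChartMeasurable (X : ∀ x : M, TangentSpace (𝓡 n) x) : Prop :=
  ∀ e ∈ IsManifold.maximalAtlas (𝓡 n) ∞ M, ∀ w : EuclideanSpace ℝ (Fin n),
    AEStronglyMeasurable (fun y => inner ℝ (X (e.symm y)) (coordVector n e y w))
      (volume.restrict e.target)

theorem IsWeakGrad.chartMeasurable {f : M → ℝ} {X : ∀ x : M, TangentSpace (𝓡 n) x}
    (h : IsWeakGrad n f X) : ChartMeasurable X := fun e he w =>
  (h.locInt_grad e he w).aestronglyMeasurable

variable {φ : M → ℝ} {X Y : ∀ x : M, TangentSpace (𝓡 n) x}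

theorem ChartMeasurable.smul (hX : ChartMeasurable X) (hφ : Continuous φ) {f : M → ℝ}
    (hf : AEStronglyMeasurable f (weightedVolume n φ)) :
    ChartMeasurable (fun x => f x • X x) := by
  intro e he w
  simp only [real_inner_smul_left]
  exact ((aestronglyMeasurable_restrict_source he hφ).1 hf.restrict).mul (hX e he w)

theorem chartMeasurable_grad {f : M → ℝ} (hf : ContMDiff (𝓡 n) 𝓘(ℝ, ℝ) ∞ f) :
    ChartMeasurable (grad n f) := by
  intro e he w
  have h1 : ContDiffOn ℝ ∞ (fun z => f (e.symm z)) e.target := by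
    have := hf.comp_contMDiffOn (contMDiffOn_chart_symm he)
    exact contMDiffOn_iff_contDiffOn.1 this
  have h2 : ContinuousOn (fun y => fderiv ℝ (fun z => f (e.symm z)) y w) e.target :=
    (h1.continuousOn_fderiv_of_isOpen e.open_target (by simp)).clm_apply continuousOn_const
  refine (h2.aestronglyMeasurable e.open_target.measurableSet).congr ?_
  filter_upwards [ae_restrict_mem e.open_target.measurableSet] with y hy
  exact (inner_grad_coordVector he hy (hf.mdifferentiable (by simp) _) w).symm

theorem aestronglyMeasurable_components (hX : ChartMeasurable X)
    (he : e ∈ IsManifold.maximalAtlas (𝓡 n) ∞ M) (i : Fin n) :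
    AEStronglyMeasurable (fun y => components e y (X (e.symm y)) i) (volume.restrict e.target) := by
  unfold components
  refine Finset.aestronglyMeasurable_fun_sum _ fun j _ => ?_
  refine AEStronglyMeasurable.mul ?_ (hX e he _)
  have h1 : ContinuousOn (fun y => (metricMatrix e y)⁻¹ i j) e.target :=
    continuousOn_pi.1 (continuousOn_pi.1 (continuousOn_metricMatrix_inv he) i) j
  exact h1.aestronglyMeasurable e.open_target.measurableSet

/-- By second countability countably many charts cover M, and almost everywhere measurability glues
over a countable cover. -/
theorem aestronglyMeasurable_of_charts [SecondCountableTopology M] (hφ : Continuous φ) {f : M → ℝ}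
    (hf : ∀ e ∈ IsManifold.maximalAtlas (𝓡 n) ∞ M,
      AEStronglyMeasurable (fun y => f (e.symm y)) (volume.restrict e.target)) :
    AEStronglyMeasurable f (weightedVolume n φ) := by
  obtain ⟨s, hs, hU⟩ := TopologicalSpace.countable_cover_nhds
    (f := fun x : M => (chartAt (EuclideanSpace ℝ (Fin n)) x).source)
    fun x => chart_source_mem_nhds _ x
  have : Countable s := hs.to_subtype
  have h : AEStronglyMeasurable f ((weightedVolume n φ).restrict
      (⋃ x : s, (chartAt (EuclideanSpace ℝ (Fin n)) (x : M)).source)) := by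
    refine aestronglyMeasurable_iUnion_iff.2 fun x => ?_
    have he := IsManifold.chart_mem_maximalAtlas (I := 𝓡 n) (n := ∞) (x : M)
    exact (aestronglyMeasurable_restrict_source he hφ).2 (hf _ he)
  rwa [iUnion_subtype (fun x => x ∈ s)
    (fun x => (chartAt (EuclideanSpace ℝ (Fin n)) (x : M)).source), hU,
    Measure.restrict_univ] at h

/-- In a chart ⟨X, Y⟩ = ∑ g^{ij} ⟨X, ∂_j⟩ ⟨Y, ∂_i⟩ with continuous g^{ij}, so measurability of the
fields as sections of the bundle never has to be discussed. -/
theorem aestronglyMeasurable_inner [SecondCountableTopology M] (hφ : Continuous φ)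
    (hX : ChartMeasurable X) (hY : ChartMeasurable Y) :
    AEStronglyMeasurable (fun x => inner ℝ (X x) (Y x)) (weightedVolume n φ) := by
  refine aestronglyMeasurable_of_charts hφ fun e he => ?_
  have h : AEStronglyMeasurable (fun y => ∑ i, components e y (X (e.symm y)) i *
      inner ℝ (Y (e.symm y)) (coordVector n e y (EuclideanSpace.single i 1)))
      (volume.restrict e.target) :=
    Finset.aestronglyMeasurable_fun_sum _ fun i _ =>
      AEStronglyMeasurable.mul (aestronglyMeasurable_components hX he i)
        (hY e he (EuclideanSpace.single i 1))
  refine h.congr ?_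
  filter_upwards [ae_restrict_mem e.open_target.measurableSet] with y hy
  exact (inner_eq_sum_components he hy _ _).symm

end Gradient

/-! ### Testing a weak divergence equation on the manifold -/

section ChartIdentity

set_option linter.unusedSectionVars false

variable {n : ℕ} {M : Type*} [MetricSpace M] [MeasurableSpace M] [BorelSpace M]
  [ChartedSpace (EuclideanSpace ℝ (Fin n)) M] [IsManifold (𝓡 n) ∞ M]
  [RiemannianBundle (fun x : M => TangentSpace (𝓡 n) x)]
  [IsContMDiffRiemannianBundle (𝓡 n) ∞ (EuclideanSpace ℝ (Fin n))
      (fun x : M => TangentSpace (𝓡 n) x)]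
variable {e : OpenPartialHomeomorph M (EuclideanSpace ℝ (Fin n))} {φ : M → ℝ}

/-- On a compact part of the target the weighted density has a lower bound c > 0, so Lebesgue
measure there is at most c⁻¹ times the weighted one. -/
theorem memLp_chart (he : e ∈ IsManifold.maximalAtlas (𝓡 n) ∞ M) (hφ : Continuous φ)
    {f : M → ℝ} {r : ℝ≥0∞} (hf : MemLp f r (weightedVolume n φ))
    {K : Set (EuclideanSpace ℝ (Fin n))} (hK : IsCompact K) (hKe : K ⊆ e.target) :
    MemLp (fun y => f (e.symm y)) r (volume.restrict K) := by
  have hmt := e.open_target.measurableSet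
  have h1 : MemLp (fun y => f (e.symm y)) r
      ((volume.restrict e.target).withDensity fun y => ENNReal.ofReal (weightedDensity e φ y)) := by
    have h2 := hf.restrict e.source
    rw [weightedVolume_restrict_source he hφ, measurableEmbedding_chartEmb.memLp_map_measure_iff] at h2
    rw [← map_val_chartMeasure, (MeasurableEmbedding.subtype_coe hmt).memLp_map_measure_iff]
    exact h2
  obtain ⟨c, hc, hcK⟩ : ∃ c > 0, ∀ y ∈ K, c ≤ weightedDensity e φ y := by
    rcases K.eq_empty_or_nonempty with rfl | hne
    · exact ⟨1, one_pos, by simp⟩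
    · obtain ⟨y, hy, hmin⟩ := hK.exists_isMinOn hne ((continuousOn_weightedDensity he hφ).mono hKe)
      exact ⟨_, weightedDensity_pos he (hKe hy), fun z hz => hmin hz⟩
  refine h1.of_measure_le_smul (c := ENNReal.ofReal c⁻¹) ENNReal.ofReal_ne_top
    (Measure.le_iff.2 fun s hs => ?_)
  rw [Measure.smul_apply, withDensity_apply _ hs, Measure.restrict_restrict hs, smul_eq_mul,
    Measure.restrict_apply hs]
  calc volume (s ∩ K) = ENNReal.ofReal c⁻¹ * ∫⁻ _ in s ∩ K, ENNReal.ofReal c := by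
        rw [setLIntegral_const, ← mul_assoc, ← ENNReal.ofReal_mul (by positivity),
          inv_mul_cancel₀ hc.ne', ENNReal.ofReal_one, one_mul]
    _ ≤ ENNReal.ofReal c⁻¹ * ∫⁻ y in s ∩ K, ENNReal.ofReal (weightedDensity e φ y) := by
        refine mul_le_mul' le_rfl (setLIntegral_mono' (hs.inter hK.measurableSet) fun y hy => ?_)
        exact ENNReal.ofReal_le_ofReal (hcK y hy.2)
    _ ≤ _ := by
        gcongr

theorem isLocallyFiniteMeasure_weightedVolume (hφ : Continuous φ) :
    IsLocallyFiniteMeasure (weightedVolume n φ) := by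
  refine ⟨fun x => ?_⟩
  set e := chartAt (EuclideanSpace ℝ (Fin n)) x with hedef
  have he : e ∈ IsManifold.maximalAtlas (𝓡 n) ∞ M := IsManifold.chart_mem_maximalAtlas x
  have hx : x ∈ e.source := mem_chart_source _ x
  obtain ⟨K, hK, hxK, hKe⟩ := exists_compact_subset e.open_target (e.map_source hx)
  refine ⟨e.source ∩ e ⁻¹' K, ?_, ?_⟩
  · exact Filter.inter_mem (e.open_source.mem_nhds hx)
      ((e.continuousAt hx).preimage_mem_nhds (mem_interior_iff_mem_nhds.1 hxK))
  · have hset : MeasurableSet (e.source ∩ e ⁻¹' K) := by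
      have : e.source ∩ e ⁻¹' K = e.symm '' K := by
        rw [← e.symm_image_eq_source_inter_preimage hKe]
      rw [this]
      exact (hK.image_of_continuousOn (e.continuousOn_symm.mono hKe)).measurableSet
    have h1 : weightedVolume n φ (e.source ∩ e ⁻¹' K) =
        ∫⁻ x in e.source, (e.source ∩ e ⁻¹' K).indicator 1 x ∂(weightedVolume n φ) := by
      rw [lintegral_indicator_one hset, Measure.restrict_apply hset, inter_eq_left.2 inter_subset_left]
    rw [h1, setLIntegral_source he hφ]
    have h2 : ∫⁻ y in e.target, ENNReal.ofReal (weightedDensity e φ y) *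
        (e.source ∩ e ⁻¹' K).indicator 1 (e.symm y) =
        ∫⁻ y in K, ENNReal.ofReal (weightedDensity e φ y) := by
      rw [← lintegral_indicator hK.measurableSet, ← lintegral_indicator e.open_target.measurableSet]
      congr 1
      ext y
      by_cases hy : y ∈ e.target
      · by_cases hyK : y ∈ K
        · rw [indicator_of_mem hy, indicator_of_mem hyK, indicator_of_mem, Pi.one_apply, mul_one]
          exact ⟨e.map_target hy, by simpa [e.right_inv hy] using hyK⟩
        · rw [indicator_of_mem hy, indicator_of_notMem hyK, indicator_of_notMem, mul_zero]
          exact fun h => hyK (by simpa [e.right_inv hy] using h.2)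
      · rw [indicator_of_notMem hy, indicator_of_notMem fun h => hy (hKe h)]
    rw [h2]
    obtain ⟨C, hC⟩ := (hK.image_of_continuousOn ((continuousOn_weightedDensity he hφ).mono hKe)).bddAbove
    calc ∫⁻ y in K, ENNReal.ofReal (weightedDensity e φ y) ≤ ∫⁻ y in K, ENNReal.ofReal C := by
          refine setLIntegral_mono' hK.measurableSet fun y hy => ENNReal.ofReal_le_ofReal ?_
          exact hC (mem_image_of_mem _ hy)
      _ < ⊤ := by
          rw [setLIntegral_const]
          exact ENNReal.mul_lt_top ENNReal.ofReal_lt_top hK.measure_lt_top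

theorem norm_coordVector_continuousOn (he : e ∈ IsManifold.maximalAtlas (𝓡 n) ∞ M)
    (w : EuclideanSpace ℝ (Fin n)) :
    ContinuousOn (fun y => ‖coordVector n e y w‖) e.target := by
  have := (continuousOn_inner_coordVector he w w).sqrt
  refine this.congr fun y hy => ?_
  simp only [real_inner_self_eq_norm_sq, Real.sqrt_sq (norm_nonneg _)]

theorem abs_components_le (e : OpenPartialHomeomorph M (EuclideanSpace ℝ (Fin n)))
    (y : EuclideanSpace ℝ (Fin n)) (V : TangentSpace (𝓡 n) (e.symm y)) (i : Fin n) :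
    |components e y V i| ≤ (∑ j, |(metricMatrix e y)⁻¹ i j| *
      ‖coordVector n e y (EuclideanSpace.single j 1)‖) * ‖V‖ := by
  unfold components
  refine (Finset.abs_sum_le_sum_abs _ _).trans ?_
  rw [Finset.sum_mul]
  refine Finset.sum_le_sum fun j _ => ?_
  rw [abs_mul, mul_assoc]
  refine mul_le_mul_of_nonneg_left ?_ (abs_nonneg _)
  rw [mul_comm]
  exact abs_real_inner_le_norm _ _

theorem continuousOn_norm_grad (he : e ∈ IsManifold.maximalAtlas (𝓡 n) ∞ M) {f : M → ℝ}
    (hf : ContMDiff (𝓡 n) 𝓘(ℝ, ℝ) ∞ f) : ContinuousOn (fun y => ‖grad n f (e.symm y)‖) e.target := by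
  have h1 : ContDiffOn ℝ ∞ (fun z => f (e.symm z)) e.target := by
    have := hf.comp_contMDiffOn (contMDiffOn_chart_symm he)
    exact contMDiffOn_iff_contDiffOn.1 this
  have h2 : ∀ w, ContinuousOn (fun y => inner ℝ (grad n f (e.symm y)) (coordVector n e y w))
      e.target := fun w => by
    refine ((h1.continuousOn_fderiv_of_isOpen e.open_target (by simp)).clm_apply
      (continuousOn_const (c := w))).congr fun y hy => ?_
    exact inner_grad_coordVector he hy (hf.mdifferentiable (by simp) _) w
  have h3 : ContinuousOn (fun y => inner ℝ (grad n f (e.symm y)) (grad n f (e.symm y))) e.target := by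
    have : ContinuousOn (fun y => ∑ i, components e y (grad n f (e.symm y)) i *
        inner ℝ (grad n f (e.symm y)) (coordVector n e y (EuclideanSpace.single i 1))) e.target := by
      unfold components
      refine continuousOn_finsetSum _ fun i _ => ContinuousOn.mul (continuousOn_finsetSum _ fun j _ =>
        ContinuousOn.mul ?_ (h2 _)) (h2 _)
      exact continuousOn_pi.1 (continuousOn_pi.1 (continuousOn_metricMatrix_inv he) i) j
    exact this.congr fun y hy => inner_eq_sum_components he hy _ _
  refine h3.sqrt.congr fun y hy => ?_
  simp only [real_inner_self_eq_norm_sq, Real.sqrt_sq (norm_nonneg _)]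

theorem continuous_norm_grad {f : M → ℝ} (hf : ContMDiff (𝓡 n) 𝓘(ℝ, ℝ) ∞ f) :
    Continuous fun x => ‖grad n f x‖ := by
  refine continuous_iff_continuousAt.2 fun x => ?_
  set e := chartAt (EuclideanSpace ℝ (Fin n)) x
  have he : e ∈ IsManifold.maximalAtlas (𝓡 n) ∞ M := IsManifold.chart_mem_maximalAtlas x
  have hx : x ∈ e.source := mem_chart_source _ x
  have h1 := ((continuousOn_norm_grad he hf).comp e.continuousOn e.mapsTo).continuousAt
    (e.open_source.mem_nhds hx)
  refine h1.congr ?_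
  filter_upwards [e.open_source.mem_nhds hx] with z hz
  exact congrArg (fun z => ‖grad n f z‖) (e.left_inv hz)

theorem hasCompactSupport_grad {f : M → ℝ} (hf : HasCompactSupport f) :
    HasCompactSupport fun x => ‖grad n f x‖ :=
  HasCompactSupport.intro hf fun x hx => by rw [grad_of_notMem_tsupport hx, norm_zero]


/-- The coordinate form ∑ ∂_i (ω W^i) = ω h of the equation, with ω the weighted density and W^i the
contravariant components, obtained by testing with ψ transplanted to M. -/
theorem chart_divergence (he : e ∈ IsManifold.maximalAtlas (𝓡 n) ∞ M) (hφ : Continuous φ)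
    {h : M → ℝ} {W : ∀ x : M, TangentSpace (𝓡 n) x}
    (hdiv : ∀ ψ : M → ℝ, ContMDiff (𝓡 n) 𝓘(ℝ, ℝ) ∞ ψ → HasCompactSupport ψ →
      ∫ x, h x * ψ x ∂(weightedVolume n φ) =
        -∫ x, inner ℝ (W x) (grad n ψ x) ∂(weightedVolume n φ))
    {ψ : EuclideanSpace ℝ (Fin n) → ℝ} (hψ : ContDiff ℝ ∞ ψ) (hc : HasCompactSupport ψ)
    (hs : tsupport ψ ⊆ e.target) :
    ∫ y in e.target, weightedDensity e φ y * h (e.symm y) * ψ y =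
      -∫ y in e.target, ∑ i, weightedDensity e φ y * components e y (W (e.symm y)) i *
        fderiv ℝ ψ y (EuclideanSpace.single i 1) := by
  obtain ⟨h1, h2, h3⟩ := contMDiff_transplant he hψ hc hs
  set Ψ : M → ℝ := e.source.indicator fun x => ψ (e x) with hΨ
  have h4 := hdiv Ψ h1 h2
  have hA : ∫ x, h x * Ψ x ∂(weightedVolume n φ) =
      ∫ x in e.source, h x * Ψ x ∂(weightedVolume n φ) := by
    refine (setIntegral_eq_integral_of_forall_compl_eq_zero fun x hx => ?_).symm
    rw [hΨ, indicator_of_notMem hx, mul_zero]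
  have hB : ∫ x, inner ℝ (W x) (grad n Ψ x) ∂(weightedVolume n φ) =
      ∫ x in e.source, inner ℝ (W x) (grad n Ψ x) ∂(weightedVolume n φ) := by
    refine (setIntegral_eq_integral_of_forall_compl_eq_zero fun x hx => ?_).symm
    rw [grad_of_notMem_tsupport fun h => hx (h3 h), inner_zero_right]
  rw [hA, hB, setIntegral_source he hφ, setIntegral_source he hφ] at h4
  have hval : ∀ y ∈ e.target, Ψ (e.symm y) = ψ y := fun y hy => by
    rw [hΨ, indicator_of_mem (e.map_target hy), e.right_inv hy]
  have hmt := e.open_target.measurableSet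
  calc _ = ∫ y in e.target, weightedDensity e φ y * (h (e.symm y) * Ψ (e.symm y)) := by
        refine setIntegral_congr_fun hmt fun y hy => ?_
        simp only [hval y hy, mul_assoc]
    _ = _ := h4
    _ = _ := by
        congr 1
        refine setIntegral_congr_fun hmt fun y hy => ?_
        rw [inner_eq_sum_components he hy, Finset.mul_sum]
        refine Finset.sum_congr rfl fun i _ => ?_
        rw [inner_grad_coordVector he hy (h1.mdifferentiable (by simp) _), ← mul_assoc]
        congr 2
        refine Filter.EventuallyEq.fderiv_eq ?_
        filter_upwards [e.open_target.mem_nhds hy] with z hz using hval z hz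

theorem memLp_continuousOn_mul {K : Set (EuclideanSpace ℝ (Fin n))} (hK : IsCompact K)
    {a f F : EuclideanSpace ℝ (Fin n) → ℝ} (ha : ContinuousOn a K) {r : ℝ≥0∞}
    (hf : MemLp f r (volume.restrict K)) (hF : AEStronglyMeasurable F (volume.restrict K))
    (hle : ∀ y ∈ K, |F y| ≤ a y * |f y|) : MemLp F r (volume.restrict K) := by
  obtain ⟨C, hC⟩ := (hK.image_of_continuousOn ha).bddAbove
  refine hf.of_le_mul (c := C) hF ?_
  filter_upwards [ae_restrict_mem hK.measurableSet] with y hy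
  exact (hle y hy).trans (mul_le_mul_of_nonneg_right (hC (mem_image_of_mem _ hy)) (abs_nonneg _))

/-- `weak_divergence_comp` for the coordinate form of the equation. Its local integrability
hypotheses follow from the global ones, because the density, the inverse metric and the lengths of
the coordinate vectors are continuous and so bounded on compact sets. -/
theorem chart_identity (he : e ∈ IsManifold.maximalAtlas (𝓡 n) ∞ M) (hφ : Continuous φ)
    {p p' r : ℝ} (hpp : p.HolderConjugate p') (hr : 1 ≤ r) {h v : M → ℝ}
    {W X : ∀ x : M, TangentSpace (𝓡 n) x}
    (hh : MemLp h (ENNReal.ofReal r) (weightedVolume n φ))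
    (hWm : ChartMeasurable W)
    (hW : MemLp (fun x => ‖W x‖) (ENNReal.ofReal p') (weightedVolume n φ))
    (hvX : IsWeakGrad n v X)
    (hX : MemLp (fun x => ‖X x‖) (ENNReal.ofReal p) (weightedVolume n φ))
    (hdiv : ∀ ψ : M → ℝ, ContMDiff (𝓡 n) 𝓘(ℝ, ℝ) ∞ ψ → HasCompactSupport ψ →
      ∫ x, h x * ψ x ∂(weightedVolume n φ) =
        -∫ x, inner ℝ (W x) (grad n ψ x) ∂(weightedVolume n φ))
    {T : ℝ → ℝ} (hT : ContDiff ℝ ∞ T) {C : ℝ} (hTC : ∀ s, |T s| ≤ C)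
    (hTC' : ∀ s, |deriv T s| ≤ C) {ζ : M → ℝ} (hζ : ContMDiff (𝓡 n) 𝓘(ℝ, ℝ) ∞ ζ)
    (hc : HasCompactSupport ζ) (hs : tsupport ζ ⊆ e.source) :
    ∫ x, h x * (ζ x * T (v x)) ∂(weightedVolume n φ) =
      -∫ x, (ζ x * deriv T (v x) * inner ℝ (W x) (X x) + T (v x) * inner ℝ (W x) (grad n ζ x))
        ∂(weightedVolume n φ) := by
  have hmt := e.open_target.measurableSet
  obtain ⟨h1, h2, h3⟩ := contDiff_transplant he hζ hc hs
  set Z : EuclideanSpace ℝ (Fin n) → ℝ := e.target.indicator fun y => ζ (e.symm y) with hZ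
  have hval : ∀ y ∈ e.target, Z y = ζ (e.symm y) := fun y hy => indicator_of_mem hy _
  have hwd := continuousOn_weightedDensity he hφ
  have key := weak_divergence_comp e.open_target hpp (fun i : Fin n => EuclideanSpace.single i (1 : ℝ))
    (h := fun y => weightedDensity e φ y * h (e.symm y)) (f := fun y => v (e.symm y))
    (W := fun i y => weightedDensity e φ y * components e y (W (e.symm y)) i)
    (F := fun i y => inner ℝ (X (e.symm y)) (coordVector n e y (EuclideanSpace.single i 1)))
    ?_ ?_ (hvX.locInt e he) ?_ ?_ ?_ hT hTC hTC' h1 h2 h3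
  · have hA : ∫ x, h x * (ζ x * T (v x)) ∂(weightedVolume n φ) =
        ∫ x in e.source, h x * (ζ x * T (v x)) ∂(weightedVolume n φ) := by
      refine (setIntegral_eq_integral_of_forall_compl_eq_zero fun x hx => ?_).symm
      rw [image_eq_zero_of_notMem_tsupport fun h => hx (hs h), zero_mul, mul_zero]
    have hB : ∫ x, (ζ x * deriv T (v x) * inner ℝ (W x) (X x) +
        T (v x) * inner ℝ (W x) (grad n ζ x)) ∂(weightedVolume n φ) =
        ∫ x in e.source, (ζ x * deriv T (v x) * inner ℝ (W x) (X x) +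
        T (v x) * inner ℝ (W x) (grad n ζ x)) ∂(weightedVolume n φ) := by
      refine (setIntegral_eq_integral_of_forall_compl_eq_zero fun x hx => ?_).symm
      rw [image_eq_zero_of_notMem_tsupport fun h => hx (hs h),
        grad_of_notMem_tsupport fun h => hx (hs h), inner_zero_right]
      ring
    rw [hA, hB, setIntegral_source he hφ, setIntegral_source he hφ]
    refine Eq.trans ?_ (key.trans ?_)
    · refine setIntegral_congr_fun hmt fun y hy => ?_
      simp only [hval y hy]
      ring
    · congr 1
      refine setIntegral_congr_fun hmt fun y hy => ?_
      rw [inner_eq_sum_components he hy, inner_eq_sum_components he hy, Finset.mul_sum,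
        Finset.mul_sum, ← Finset.sum_add_distrib, Finset.mul_sum]
      refine Finset.sum_congr rfl fun i _ => ?_
      rw [inner_grad_coordVector he hy (hζ.mdifferentiable (by simp) _), hval y hy]
      have : fderiv ℝ Z y = fderiv ℝ (fun z => ζ (e.symm z)) y := by
        refine Filter.EventuallyEq.fderiv_eq ?_
        filter_upwards [e.open_target.mem_nhds hy] with z hz using hval z hz
      rw [this]
      ring
  · refine (locallyIntegrableOn_iff e.open_target.isLocallyClosed).2 fun K hKe hK => ?_
    have h5 := memLp_chart he hφ hh hK hKe
    have h6 := memLp_continuousOn_mul hK (hwd.mono hKe) h5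
      (F := fun y => weightedDensity e φ y * h (e.symm y))
      (((hwd.mono hKe).aestronglyMeasurable hK.measurableSet).mul h5.1) fun y hy => by
        rw [abs_mul, abs_of_pos (weightedDensity_pos he (hKe hy))]
    have : IsFiniteMeasure (volume.restrict K) := ⟨by
      rw [Measure.restrict_apply_univ]; exact hK.measure_lt_top⟩
    exact h6.integrable (ENNReal.one_le_ofReal.2 hr)
  · intro i K hKe hK
    have h5 := memLp_chart he hφ hW hK hKe
    refine memLp_continuousOn_mul hK (a := fun y => weightedDensity e φ y *
      ∑ j, |(metricMatrix e y)⁻¹ i j| * ‖coordVector n e y (EuclideanSpace.single j 1)‖) ?_ h5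
      ?_ fun y hy => ?_
    · refine ContinuousOn.mono (hwd.mul (continuousOn_finsetSum _ fun j _ =>
        ContinuousOn.mul (ContinuousOn.abs ?_) (norm_coordVector_continuousOn he _))) hKe
      exact continuousOn_pi.1 (continuousOn_pi.1 (continuousOn_metricMatrix_inv he) i) j
    · exact AEStronglyMeasurable.mul ((hwd.mono hKe).aestronglyMeasurable hK.measurableSet)
        ((aestronglyMeasurable_components hWm he i).mono_measure (Measure.restrict_mono hKe le_rfl))
    · rw [abs_mul, abs_of_pos (weightedDensity_pos he (hKe hy)), mul_assoc, abs_norm]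
      exact mul_le_mul_of_nonneg_left (abs_components_le e y _ i) (weightedDensity_pos he (hKe hy)).le
  · intro i K hKe hK
    refine memLp_continuousOn_mul hK ((norm_coordVector_continuousOn he
      (EuclideanSpace.single i 1)).mono hKe) (memLp_chart he hφ hX hK hKe)
      ((hvX.chartMeasurable e he _).mono_measure (Measure.restrict_mono hKe le_rfl)) fun y hy => ?_
    rw [abs_norm, mul_comm]
    exact abs_real_inner_le_norm _ _
  · intro i ψ hψ hψc hψs
    exact hvX.integral_eq e he _ ψ hψ hψc hψs
  · intro ψ hψ hψc hψs
    exact chart_divergence he hφ hdiv hψ hψc hψs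


theorem integrable_inner_of_memLp [SecondCountableTopology M] (hφ : Continuous φ) {p p' : ℝ}
    (hpp : p.HolderConjugate p') {W X : ∀ x : M, TangentSpace (𝓡 n) x}
    (hWm : ChartMeasurable W)
    (hW : MemLp (fun x => ‖W x‖) (ENNReal.ofReal p') (weightedVolume n φ))
    (hXm : ChartMeasurable X)
    (hX : MemLp (fun x => ‖X x‖) (ENNReal.ofReal p) (weightedVolume n φ)) :
    Integrable (fun x => inner ℝ (W x) (X x)) (weightedVolume n φ) := by
  refine (integrable_mul_of_memLp hpp hX hW).mono (aestronglyMeasurable_inner hφ hWm hXm)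
    (Eventually.of_forall fun x => ?_)
  rw [Real.norm_eq_abs, Real.norm_eq_abs, abs_of_nonneg (a := ‖X x‖ * ‖W x‖) (by positivity),
    mul_comm]
  exact abs_real_inner_le_norm _ _

theorem memLp_of_continuous_of_hasCompactSupport (hφ : Continuous φ) {f : M → ℝ}
    (hf : Continuous f) (hc : HasCompactSupport f) (r : ℝ≥0∞) :
    MemLp f r (weightedVolume n φ) := by
  have := isLocallyFiniteMeasure_weightedVolume (n := n) hφ
  exact hf.memLp_of_hasCompactSupport hc

theorem memLp_bounded_mul {α : Type*} [MeasurableSpace α] {μ : Measure α} {f g : α → ℝ} {r : ℝ≥0∞}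
    (hf : MemLp f r μ) (hg : AEStronglyMeasurable g μ) {C : ℝ} (hC : ∀ x, |g x| ≤ C) :
    MemLp (fun x => g x * f x) r μ :=
  hf.of_le_mul (c := C) (hg.mul hf.1) (Eventually.of_forall fun x => by
    rw [norm_mul]; exact mul_le_mul_of_nonneg_right (hC x) (norm_nonneg _))

/-- If `div W = h` weakly, the equation can be tested with `η T(v)` for `η` smooth with compact
support and `v` with weak gradient in `L^p`. -/
theorem integral_test_comp [SecondCountableTopology M] (hφ : Continuous φ)
    {p p' r r' : ℝ} (hpp : p.HolderConjugate p') (hr : r.HolderConjugate r') {h v : M → ℝ}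
    {W X : ∀ x : M, TangentSpace (𝓡 n) x}
    (hh : MemLp h (ENNReal.ofReal r) (weightedVolume n φ))
    (hWm : ChartMeasurable W)
    (hW : MemLp (fun x => ‖W x‖) (ENNReal.ofReal p') (weightedVolume n φ))
    (hv : AEStronglyMeasurable v (weightedVolume n φ))
    (hvX : IsWeakGrad n v X)
    (hX : MemLp (fun x => ‖X x‖) (ENNReal.ofReal p) (weightedVolume n φ))
    (hdiv : ∀ ψ : M → ℝ, ContMDiff (𝓡 n) 𝓘(ℝ, ℝ) ∞ ψ → HasCompactSupport ψ →
      ∫ x, h x * ψ x ∂(weightedVolume n φ) =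
        -∫ x, inner ℝ (W x) (grad n ψ x) ∂(weightedVolume n φ))
    {T : ℝ → ℝ} (hT : ContDiff ℝ ∞ T) {C : ℝ} (hTC : ∀ s, |T s| ≤ C)
    (hTC' : ∀ s, |deriv T s| ≤ C) {η : M → ℝ} (hη : ContMDiff (𝓡 n) 𝓘(ℝ, ℝ) ∞ η)
    (hc : HasCompactSupport η) :
    ∫ x, h x * (η x * T (v x)) ∂(weightedVolume n φ) =
      -∫ x, (η x * deriv T (v x) * inner ℝ (W x) (X x) + T (v x) * inner ℝ (W x) (grad n η x))
        ∂(weightedVolume n φ) := by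
  have hTv : AEStronglyMeasurable (fun x => T (v x)) (weightedVolume n φ) :=
    hT.continuous.comp_aestronglyMeasurable hv
  have hTv' : AEStronglyMeasurable (fun x => deriv T (v x)) (weightedVolume n φ) :=
    (hT.continuous_deriv (by simp)).comp_aestronglyMeasurable hv
  have hWX := integrable_inner_of_memLp hφ hpp hWm hW hvX.chartMeasurable hX
  have hbd : ∀ ζ : M → ℝ, ContMDiff (𝓡 n) 𝓘(ℝ, ℝ) ∞ ζ → HasCompactSupport ζ →
      Integrable (fun x => h x * (ζ x * T (v x))) (weightedVolume n φ) ∧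
      Integrable (fun x => ζ x * deriv T (v x) * inner ℝ (W x) (X x) +
        T (v x) * inner ℝ (W x) (grad n ζ x)) (weightedVolume n φ) := by
    intro ζ hζ hζc
    obtain ⟨B, hB⟩ := hζc.exists_bound_of_continuous hζ.continuous
    refine ⟨integrable_mul_of_memLp hr hh ?_, Integrable.add ?_ ?_⟩
    · have := memLp_bounded_mul (memLp_of_continuous_of_hasCompactSupport (n := n) hφ hζ.continuous hζc
        (ENNReal.ofReal r')) hTv fun x => hTC (v x)
      simpa only [mul_comm] using this
    · refine hWX.bdd_mul (c := B * C) ((hζ.continuous.aestronglyMeasurable).mul hTv')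
        (Eventually.of_forall fun x => ?_)
      rw [norm_mul]
      exact mul_le_mul (hB x) (hTC' _) (norm_nonneg _) ((norm_nonneg _).trans (hB x))
    · refine Integrable.bdd_mul (c := C) ?_ hTv (Eventually.of_forall fun x => hTC _)
      exact integrable_inner_of_memLp hφ hpp hWm hW (chartMeasurable_grad hζ)
        (memLp_of_continuous_of_hasCompactSupport hφ (continuous_norm_grad hζ)
          (hasCompactSupport_grad hζc) _)
  have : LocallyCompactSpace M := ChartedSpace.locallyCompactSpace (EuclideanSpace ℝ (Fin n)) M
  obtain ⟨f, hf⟩ := SmoothPartitionOfUnity.exists_isSubordinate_chartAt_source_of_isClosed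
    (H := EuclideanSpace ℝ (Fin n)) (𝓡 n) (isClosed_univ (X := M))
  -- Only finitely many members of the partition of unity meet the support of η. Hence η is a finite
  -- sum of pieces supported in single charts, and both sides of the identity are additive over
  -- them.
  have hfin : {i | (Function.support (f i) ∩ tsupport η).Nonempty}.Finite :=
    f.locallyFinite.finite_nonempty_inter_compact hc
  have hsum : ∀ x, η x = ∑ i ∈ hfin.toFinset, f i x * η x := by
    intro x
    by_cases hx : x ∈ tsupport η
    · rw [← Finset.sum_mul]
      have h1 := f.sum_eq_one (mem_univ x)
      rw [finsum_eq_sum_of_support_subset (s := hfin.toFinset)] at h1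
      · rw [h1, one_mul]
      · intro i hi
        simpa using ⟨x, hi, hx⟩
    · simp [image_eq_zero_of_notMem_tsupport hx]
  have hfs : ∀ i, ContMDiff (𝓡 n) 𝓘(ℝ, ℝ) ∞ fun x => f i x * η x := fun i =>
    (f i).contMDiff.mul hη
  have hfc : ∀ i, HasCompactSupport fun x => f i x * η x := fun i => hc.mul_left
  have hpart : ∀ i, ∫ x, h x * ((f i x * η x) * T (v x)) ∂(weightedVolume n φ) =
      -∫ x, ((f i x * η x) * deriv T (v x) * inner ℝ (W x) (X x) +
        T (v x) * inner ℝ (W x) (grad n (fun x => f i x * η x) x)) ∂(weightedVolume n φ) := by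
    intro i
    refine chart_identity (e := chartAt (EuclideanSpace ℝ (Fin n)) (i : M))
      (IsManifold.chart_mem_maximalAtlas _) hφ hpp hr.lt.le hh hWm hW hvX hX hdiv hT hTC hTC'
      (hfs i) (hfc i) ?_
    exact (tsupport_mul_subset_left (f := fun x => f i x) (g := η)).trans (hf i)
  have hgrad : ∀ x, grad n η x = ∑ i ∈ hfin.toFinset, grad n (fun x => f i x * η x) x := by
    intro x
    have h1 : ∀ s : Finset (univ : Set M), grad n (fun x => ∑ i ∈ s, f i x * η x) x =
        ∑ i ∈ s, grad n (fun x => f i x * η x) x := by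
      classical
      intro s
      induction s using Finset.induction_on with
      | empty =>
        simp only [Finset.sum_empty]
        exact grad_of_notMem_tsupport (by simp [tsupport])
      | insert a s ha ih =>
        simp only [Finset.sum_insert ha]
        rw [grad_add, ih]
        · exact (hfs a).mdifferentiable (by simp) x
        · exact (contMDiff_finsetSum fun i _ => hfs i).mdifferentiable (by simp) x
    rw [← h1]
    congr 1
    funext z
    exact hsum z
  calc ∫ x, h x * (η x * T (v x)) ∂(weightedVolume n φ)
      = ∫ x, ∑ i ∈ hfin.toFinset, h x * ((f i x * η x) * T (v x)) ∂(weightedVolume n φ) := by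
        congr 1
        ext x
        conv_lhs => rw [hsum x, Finset.sum_mul, Finset.mul_sum]
    _ = ∑ i ∈ hfin.toFinset, ∫ x, h x * ((f i x * η x) * T (v x)) ∂(weightedVolume n φ) :=
        integral_finsetSum _ fun i _ => (hbd _ (hfs i) (hfc i)).1
    _ = -∑ i ∈ hfin.toFinset, ∫ x, ((f i x * η x) * deriv T (v x) * inner ℝ (W x) (X x) +
        T (v x) * inner ℝ (W x) (grad n (fun x => f i x * η x) x)) ∂(weightedVolume n φ) := by
        rw [← Finset.sum_neg_distrib]
        exact Finset.sum_congr rfl fun i _ => hpart i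
    _ = -∫ x, ∑ i ∈ hfin.toFinset, ((f i x * η x) * deriv T (v x) * inner ℝ (W x) (X x) +
        T (v x) * inner ℝ (W x) (grad n (fun x => f i x * η x) x)) ∂(weightedVolume n φ) := by
        rw [integral_finsetSum _ fun i _ => (hbd _ (hfs i) (hfc i)).2]
    _ = _ := by
        congr 2
        ext x
        conv_rhs => rw [hsum x, hgrad x, Finset.sum_mul, Finset.sum_mul, inner_sum, Finset.mul_sum,
          ← Finset.sum_add_distrib]

end ChartIdentity

/-! ### Compactness of closed balls; comparison of the metric with a frozen norm in a chart -/

section Properness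

set_option linter.unusedSectionVars false

variable {n : ℕ} {M : Type*} [MetricSpace M]
  [ChartedSpace (EuclideanSpace ℝ (Fin n)) M] [IsManifold (𝓡 n) ∞ M]
  [RiemannianBundle (fun x : M => TangentSpace (𝓡 n) x)]
  [IsContMDiffRiemannianBundle (𝓡 n) ∞ (EuclideanSpace ℝ (Fin n))
      (fun x : M => TangentSpace (𝓡 n) x)]
  [IsRiemannianManifold (𝓡 n) M]

/-- The distance is an infimum of lengths. On a curve from x to y shorter than a + b, the point at
distance exactly a from x has used up length at least a, so the remaining arc is shorter than b. -/
theorem exists_intermediate_point (n : ℕ) {M : Type*} [MetricSpace M]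
    [ChartedSpace (EuclideanSpace ℝ (Fin n)) M]
    [RiemannianBundle (fun x : M => TangentSpace (𝓡 n) x)]
    [IsRiemannianManifold (𝓡 n) M] {x y : M} {a b : ℝ} (ha : 0 ≤ a) (hb : 0 < b)
    (h : dist x y < a + b) : ∃ z, dist x z ≤ a ∧ dist z y < b := by
  rcases le_or_gt (dist x y) a with hxa | hxa
  · exact ⟨y, hxa, by simpa⟩
  have h1 : Manifold.riemannianEDist (𝓡 n) x y < ENNReal.ofReal (a + b) := by
    rw [← IsRiemannianManifold.out x y, edist_dist]
    exact (ENNReal.ofReal_lt_ofReal_iff (by linarith)).2 h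
  obtain ⟨γ, h0, hy1, hγ, hlen⟩ := Manifold.exists_lt_of_riemannianEDist_lt h1
  have hcont : ContinuousOn (fun t => dist x (γ t)) (Icc 0 1) :=
    (continuous_const.dist continuous_id).comp_continuousOn hγ.continuousOn
  obtain ⟨τ, hτ, hτa⟩ : a ∈ (fun t => dist x (γ t)) '' Icc 0 1 :=
    intermediate_value_Icc zero_le_one hcont (by simp [h0, hy1, ha, hxa.le])
  dsimp only at hτa
  refine ⟨γ τ, hτa.le, ?_⟩
  rw [← Manifold.pathELength_add hτ.1 hτ.2] at hlen
  have h2 : ENNReal.ofReal a ≤ Manifold.pathELength (𝓡 n) γ 0 τ := by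
    rw [← hτa, ← edist_dist, IsRiemannianManifold.out (I := 𝓡 n) x (γ τ)]
    exact Manifold.riemannianEDist_le_pathELength (hγ.mono (Icc_subset_Icc le_rfl hτ.2)) h0 rfl hτ.1
  have h3 : ENNReal.ofReal (dist (γ τ) y) ≤ Manifold.pathELength (𝓡 n) γ τ 1 := by
    rw [← edist_dist, IsRiemannianManifold.out (I := 𝓡 n) (γ τ) y]
    exact Manifold.riemannianEDist_le_pathELength (hγ.mono (Icc_subset_Icc hτ.1 le_rfl)) rfl hy1 hτ.2
  have h4 := (add_le_add h2 h3).trans_lt hlen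
  rw [← ENNReal.ofReal_add ha dist_nonneg, ENNReal.ofReal_lt_ofReal_iff (by linarith)] at h4
  linarith

/-- Hopf–Rinow by continuation in the radius. Let R be the supremum of the radii of compact balls
about x. The closed ball of radius R lies within any ε of a smaller compact ball, so it is totally
bounded and, by completeness, compact; local compactness then gives compact balls of radius larger
than R. -/
theorem properSpace_of_complete (n : ℕ) (M : Type*) [MetricSpace M]
    [ChartedSpace (EuclideanSpace ℝ (Fin n)) M]
    [RiemannianBundle (fun x : M => TangentSpace (𝓡 n) x)]
    [IsRiemannianManifold (𝓡 n) M] [CompleteSpace M] : ProperSpace M := by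
  have hlc : LocallyCompactSpace M := ChartedSpace.locallyCompactSpace (EuclideanSpace ℝ (Fin n)) M
  refine ⟨fun x => ?_⟩
  by_contra! hcon
  obtain ⟨R₀, hR₀⟩ := hcon
  set S := {r : ℝ | 0 ≤ r ∧ IsCompact (Metric.closedBall x r)}
  have h0 : (0 : ℝ) ∈ S := ⟨le_rfl, by simp⟩
  have hdown : ∀ r ∈ S, ∀ s, 0 ≤ s → s ≤ r → s ∈ S := fun r hr s hs hsr =>
    ⟨hs, hr.2.of_isClosed_subset Metric.isClosed_closedBall (Metric.closedBall_subset_closedBall hsr)⟩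
  have hbdd : BddAbove S := by
    refine ⟨R₀, fun r hr => ?_⟩
    by_contra! hlt
    exact hR₀ (hr.2.of_isClosed_subset Metric.isClosed_closedBall
      (Metric.closedBall_subset_closedBall hlt.le))
  set R := sSup S
  have hR0 : 0 ≤ R := le_csSup hbdd h0
  have hRc : IsCompact (Metric.closedBall x R) := by
    refine TotallyBounded.isCompact_of_isClosed (Metric.totallyBounded_iff.2 fun ε hε => ?_)
      Metric.isClosed_closedBall
    obtain ⟨r, hrS, hr⟩ : ∃ r ∈ S, R - ε / 2 < r := exists_lt_of_lt_csSup ⟨0, h0⟩ (by linarith)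
    obtain ⟨t, ht, htc⟩ := Metric.totallyBounded_iff.1 hrS.2.totallyBounded (ε / 2) (by positivity)
    refine ⟨t, ht, fun y hy => ?_⟩
    rw [Metric.mem_closedBall, dist_comm] at hy
    obtain ⟨z, hz1, hz2⟩ := exists_intermediate_point n hrS.1 (half_pos hε)
      (show dist x y < r + ε / 2 by linarith)
    obtain ⟨w, hw, hzw⟩ := mem_iUnion₂.1 (htc (show z ∈ Metric.closedBall x r by
      rwa [Metric.mem_closedBall, dist_comm]))
    refine mem_iUnion₂.2 ⟨w, hw, ?_⟩
    rw [Metric.mem_ball] at hzw ⊢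
    rw [dist_comm] at hz2
    linarith [dist_triangle y z w]
  obtain ⟨δ, hδ, hδc⟩ := hRc.exists_isCompact_cthickening
  have : R + δ / 2 ∈ S := by
    refine ⟨by linarith, hδc.of_isClosed_subset Metric.isClosed_closedBall fun y hy => ?_⟩
    rw [Metric.mem_closedBall, dist_comm] at hy
    obtain ⟨z, hz1, hz2⟩ := exists_intermediate_point n hR0 hδ (show dist x y < R + δ by linarith)
    refine Metric.mem_cthickening_of_dist_le y z δ _ ?_ (by rw [dist_comm]; exact hz2.le)
    rwa [Metric.mem_closedBall, dist_comm]
  linarith [le_csSup hbdd this]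

variable {e : OpenPartialHomeomorph M (EuclideanSpace ℝ (Fin n))}

/-- By homogeneity it suffices to compare the norms on the Euclidean unit sphere; joint continuity
in (y, w) and compactness of the sphere give one neighbourhood for all w. -/
theorem eventually_norm_coordVector_le (he : e ∈ IsManifold.maximalAtlas (𝓡 n) ∞ M)
    {y₀ : EuclideanSpace ℝ (Fin n)} (hy₀ : y₀ ∈ e.target) :
    ∀ᶠ y in 𝓝 y₀, ∀ w, ‖coordVector n e y w‖ ≤ 2 * ‖coordVector n e y₀ w‖ ∧
      ‖coordVector n e y₀ w‖ ≤ 2 * ‖coordVector n e y w‖ := by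
  have hF : ContinuousOn (fun z : EuclideanSpace ℝ (Fin n) × EuclideanSpace ℝ (Fin n) =>
      inner ℝ (coordVector n e z.1 z.2) (coordVector n e z.1 z.2)) (e.target ×ˢ univ) := by
    have h1 : ∀ z : EuclideanSpace ℝ (Fin n) × EuclideanSpace ℝ (Fin n),
        inner ℝ (coordVector n e z.1 z.2) (coordVector n e z.1 z.2) =
        ∑ i, ∑ j, z.2 i * (z.2 j * inner ℝ (coordVector n e z.1 (EuclideanSpace.single i 1))
          (coordVector n e z.1 (EuclideanSpace.single j 1))) := fun z => by
      conv_lhs => rw [coordVector_eq_sum z.1 z.2]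
      simp only [sum_inner, inner_sum, real_inner_smul_left, real_inner_smul_right]
      exact Finset.sum_comm' (by simp) |>.trans (Finset.sum_congr rfl fun i _ =>
        Finset.sum_congr rfl fun j _ => by ring)
    simp_rw [h1]
    refine continuousOn_finsetSum _ fun i _ => continuousOn_finsetSum _ fun j _ => ?_
    refine ContinuousOn.mul (by fun_prop) (ContinuousOn.mul (by fun_prop) ?_)
    exact (continuousOn_inner_coordVector he _ _).comp continuousOn_fst fun z hz => hz.1
  have hN : ContinuousOn (fun z : EuclideanSpace ℝ (Fin n) × EuclideanSpace ℝ (Fin n) =>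
      ‖coordVector n e z.1 z.2‖) (e.target ×ˢ univ) := by
    refine hF.sqrt.congr fun z _ => ?_
    simp only [real_inner_self_eq_norm_sq, Real.sqrt_sq (norm_nonneg _)]
  obtain ⟨N, hNdef⟩ : ∃ N : EuclideanSpace ℝ (Fin n) × EuclideanSpace ℝ (Fin n) → ℝ,
      ∀ y w, ‖coordVector n e y w‖ = N (y, w) := ⟨fun z => ‖coordVector n e z.1 z.2‖, fun _ _ => rfl⟩
  simp only [hNdef] at hN
  have hsph : ∀ᶠ y in 𝓝 y₀, ∀ w ∈ Metric.sphere (0 : EuclideanSpace ℝ (Fin n)) 1,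
      N (y, w) ≤ 2 * N (y₀, w) ∧ N (y₀, w) ≤ 2 * N (y, w) := by
    refine (isCompact_sphere _ _).eventually_forall_of_forall_eventually fun w hw => ?_
    have hpos : 0 < N (y₀, w) := by
      rw [← hNdef]
      refine norm_pos_iff.2 fun h => ?_
      have h0 : coordVector n e y₀ 0 = 0 := by
        simpa using coordVector_smul (e := e) 0 y₀ 0
      have := (coordVector_bijective he hy₀).1 (h.trans h0.symm)
      simp [this] at hw
    have hc1 : ContinuousAt N (y₀, w) :=
      hN.continuousAt (prod_mem_nhds (e.open_target.mem_nhds hy₀) univ_mem)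
    have hc2 : ContinuousAt (fun z : EuclideanSpace ℝ (Fin n) × EuclideanSpace ℝ (Fin n) =>
        N (y₀, z.2)) (y₀, w) :=
      ContinuousAt.comp (g := N) (f := fun z : EuclideanSpace ℝ (Fin n) × EuclideanSpace ℝ (Fin n) =>
        (y₀, z.2)) (x := (y₀, w)) hc1 (by fun_prop)
    have e1 := hc1.tendsto.eventually_lt (hc2.tendsto.const_mul 2)
      (show N (y₀, w) < 2 * N (y₀, w) by linarith)
    have e2 := hc2.tendsto.eventually_lt (hc1.tendsto.const_mul 2)
      (show N (y₀, w) < 2 * N (y₀, w) by linarith)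
    filter_upwards [e1, e2] with z h1 h2 using ⟨h1.le, h2.le⟩
  filter_upwards [hsph] with y hy w
  rcases eq_or_ne w 0 with rfl | hw
  · have h0 : ∀ y, coordVector n e y 0 = 0 := fun y => by
      simpa using coordVector_smul (e := e) 0 y 0
    simp [h0]
  · have hw' : 0 < ‖w‖ := norm_pos_iff.2 hw
    have h1 : ∀ y, ‖coordVector n e y w‖ = ‖w‖ * ‖coordVector n e y (‖w‖⁻¹ • w)‖ := fun y => by
      rw [coordVector_smul, norm_smul, norm_inv, norm_norm, ← mul_assoc, mul_inv_cancel₀ hw'.ne',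
        one_mul]
    have h2 := hy (‖w‖⁻¹ • w) (by simp [norm_smul, hw'.ne'])
    rw [← hNdef, ← hNdef] at h2
    rw [h1 y, h1 y₀]
    constructor <;> nlinarith [h2.1, h2.2]

/-- The distance is at most the length of the image of the straight segment. -/
theorem dist_chart_symm_le (he : e ∈ IsManifold.maximalAtlas (𝓡 n) ∞ M)
    {s : Set (EuclideanSpace ℝ (Fin n))} (hs : Convex ℝ s) (hse : s ⊆ e.target)
    {y z : EuclideanSpace ℝ (Fin n)} (hy : y ∈ s) (hz : z ∈ s) {C : ℝ} (hC : 0 ≤ C)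
    (hbd : ∀ a ∈ s, ‖coordVector n e a (z - y)‖ ≤ C) :
    dist (e.symm y) (e.symm z) ≤ C := by
  have hmem : ∀ t ∈ Icc (0 : ℝ) 1, AffineMap.lineMap y z t ∈ s := fun t ht =>
    hs.lineMap_mem hy hz ht
  set γ : ℝ → M := fun t => e.symm (AffineMap.lineMap y z t) with hγ
  have hline : ContDiff ℝ ∞ (fun t : ℝ => (AffineMap.lineMap y z t : EuclideanSpace ℝ (Fin n))) := by
    simp only [AffineMap.lineMap_apply_module']
    fun_prop
  have h1 : ContMDiffOn 𝓘(ℝ, ℝ) (𝓡 n) 1 γ (Icc 0 1) :=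
    ((contMDiffOn_chart_symm he).of_le (by simp)).comp
      ((hline.of_le (by simp)).contMDiff.contMDiffOn) fun t ht => hse (hmem t ht)
  have h2 := Manifold.riemannianEDist_le_pathELength h1 (x := e.symm y) (y := e.symm z) (by simp [hγ])
    (by simp [hγ]) zero_le_one
  rw [← IsRiemannianManifold.out (I := 𝓡 n), Manifold.pathELength_eq_lintegral_mfderiv_Icc, edist_dist] at h2
  have h3 : ∫⁻ t in Icc (0 : ℝ) 1, ‖mfderiv 𝓘(ℝ, ℝ) (𝓡 n) γ t 1‖ₑ ≤ ENNReal.ofReal C := by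
    calc _ ≤ ∫⁻ t in Icc (0 : ℝ) 1, ENNReal.ofReal C := by
          refine setLIntegral_mono' measurableSet_Icc fun t ht => ?_
          have h4 := mfderiv_comp_apply (I := 𝓘(ℝ, ℝ)) (I' := 𝓡 n) (I'' := 𝓡 n) t (g := e.symm)
            (f := fun t : ℝ => (AffineMap.lineMap y z t : EuclideanSpace ℝ (Fin n)))
            (mdifferentiableAt_chart_symm he (hse (hmem t ht)))
            ((hline.differentiable (by simp)) t).mdifferentiableAt (1 : ℝ)
          have h5 : mfderiv 𝓘(ℝ, ℝ) (𝓡 n)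
              (fun t : ℝ => (AffineMap.lineMap y z t : EuclideanSpace ℝ (Fin n))) t (1 : ℝ) = z - y := by
            rw [mfderiv_eq_fderiv]
            have h6 : HasDerivAt (fun t : ℝ => (AffineMap.lineMap y z t : EuclideanSpace ℝ (Fin n)))
              (z - y) t := AffineMap.hasDerivAt_lineMap
            exact h6.deriv
          have h7 : mfderiv 𝓘(ℝ, ℝ) (𝓡 n) γ t 1 = coordVector n e (AffineMap.lineMap y z t) (z - y) := by
            refine h4.trans ?_
            rw [h5]; rfl
          rw [h7, ← ofReal_norm]
          exact ENNReal.ofReal_le_ofReal (hbd _ (hmem t ht))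
      _ = ENNReal.ofReal C := by simp
  exact (ENNReal.ofReal_le_ofReal_iff hC).1 (h2.trans h3)

end Properness

/-! ### Smooth cutoffs with small gradient -/

section Cutoff

set_option linter.unusedSectionVars false

open scoped Convolution

variable {n : ℕ} {M : Type*} [MetricSpace M] [MeasurableSpace M] [BorelSpace M]
  [ChartedSpace (EuclideanSpace ℝ (Fin n)) M] [IsManifold (𝓡 n) ∞ M]
  [RiemannianBundle (fun x : M => TangentSpace (𝓡 n) x)]
  [IsContMDiffRiemannianBundle (𝓡 n) ∞ (EuclideanSpace ℝ (Fin n))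
      (fun x : M => TangentSpace (𝓡 n) x)]
  [IsRiemannianManifold (𝓡 n) M]

/-- A function that is Lipschitz with respect to a seminorm `N` on a ball is approximated, on a
smaller ball, by smooth functions with derivative bounded by `N`. -/
theorem exists_contDiff_approx_of_seminorm {E : Type*} [NormedAddCommGroup E]
    [InnerProductSpace ℝ E] [FiniteDimensional ℝ E] [MeasurableSpace E] [BorelSpace E]
    {y₀ : E} {ρ : ℝ} (hρ : 0 < ρ) {f : E → ℝ} {N : E → ℝ} (hN : Continuous N)
    (hN0 : N 0 = 0) (hNs : ∀ (c : ℝ) w, N (c • w) = |c| * N w)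
    (hf : ∀ y ∈ Metric.closedBall y₀ (2 * ρ), ∀ z ∈ Metric.closedBall y₀ (2 * ρ),
      |f z - f y| ≤ N (z - y)) {ε : ℝ} (hε : 0 < ε) :
    ∃ g : E → ℝ, ContDiff ℝ ∞ g ∧ ∀ y ∈ Metric.ball y₀ ρ,
      |g y - f y| ≤ ε ∧ ∀ w, |fderiv ℝ g y w| ≤ N w := by
  set B := Metric.closedBall y₀ (2 * ρ)
  set F : E → ℝ := B.indicator f with hF
  have hfc : ContinuousOn f B := by
    intro y hy
    refine tendsto_iff_dist_tendsto_zero.2 ?_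
    have h1 : Tendsto (fun z => N (z - y)) (𝓝[B] y) (𝓝 0) := by
      have : Continuous fun z => N (z - y) := by fun_prop
      have h := this.tendsto y
      simp only [sub_self, hN0] at h
      exact h.mono_left nhdsWithin_le_nhds
    refine squeeze_zero' (Eventually.of_forall fun _ => dist_nonneg) ?_ h1
    filter_upwards [self_mem_nhdsWithin] with z hz using hf y hy z hz
  have hBc : IsCompact B := isCompact_closedBall _ _
  have hFi : LocallyIntegrable F volume := by
    have : IntegrableOn f B volume := hfc.integrableOn_compact hBc
    exact ((integrable_indicator_iff hBc.measurableSet).2 this).locallyIntegrable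
  obtain ⟨r, hr, hrN⟩ : ∃ r > 0, ∀ z : E, ‖z‖ < r → N z < ε := by
    have : ∀ᶠ z in 𝓝 (0 : E), N z < ε := hN.continuousAt.eventually_lt continuousAt_const (by rwa [hN0])
    obtain ⟨r, hr, h⟩ := Metric.eventually_nhds_iff.1 this
    exact ⟨r, hr, fun z hz => h (by simpa using hz)⟩
  -- Below ρ, so that points of the small ball moved by the bump's support stay where f is Lipschitz
  -- for N; below r, so that averaging changes f by at most ε.
  set r' := min r ρ
  have hr' : 0 < r' := lt_min hr hρ
  let φ : ContDiffBump (0 : E) := ⟨r' / 2, r', by positivity, half_lt_self hr'⟩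
  have hout : φ.rOut = r' := rfl
  have hin : ∀ y ∈ Metric.ball y₀ ρ, ∀ z, ‖z‖ < r' → y - z ∈ B := fun y hy z hz => by
    rw [Metric.mem_closedBall, dist_eq_norm]
    rw [Metric.mem_ball, dist_eq_norm] at hy
    have : y - z - y₀ = (y - y₀) - z := by abel
    rw [this]
    linarith [norm_sub_le (y - y₀) z, min_le_right r ρ]
  have hball : ∀ y ∈ Metric.ball y₀ ρ, y ∈ B := fun y hy => by simpa using hin y hy 0 (by simpa)
  set g : E → ℝ := φ.normed volume ⋆[ContinuousLinearMap.lsmul ℝ ℝ, volume] F with hg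
  have hgs : ContDiff ℝ ∞ g := φ.hasCompactSupport_normed.contDiff_convolution_left _
    φ.contDiff_normed hFi
  have hgex : ∀ y, Integrable (fun t => φ.normed volume t * F (y - t)) volume := fun y =>
    φ.hasCompactSupport_normed.convolutionExists_left (ContinuousLinearMap.lsmul ℝ ℝ)
      (φ.continuous_normed) hFi y
  have hgdef : ∀ y, g y = ∫ t, φ.normed volume t * F (y - t) := fun y => rfl
  -- Averaging translates preserves the Lipschitz bound for N. The derivative bound then comes from
  -- difference quotients along w, using the homogeneity of N.
  have hlip : ∀ y ∈ Metric.ball y₀ ρ, ∀ z ∈ Metric.ball y₀ ρ, |g z - g y| ≤ N (z - y) := by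
    intro y hy z hz
    rw [hgdef, hgdef, ← integral_sub (hgex z) (hgex y), ← Real.norm_eq_abs]
    calc _ ≤ ∫ t, φ.normed volume t * N (z - y) := by
          refine norm_integral_le_of_norm_le (φ.integrable_normed.mul_const _)
            (Eventually.of_forall fun t => ?_)
          rw [← mul_sub, norm_mul, Real.norm_eq_abs, abs_of_nonneg (φ.nonneg_normed t)]
          by_cases ht : ‖t‖ < r'
          · refine mul_le_mul_of_nonneg_left ?_ (φ.nonneg_normed t)
            rw [hF, indicator_of_mem (hin z hz t ht), indicator_of_mem (hin y hy t ht)]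
            have := hf _ (hin y hy t ht) _ (hin z hz t ht)
            simpa using this
          · have : φ.normed volume t = 0 := by
              have : t ∉ Function.support (φ.normed volume) := by
                rw [φ.support_normed_eq]
                simpa [hout] using ht
              simpa using this
            simp [this]
      _ = N (z - y) := by rw [integral_mul_const, φ.integral_normed, one_mul]
  refine ⟨g, hgs, fun y hy => ⟨?_, fun w => ?_⟩⟩
  · have h1 := φ.dist_normed_convolution_le (μ := volume) (g := F) (x₀ := y) (ε := ε)
      hFi.aestronglyMeasurable fun x hx => ?_
    · rw [hF, indicator_of_mem (hball y hy)] at h1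
      exact h1
    · rw [Metric.mem_ball, dist_eq_norm, hout] at hx
      have hxB : x ∈ B := by
        have := hin y hy (y - x) (by rwa [norm_sub_rev])
        simpa using this
      rw [hF, indicator_of_mem hxB, indicator_of_mem (hball y hy)]
      exact (hf y (hball y hy) x hxB).trans (hrN _ (hx.trans_le (min_le_left _ _))).le
  · have hd : HasDerivAt (fun t : ℝ => g (y + t • w)) (fderiv ℝ g y w) 0 := by
      have h1 : HasFDerivAt g (fderiv ℝ g y) (y + (0 : ℝ) • w) := by
        simpa using (hgs.differentiable (by simp) y).hasFDerivAt
      have h2 : HasDerivAt (fun t : ℝ => y + t • w) w 0 := by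
        simpa using ((hasDerivAt_id (0 : ℝ)).smul_const w).const_add y
      exact h1.comp_hasDerivAt 0 h2
    have h3 := (hasDerivAt_iff_tendsto_slope.1 hd).abs
    refine le_of_tendsto h3 ?_
    have hcont : ContinuousAt (fun t : ℝ => y + t • w) 0 := by fun_prop
    have h4 : ∀ᶠ t in 𝓝 (0 : ℝ), y + t • w ∈ Metric.ball y₀ ρ :=
      hcont.eventually_mem (Metric.isOpen_ball.mem_nhds (by simpa using hy))
    filter_upwards [nhdsWithin_le_nhds h4, self_mem_nhdsWithin] with t ht ht0
    have ht0' : (0 : ℝ) < |t| := abs_pos.2 ht0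
    have h5 := hlip y hy _ ht
    rw [add_sub_cancel_left, hNs] at h5
    rw [slope_def_field, sub_zero, zero_smul, add_zero, abs_div, div_le_iff₀ ht0', mul_comm]
    exact h5

theorem norm_le_of_inner_coordVector_le {e : OpenPartialHomeomorph M (EuclideanSpace ℝ (Fin n))}
    (he : e ∈ IsManifold.maximalAtlas (𝓡 n) ∞ M) {y : EuclideanSpace ℝ (Fin n)} (hy : y ∈ e.target)
    {V : TangentSpace (𝓡 n) (e.symm y)} {C : ℝ} (hC : 0 ≤ C)
    (h : ∀ w, |inner ℝ V (coordVector n e y w)| ≤ C * ‖coordVector n e y w‖) : ‖V‖ ≤ C := by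
  obtain ⟨w, hw⟩ := (coordVector_bijective he hy).2 V
  have h1 := h w
  rw [hw, real_inner_self_eq_norm_sq, abs_of_nonneg (sq_nonneg _)] at h1
  rcases eq_or_lt_of_le (norm_nonneg V) with h0 | h0
  · rwa [← h0]
  · nlinarith

/-- Local smooth approximation of Lipschitz functions. -/
theorem exists_local_approx (x : M) : ∃ U : Set M, IsOpen U ∧ x ∈ U ∧ ∀ (f : M → ℝ) (L : ℝ), 0 ≤ L →
    (∀ a b, |f b - f a| ≤ L * dist a b) → ∀ ε > 0, ∃ g : M → ℝ,
      ContMDiffOn (𝓡 n) 𝓘(ℝ, ℝ) ∞ g U ∧ ∀ z ∈ U, |g z - f z| ≤ ε ∧ ‖grad n g z‖ ≤ 4 * L := by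
  set e := chartAt (EuclideanSpace ℝ (Fin n)) x
  have he : e ∈ IsManifold.maximalAtlas (𝓡 n) ∞ M := IsManifold.chart_mem_maximalAtlas x
  have hx : x ∈ e.source := mem_chart_source _ x
  have hy₀ := e.map_source hx
  set y₀ := e x
  -- On this ball the metric is within a factor 2 of its value at y₀. One factor is lost in passing
  -- from the distance to the frozen norm and one in passing back to the metric at y, whence 4 L.
  -- The ball is chosen before f and ε.
  obtain ⟨R, hR, hRb⟩ := Metric.eventually_nhds_iff.1
    ((eventually_norm_coordVector_le he hy₀).and (e.open_target.mem_nhds hy₀))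
  set ρ := R / 4
  have hρ : 0 < ρ := by positivity
  have hB : ∀ y ∈ Metric.closedBall y₀ (2 * ρ), dist y y₀ < R := fun y hy => by
    rw [Metric.mem_closedBall] at hy
    have : 2 * ρ < R := by simp only [ρ]; linarith
    linarith
  have hBt : Metric.closedBall y₀ (2 * ρ) ⊆ e.target := fun y hy => (hRb (hB y hy)).2
  have hbB : Metric.ball y₀ ρ ⊆ Metric.closedBall y₀ (2 * ρ) :=
    Metric.ball_subset_closedBall.trans (Metric.closedBall_subset_closedBall (by linarith))
  refine ⟨e.source ∩ e ⁻¹' Metric.ball y₀ ρ, e.isOpen_inter_preimage Metric.isOpen_ball,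
    ⟨hx, Metric.mem_ball_self hρ⟩, fun f L hL hf ε hε => ?_⟩
  have hN : Continuous fun w => 2 * L * ‖coordVector n e y₀ w‖ := by
    refine continuous_const.mul ?_
    have h1 : ∀ w : EuclideanSpace ℝ (Fin n), ‖coordVector n e y₀ w‖ =
        √(∑ i, ∑ j, w i * (w j * inner ℝ (coordVector n e y₀ (EuclideanSpace.single j 1))
          (coordVector n e y₀ (EuclideanSpace.single i 1)))) := fun w => by
      rw [← Real.sqrt_sq (norm_nonneg (coordVector n e y₀ w)), ← real_inner_self_eq_norm_sq]
      conv_lhs => rw [coordVector_eq_sum y₀ w]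
      simp only [sum_inner, inner_sum, real_inner_smul_left, real_inner_smul_right]
    simp_rw [h1]
    fun_prop
  have hN0 : 2 * L * ‖coordVector n e y₀ 0‖ = 0 := by
    have h0 : coordVector n e y₀ 0 = 0 := by
      simpa using coordVector_smul (e := e) 0 y₀ 0
    simp [h0]
  have hNs : ∀ (c : ℝ) w, 2 * L * ‖coordVector n e y₀ (c • w)‖ =
      |c| * (2 * L * ‖coordVector n e y₀ w‖) := fun c w => by
    rw [coordVector_smul, norm_smul, Real.norm_eq_abs]; ring
  have hfN : ∀ y ∈ Metric.closedBall y₀ (2 * ρ), ∀ z ∈ Metric.closedBall y₀ (2 * ρ),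
      |f (e.symm z) - f (e.symm y)| ≤ 2 * L * ‖coordVector n e y₀ (z - y)‖ := by
    intro y hy z hz
    refine (hf _ _).trans ?_
    have h1 : dist (e.symm y) (e.symm z) ≤ 2 * ‖coordVector n e y₀ (z - y)‖ :=
      dist_chart_symm_le he (convex_closedBall y₀ (2 * ρ)) hBt hy hz (by positivity)
        fun a ha => ((hRb (hB a ha)).1 _).1
    nlinarith
  obtain ⟨g, hg, hgb⟩ := exists_contDiff_approx_of_seminorm (y₀ := y₀) hρ
    (f := fun y => f (e.symm y)) (N := fun w => 2 * L * ‖coordVector n e y₀ w‖) hN hN0 hNs hfN hε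
  refine ⟨fun z => g (e z), ?_, ?_⟩
  · exact hg.contMDiff.comp_contMDiffOn ((contMDiffOn_chart he).mono inter_subset_left)
  · rintro z ⟨hz, hzb⟩
    have h1 := hgb (e z) hzb
    rw [e.left_inv hz] at h1
    refine ⟨h1.1, ?_⟩
    have hzt := e.map_source hz
    have h2 : ‖grad n (fun z => g (e z)) (e.symm (e z))‖ ≤ 4 * L := by
      refine norm_le_of_inner_coordVector_le he hzt (by positivity) fun w => ?_
      rw [inner_grad_coordVector he hzt]
      · have h3 : fderiv ℝ (fun y => g (e (e.symm y))) (e z) = fderiv ℝ g (e z) := by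
          refine Filter.EventuallyEq.fderiv_eq ?_
          filter_upwards [e.open_target.mem_nhds hzt] with y hy
          rw [e.right_inv hy]
        rw [h3]
        have h4 := ((hRb (hB _ (hbB hzb))).1 w).2
        refine (h1.2 w).trans ?_
        nlinarith
      · have : MDifferentiableAt (𝓡 n) 𝓘(ℝ, ℝ) (g ∘ e) (e.symm (e z)) :=
          MDifferentiableAt.comp _ ((hg.differentiable (by simp)).mdifferentiable _)
            (mdifferentiableAt_chart he (e.map_target hzt))
        exact this
    rwa [e.left_inv hz] at h2
theorem grad_sum {ι : Type*} (s : Finset ι) {f : ι → M → ℝ} {x : M}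
    (hf : ∀ i ∈ s, MDifferentiableAt (𝓡 n) 𝓘(ℝ, ℝ) (f i) x) :
    grad n (fun z => ∑ i ∈ s, f i z) x = ∑ i ∈ s, grad n (f i) x := by
  classical
  have h : MDifferentiableAt (𝓡 n) 𝓘(ℝ, ℝ) (fun z => ∑ i ∈ s, f i z) x ∧
      grad n (fun z => ∑ i ∈ s, f i z) x = ∑ i ∈ s, grad n (f i) x := by
    induction s using Finset.induction_on with
    | empty =>
      simp only [Finset.sum_empty]
      exact ⟨mdifferentiableAt_const, grad_of_notMem_tsupport (by simp [tsupport])⟩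
    | insert a s ha ih =>
      simp only [Finset.sum_insert ha]
      obtain ⟨h1, h2⟩ := ih fun i hi => hf i (Finset.mem_insert_of_mem hi)
      have h3 := hf a (Finset.mem_insert_self a s)
      exact ⟨h3.add h1, by rw [grad_add h3 h1, h2]⟩
  exact h.2

theorem grad_congr {f g : M → ℝ} {x : M} (h : f =ᶠ[𝓝 x] g) : grad n f x = grad n g x := by
  refine ext_inner_right ℝ fun V => ?_
  rw [inner_grad, inner_grad, h.mfderiv_eq]
  rfl

/-- Local approximations g_i are glued by a partition of unity. Since ∑ ρ_i is locally constant
where f ≠ 0, the gradient of ∑ ρ_i g_i equals ∑ ρ_i ∇g_i + ∑ (g_i - f) ∇ρ_i. The first sum is at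
most 4 L, and the second is small once the g_i are close enough to f. -/
theorem exists_smooth_approx [CompleteSpace M] [SecondCountableTopology M] {f : M → ℝ} {L : ℝ}
    (hL : 0 ≤ L) (hf : ∀ a b, |f b - f a| ≤ L * dist a b) (hc : HasCompactSupport f) {ε : ℝ}
    (hε : 0 < ε) :
    ∃ η : M → ℝ, ContMDiff (𝓡 n) 𝓘(ℝ, ℝ) ∞ η ∧ HasCompactSupport η ∧
      (∀ x, |η x - f x| ≤ ε) ∧ ∀ x, ‖grad n η x‖ ≤ 4 * L + ε := by
  have : ProperSpace M := properSpace_of_complete n M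
  choose U hUo hxU hU using fun x : M => exists_local_approx (n := n) x
  obtain ⟨ρ, hρ⟩ := SmoothPartitionOfUnity.exists_isSubordinate (𝓡 n) (isClosed_univ (X := M))
    (fun x => U x ∩ Metric.ball x 1) (fun x => (hUo x).inter Metric.isOpen_ball)
    (fun x _ => mem_iUnion.2 ⟨x, hxU x, Metric.mem_ball_self one_pos⟩)
  have hρU : ∀ i, tsupport (ρ i) ⊆ U i := fun i => (hρ i).trans inter_subset_left
  have hρc : ∀ i, HasCompactSupport (ρ i) := fun i =>
    (isCompact_closedBall i 1).of_isClosed_subset (isClosed_tsupport _)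
      ((hρ i).trans (inter_subset_right.trans Metric.ball_subset_closedBall))
  have hρs : ∀ i, ContMDiff (𝓡 n) 𝓘(ℝ, ℝ) ∞ fun x => ρ i x := fun i => (ρ i).contMDiff
  have hfin : {i | (Function.support (ρ i) ∩ tsupport f).Nonempty}.Finite :=
    ρ.locallyFinite.finite_nonempty_inter_compact hc
  set s := hfin.toFinset
  have hsum1 : ∀ x ∈ tsupport f, ∑ i ∈ s, ρ i x = 1 := by
    intro x hx
    rw [← ρ.sum_eq_one (mem_univ x), finsum_eq_sum_of_support_subset]
    intro i hi
    simpa [s] using ⟨x, hi, hx⟩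
  have hsumle : ∀ x, ∑ i ∈ s, ρ i x ≤ 1 := by
    intro x
    refine le_trans ?_ (ρ.sum_le_one x)
    rw [finsum_eq_sum_of_support_subset_of_finite _ (Subset.refl _) (ρ.locallyFinite.point_finite x)]
    classical
    rw [← Finset.sum_filter_add_sum_filter_not s (fun i => ρ i x ≠ 0)]
    have h0 : ∑ i ∈ s with ¬ ρ i x ≠ 0, ρ i x = 0 :=
      Finset.sum_eq_zero fun i hi => by simpa using (Finset.mem_filter.1 hi).2
    rw [h0, add_zero]
    refine Finset.sum_le_sum_of_subset_of_nonneg (fun i hi => ?_) fun i _ _ => ρ.nonneg i x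
    exact (ρ.locallyFinite.point_finite x).mem_toFinset.2 (Finset.mem_filter.1 hi).2
  have hbd : ∀ i, ∃ B, 0 ≤ B ∧ ∀ x, ‖grad n (fun x => ρ i x) x‖ ≤ B := fun i => by
    obtain ⟨B, hB⟩ := (hasCompactSupport_grad (n := n) (hρc i)).exists_bound_of_continuous
      (continuous_norm_grad (hρs i))
    rcases isEmpty_or_nonempty M with h | ⟨⟨x⟩⟩
    · exact ⟨0, le_rfl, fun x => h.elim x⟩
    · exact ⟨B, (norm_nonneg _).trans (hB x), fun x => by simpa using hB x⟩
  choose B hB0 hB using hbd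
  -- Small enough both for the error in the values (ε' ≤ ε) and for the error in the gradient (ε' ∑
  -- B_i ≤ ε). The partition, and with it the B_i, is already fixed, because the sets U i work for
  -- every accuracy.
  set ε' := ε / (1 + ∑ i ∈ s, B i) with hε'
  have hS0 : 0 ≤ ∑ i ∈ s, B i := Finset.sum_nonneg fun i _ => hB0 i
  have hε'0 : 0 < ε' := by positivity
  have hε'e : ε' * (1 + ∑ i ∈ s, B i) = ε := div_mul_cancel₀ _ (by positivity)
  have hε'1 : ε' ≤ ε := by nlinarith
  have hε'2 : ε' * ∑ i ∈ s, B i ≤ ε := by nlinarith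
  choose g hgs hg using fun i => hU i f L hL hf ε' hε'0
  have hprod : ∀ i, ContMDiff (𝓡 n) 𝓘(ℝ, ℝ) ∞ fun x => ρ i x * g i x := fun i => by
    refine contMDiff_of_tsupport fun x hx => ?_
    have hxU : x ∈ U i := hρU i (tsupport_mul_subset_left (f := fun x => ρ i x) (g := g i) hx)
    exact (hρs i).contMDiffAt.mul ((hgs i).contMDiffAt ((hUo i).mem_nhds hxU))
  have hgrad : ∀ i x, grad n (fun x => ρ i x * g i x) x =
      ρ i x • grad n (g i) x + g i x • grad n (fun x => ρ i x) x := by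
    intro i x
    by_cases hx : x ∈ tsupport (ρ i)
    · exact grad_mul ((hρs i).mdifferentiable (by simp) x)
        (((hgs i).contMDiffAt ((hUo i).mem_nhds (hρU i hx))).mdifferentiableAt (by simp))
    · rw [grad_of_notMem_tsupport fun h => hx (tsupport_mul_subset_left (f := fun x => ρ i x) (g := g i) h),
        image_eq_zero_of_notMem_tsupport hx, grad_of_notMem_tsupport (f := fun x => ρ i x) hx]
      simp
  have hfz : ∀ x, x ∉ tsupport f → f x = 0 := fun x hx => image_eq_zero_of_notMem_tsupport hx
  have hfsum : ∀ x, f x = ∑ i ∈ s, ρ i x * f x := fun x => by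
    by_cases hx : x ∈ tsupport f
    · rw [← Finset.sum_mul, hsum1 x hx, one_mul]
    · simp [hfz x hx]
  have hfcont : Continuous f := by
    have : LipschitzWith (Real.toNNReal L) f := LipschitzWith.of_dist_le_mul fun a b => by
      rw [Real.coe_toNNReal _ hL, dist_comm, Real.dist_eq]; exact hf a b
    exact this.continuous
  have hpt : ∀ i x, x ∉ U i → ρ i x = 0 := fun i x hx =>
    image_eq_zero_of_notMem_tsupport fun h => hx (hρU i h)
  have hfg : ∀ x, f x • ∑ i ∈ s, grad n (fun x => ρ i x) x = 0 := by
    intro x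
    by_cases hx : f x = 0
    · rw [hx, zero_smul]
    · rw [← grad_sum s fun i _ => (hρs i).mdifferentiable (by simp) x]
      have h1 : (fun z => ∑ i ∈ s, ρ i z) =ᶠ[𝓝 x] fun z => 1 := by
        filter_upwards [hfcont.continuousAt.eventually_ne hx] with z hz
        exact hsum1 z (subset_tsupport f hz)
      have h2 : grad n (fun _ : M => (1 : ℝ)) x = 0 := by
        refine ext_inner_right ℝ fun V => ?_
        rw [inner_grad, mfderiv_const, inner_zero_left]
        rfl
      rw [grad_congr h1, h2, smul_zero]
  refine ⟨fun x => ∑ i ∈ s, ρ i x * g i x, contMDiff_finsetSum fun i _ => hprod i, ?_, ?_, ?_⟩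
  · refine HasCompactSupport.of_support_subset_isCompact
      (s.isCompact_biUnion fun i _ => (hρc i : IsCompact (tsupport (ρ i)))) fun x hx => ?_
    obtain ⟨i, hi, hne⟩ := Finset.exists_ne_zero_of_sum_ne_zero hx
    exact mem_iUnion₂.2 ⟨i, hi, subset_tsupport _ (left_ne_zero_of_mul hne)⟩
  · intro x
    conv_lhs => rw [hfsum x, ← Finset.sum_sub_distrib]
    calc _ ≤ ∑ i ∈ s, |ρ i x * g i x - ρ i x * f x| := Finset.abs_sum_le_sum_abs _ _
      _ ≤ ∑ i ∈ s, ρ i x * ε' := by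
          refine Finset.sum_le_sum fun i _ => ?_
          rw [← mul_sub, abs_mul, abs_of_nonneg (ρ.nonneg i x)]
          by_cases hx : x ∈ U i
          · exact mul_le_mul_of_nonneg_left (hg i x hx).1 (ρ.nonneg i x)
          · simp [hpt i x hx]
      _ ≤ ε := by
          rw [← Finset.sum_mul]
          nlinarith [hsumle x]
  · intro x
    rw [grad_sum s fun i _ => (hprod i).mdifferentiable (by simp) x]
    have h1 : ∑ i ∈ s, grad n (fun x => ρ i x * g i x) x =
        ∑ i ∈ s, ρ i x • grad n (g i) x +
          ∑ i ∈ s, (g i x - f x) • grad n (fun x => ρ i x) x := by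
      simp only [hgrad, sub_smul, Finset.sum_add_distrib, Finset.sum_sub_distrib]
      rw [← Finset.smul_sum (r := f x), hfg x, sub_zero]
    rw [h1]
    refine (norm_add_le _ _).trans (add_le_add ?_ ?_)
    · calc _ ≤ ∑ i ∈ s, ‖ρ i x • grad n (g i) x‖ := norm_sum_le _ _
        _ ≤ ∑ i ∈ s, ρ i x * (4 * L) := by
            refine Finset.sum_le_sum fun i _ => ?_
            rw [norm_smul, Real.norm_eq_abs, abs_of_nonneg (ρ.nonneg i x)]
            by_cases hx : x ∈ U i
            · exact mul_le_mul_of_nonneg_left (hg i x hx).2 (ρ.nonneg i x)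
            · simp [hpt i x hx]
        _ ≤ 4 * L := by
            rw [← Finset.sum_mul]
            nlinarith [hsumle x]
    · calc _ ≤ ∑ i ∈ s, ‖(g i x - f x) • grad n (fun x => ρ i x) x‖ := norm_sum_le _ _
        _ ≤ ∑ i ∈ s, ε' * B i := by
            refine Finset.sum_le_sum fun i _ => ?_
            rw [norm_smul, Real.norm_eq_abs]
            by_cases hx : x ∈ tsupport (ρ i)
            · exact mul_le_mul (hg i x (hρU i hx)).1 (hB i x) (norm_nonneg _) hε'0.le
            · rw [grad_of_notMem_tsupport (f := fun x => ρ i x) hx, norm_zero, mul_zero]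
              exact mul_nonneg hε'0.le (hB0 i)
        _ ≤ ε := by rwa [← Finset.mul_sum]

-- The tents max(0, 1 - d(x₀, ·)/(k+1)) have compact support because closed balls are compact. They
-- are smoothed with accuracy equal to their Lipschitz constant 1/(k+1): this gives 4/(k+1) +
-- 1/(k+1) for the gradient and 1 + 1 for the values.
variable (n M) in
theorem exists_cutoffs [CompleteSpace M] [SecondCountableTopology M] :
    ∃ η : ℕ → M → ℝ, (∀ k, ContMDiff (𝓡 n) 𝓘(ℝ, ℝ) ∞ (η k)) ∧ (∀ k, HasCompactSupport (η k)) ∧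
      (∀ k x, |η k x| ≤ 2) ∧ (∀ k x, ‖grad n (η k) x‖ ≤ 5 / ((k : ℝ) + 1)) ∧
      ∀ x, Tendsto (fun k => η k x) atTop (𝓝 1) := by
  have : ProperSpace M := properSpace_of_complete n M
  rcases isEmpty_or_nonempty M with h | ⟨⟨x₀⟩⟩
  · exact ⟨fun _ x => h.elim x, fun _ x => h.elim x,
      fun _ => by rw [HasCompactSupport, eq_empty_of_isEmpty (tsupport _)]; exact isCompact_empty,
      fun _ x => h.elim x, fun _ x => h.elim x, fun x => h.elim x⟩
  set L : ℕ → ℝ := fun k => 1 / ((k : ℝ) + 1)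
  have hL : ∀ k, 0 < L k := fun k => by positivity
  have hL1 : ∀ k, L k ≤ 1 := fun k => by
    rw [div_le_one (by positivity)]; linarith [(Nat.cast_nonneg k : (0 : ℝ) ≤ k)]
  have hL0 : Tendsto L atTop (𝓝 0) := tendsto_one_div_add_atTop_nhds_zero_nat
  set f : ℕ → M → ℝ := fun k x => max 0 (1 - L k * dist x₀ x)
  have hf : ∀ k a b, |f k b - f k a| ≤ L k * dist a b := fun k a b => by
    have h := abs_max_sub_max_le_abs (1 - L k * dist x₀ b) (1 - L k * dist x₀ a) 0
    simp only [f, max_comm (0 : ℝ)]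
    refine h.trans ?_
    rw [abs_le]
    constructor
    · nlinarith [dist_triangle x₀ a b, hL k]
    · nlinarith [dist_triangle x₀ b a, hL k, dist_comm a b]
  have hfc : ∀ k, HasCompactSupport (f k) := fun k => by
    refine HasCompactSupport.of_support_subset_isCompact (isCompact_closedBall x₀ (L k)⁻¹)
      fun x hx => ?_
    rw [Metric.mem_closedBall, dist_comm]
    by_contra! hlt
    refine hx (max_eq_left ?_)
    rw [inv_lt_iff_one_lt_mul₀ (hL k)] at hlt
    linarith
  have hf1 : ∀ k x, |f k x| ≤ 1 := fun k x => by
    rw [abs_of_nonneg (le_max_left _ _)]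
    exact max_le zero_le_one (by nlinarith [hL k, dist_nonneg (x := x₀) (y := x)])
  choose η h1 h2 h3 h4 using fun k => exists_smooth_approx (n := n) (hL k).le (hf k) (hfc k) (hL k)
  refine ⟨η, h1, h2, fun k x => ?_, fun k x => (h4 k x).trans (by simp only [L]; ring_nf; rfl),
    fun x => ?_⟩
  · have := abs_le.1 (h3 k x)
    have h5 := abs_le.1 (hf1 k x)
    exact abs_le.2 ⟨by linarith [hL1 k], by linarith [hL1 k]⟩
  · have h5 : Tendsto (fun k => f k x) atTop (𝓝 1) := by
      have : Tendsto (fun k => max 0 (1 - L k * dist x₀ x)) atTop (𝓝 (max 0 (1 - 0 * dist x₀ x))) :=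
        tendsto_const_nhds.max (tendsto_const_nhds.sub (hL0.mul_const _))
      simpa using this
    have h6 : Tendsto (fun k => η k x - f k x) atTop (𝓝 0) :=
      squeeze_zero_norm (fun k => h3 k x) hL0
    simpa using h6.add h5

end Cutoff

/-! ### Truncations vanishing near zero and near infinity -/

section Truncation

/-- T_m(s) = s κ(c s) (1 - κ(s/c)) with c = m + 1, where κ is 0 for s² ≤ 1 and 1 for s² ≥ 2. The
derivatives are bounded uniformly in m because s κ'(s) is bounded and this bound is unchanged by
scaling. Vanishing at both ends gives domination by any power |s|^a, which is what moves T_m(v) from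
one Lebesgue space into another. -/
theorem exists_truncations : ∃ C : ℝ, ∃ T : ℕ → ℝ → ℝ, (∀ m, ContDiff ℝ ∞ (T m)) ∧
    (∀ m s, |T m s| ≤ |s|) ∧ (∀ m, ∀ a ≥ 0, ∃ B, ∀ s, |T m s| ≤ B * |s| ^ (a : ℝ)) ∧
    (∀ m s, |deriv (T m) s| ≤ C) ∧ (∀ s, Tendsto (fun m => T m s) atTop (𝓝 s)) ∧
    (∀ s ≠ 0, Tendsto (fun m => deriv (T m) s) atTop (𝓝 1)) ∧ ∀ m, deriv (T m) 0 = 0 := by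
  set κ : ℝ → ℝ := fun s => Real.smoothTransition (s ^ 2 - 1) with hκ
  have hκs : ContDiff ℝ ∞ κ := Real.smoothTransition.contDiff.comp (by fun_prop)
  have hκ0 : ∀ s, s ^ 2 ≤ 1 → κ s = 0 := fun s hs =>
    Real.smoothTransition.zero_of_nonpos (by linarith)
  have hκ1 : ∀ s, 2 ≤ s ^ 2 → κ s = 1 := fun s hs =>
    Real.smoothTransition.one_of_one_le (by linarith)
  have hκn : ∀ s, 0 ≤ κ s := fun s => Real.smoothTransition.nonneg _
  have hκl : ∀ s, κ s ≤ 1 := fun s => Real.smoothTransition.le_one _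
  have hκd : Differentiable ℝ κ := hκs.differentiable (by simp)
  have hd0 : ∀ s, s ^ 2 < 1 → deriv κ s = 0 := fun s hs => by
    have : κ =ᶠ[𝓝 s] fun _ => 0 := by
      filter_upwards [(show ContinuousAt (fun s : ℝ => s ^ 2) s by fun_prop).eventually_lt
        continuousAt_const hs] with z hz using hκ0 z hz.le
    rw [this.deriv_eq, deriv_const]
  have hd1 : ∀ s, 2 < s ^ 2 → deriv κ s = 0 := fun s hs => by
    have : κ =ᶠ[𝓝 s] fun _ => 1 := by
      filter_upwards [continuousAt_const.eventually_lt
        (show ContinuousAt (fun s : ℝ => s ^ 2) s by fun_prop) hs] with z hz using hκ1 z hz.le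
    rw [this.deriv_eq, deriv_const]
  obtain ⟨A, hA⟩ : ∃ A, ∀ s, ‖s * deriv κ s‖ ≤ A := by
    refine HasCompactSupport.exists_bound_of_continuous ?_
      (continuous_id.mul (hκs.continuous_deriv (by simp)))
    refine HasCompactSupport.intro (isCompact_Icc (a := (-2 : ℝ)) (b := 2)) fun s hs => ?_
    rw [hd1, mul_zero]
    by_contra! h
    exact hs (abs_le.1 (abs_le_of_sq_le_sq (by linarith) (by norm_num)))
  have hA0 : 0 ≤ A := (norm_nonneg _).trans (hA 0)
  set c : ℕ → ℝ := fun m => (m : ℝ) + 1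
  have hc : ∀ m, 1 ≤ c m := fun m => by simp [c]
  have hc0 : ∀ m, 0 < c m := fun m => one_pos.trans_le (hc m)
  have hct : Tendsto c atTop atTop := tendsto_natCast_atTop_atTop.atTop_add tendsto_const_nhds
  set T : ℕ → ℝ → ℝ := fun m s => s * (κ (c m * s) * (1 - κ ((c m)⁻¹ * s))) with hT
  have hTs : ∀ m, ContDiff ℝ ∞ (T m) := fun m =>
    contDiff_id.mul ((hκs.comp (by fun_prop)).mul (contDiff_const.sub (hκs.comp (by fun_prop))))
  have hTd : ∀ m s, deriv (T m) s = κ (c m * s) * (1 - κ ((c m)⁻¹ * s)) +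
      ((c m * s) * deriv κ (c m * s) * (1 - κ ((c m)⁻¹ * s)) -
        κ (c m * s) * ((c m)⁻¹ * s * deriv κ ((c m)⁻¹ * s))) := fun m s => by
    have h1 : ∀ b : ℝ, HasDerivAt (fun s => κ (b * s)) (deriv κ (b * s) * b) s := fun b => by
      have := (hκd (b * s)).hasDerivAt.comp s ((hasDerivAt_id s).const_mul b)
      rw [mul_one] at this
      exact this
    have h2 := (hasDerivAt_id s).mul ((h1 (c m)).mul ((h1 (c m)⁻¹).const_sub 1))
    refine h2.deriv.trans ?_
    simp only [id, Pi.mul_apply]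
    ring
  have hTle : ∀ m s, |T m s| ≤ |s| := fun m s => by
    rw [hT, abs_mul]
    refine mul_le_of_le_one_right (abs_nonneg _) ?_
    rw [abs_of_nonneg (mul_nonneg (hκn _) (by linarith [hκl ((c m)⁻¹ * s)]))]
    exact mul_le_one₀ (hκl _) (by linarith [hκl ((c m)⁻¹ * s)]) (by linarith [hκn ((c m)⁻¹ * s)])
  have hev : ∀ s : ℝ, s ≠ 0 → ∀ᶠ m in atTop, 2 < (c m * s) ^ 2 ∧ ((c m)⁻¹ * s) ^ 2 < 1 := by
    intro s hs
    have hs' : 0 < |s| := abs_pos.2 hs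
    filter_upwards [hct.eventually_gt_atTop (2 / |s|), hct.eventually_gt_atTop |s|] with m h1 h2
    rw [div_lt_iff₀ hs'] at h1
    constructor
    · rw [← sq_abs, abs_mul, abs_of_pos (hc0 m)]
      nlinarith
    · rw [sq_lt_one_iff_abs_lt_one, abs_mul, abs_inv, abs_of_pos (hc0 m), inv_mul_lt_iff₀ (hc0 m),
        mul_one]
      exact h2
  refine ⟨1 + (A + A), T, hTs, hTle, fun m a ha => ?_, fun m s => ?_, fun s => ?_, fun s hs => ?_,
    fun m => ?_⟩
  -- T_m is nonzero only for 1/c ≤ |s| ≤ 2c, and there |T_m s| ≤ |s| ≤ 2c ≤ 2c (c|s|)^a.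
  · refine ⟨2 * c m * c m ^ a, fun s => ?_⟩
    have hB : 0 ≤ 2 * c m * c m ^ a * |s| ^ a := by have := hc0 m; positivity
    by_cases h1 : (c m * s) ^ 2 ≤ 1
    · simpa [hT, hκ0 _ h1] using hB
    by_cases h2 : 2 ≤ ((c m)⁻¹ * s) ^ 2
    · simpa [hT, hκ1 _ h2] using hB
    push Not at h1 h2
    have h3 : 1 ≤ c m * |s| := by
      rw [← abs_of_pos (hc0 m), ← abs_mul]
      exact ((one_lt_sq_iff_one_lt_abs _).1 h1).le
    have h4 : |s| ≤ 2 * c m := by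
      have : |(c m)⁻¹ * s| ≤ 2 := abs_le_of_sq_le_sq (by linarith) (by norm_num)
      rw [abs_mul, abs_inv, abs_of_pos (hc0 m), inv_mul_le_iff₀ (hc0 m)] at this
      linarith
    calc |T m s| ≤ 2 * c m * 1 := by linarith [hTle m s]
      _ ≤ 2 * c m * (c m * |s|) ^ a := by
          have := hc0 m
          gcongr
          exact Real.one_le_rpow h3 ha
      _ = _ := by rw [Real.mul_rpow (hc0 m).le (abs_nonneg _), mul_assoc (2 * c m)]
  · rw [hTd]
    have e1 : |1 - κ ((c m)⁻¹ * s)| ≤ 1 := abs_le.2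
      ⟨by linarith [hκl ((c m)⁻¹ * s)], by linarith [hκn ((c m)⁻¹ * s)]⟩
    have e2 : |κ (c m * s)| ≤ 1 := abs_le.2 ⟨by linarith [hκn (c m * s)], hκl _⟩
    refine (abs_add_le _ _).trans (add_le_add ?_ ((abs_sub _ _).trans (add_le_add ?_ ?_)))
    · rw [abs_mul]; exact mul_le_one₀ e2 (abs_nonneg _) e1
    · rw [abs_mul]
      exact (mul_le_of_le_one_right (abs_nonneg _) e1).trans (hA _)
    · rw [abs_mul]
      exact (mul_le_of_le_one_left (abs_nonneg _) e2).trans (hA _)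
  · rcases eq_or_ne s 0 with rfl | hs
    · simp [hT]
    · refine tendsto_const_nhds.congr' ?_
      filter_upwards [hev s hs] with m hm
      simp [hT, hκ1 _ hm.1.le, hκ0 _ hm.2.le]
  · refine tendsto_const_nhds.congr' ?_
    filter_upwards [hev s hs] with m hm
    simp [hTd, hκ1 _ hm.1.le, hκ0 _ hm.2.le, hd1 _ hm.1, hd0 _ hm.2]
  · have : κ 0 = 0 := hκ0 0 (by norm_num)
    simp [hTd, this]

theorem memLp_abs_rpow {α : Type*} [MeasurableSpace α] {μ : Measure α} {f : α → ℝ} {r a : ℝ}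
    (ha : 0 < a) (hf : MemLp f (ENNReal.ofReal r) μ) :
    MemLp (fun x => |f x| ^ a) (ENNReal.ofReal (r / a)) μ := by
  have h := hf.norm_rpow_div (ENNReal.ofReal a)
  rw [ENNReal.toReal_ofReal ha.le, ← ENNReal.ofReal_div_of_pos ha] at h
  exact h

end Truncation

/-! ### Testing the equation with v itself -/

section Pairing

set_option linter.unusedSectionVars false

variable {n : ℕ} {M : Type*} [MetricSpace M] [MeasurableSpace M] [BorelSpace M]
  [ChartedSpace (EuclideanSpace ℝ (Fin n)) M] [IsManifold (𝓡 n) ∞ M]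
  [RiemannianBundle (fun x : M => TangentSpace (𝓡 n) x)]
  [IsContMDiffRiemannianBundle (𝓡 n) ∞ (EuclideanSpace ℝ (Fin n))
      (fun x : M => TangentSpace (𝓡 n) x)]
  {φ : M → ℝ} {p p' r r' : ℝ} {h v : M → ℝ} {W X : ∀ x : M, TangentSpace (𝓡 n) x}

/-- Takes the place of the fact that the weak gradient vanishes almost everywhere on {v = 0}. The
equation is tested with η T_k(v), where T_k(s) = c⁻¹ arctan(c s) and c = k + 1: T_k tends to 0
uniformly, while T_k' = 1/(1 + (c s)²) tends boundedly to the indicator of {0}. -/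
theorem integral_indicator_zero_of_hasCompactSupport [SecondCountableTopology M] (hφ : Continuous φ)
    (hpp : p.HolderConjugate p') (hr : r.HolderConjugate r')
    (hh : MemLp h (ENNReal.ofReal r) (weightedVolume n φ))
    (hWm : ChartMeasurable W)
    (hW : MemLp (fun x => ‖W x‖) (ENNReal.ofReal p') (weightedVolume n φ))
    (hv : AEStronglyMeasurable v (weightedVolume n φ))
    (hvX : IsWeakGrad n v X)
    (hX : MemLp (fun x => ‖X x‖) (ENNReal.ofReal p) (weightedVolume n φ))
    (hdiv : ∀ ψ : M → ℝ, ContMDiff (𝓡 n) 𝓘(ℝ, ℝ) ∞ ψ → HasCompactSupport ψ →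
      ∫ x, h x * ψ x ∂(weightedVolume n φ) =
        -∫ x, inner ℝ (W x) (grad n ψ x) ∂(weightedVolume n φ))
    {η : M → ℝ} (hη : ContMDiff (𝓡 n) 𝓘(ℝ, ℝ) ∞ η) (hc : HasCompactSupport η) :
    ∫ x, η x * (({0} : Set ℝ).indicator 1 (v x) * inner ℝ (W x) (X x)) ∂(weightedVolume n φ) = 0 := by
  set c : ℕ → ℝ := fun k => (k : ℝ) + 1
  have hc1 : ∀ k, 1 ≤ c k := fun k => by simp [c]
  have hc0 : ∀ k, 0 < c k := fun k => one_pos.trans_le (hc1 k)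
  have hct : Tendsto c atTop atTop := tendsto_natCast_atTop_atTop.atTop_add tendsto_const_nhds
  have hci : Tendsto (fun k => (c k)⁻¹) atTop (𝓝 0) := tendsto_inv_atTop_zero.comp hct
  set T : ℕ → ℝ → ℝ := fun k s => (c k)⁻¹ * Real.arctan (c k * s) with hT
  have hTs : ∀ k, ContDiff ℝ ∞ (T k) := fun k =>
    contDiff_const.mul (Real.contDiff_arctan.comp (by fun_prop))
  have hTd : ∀ k s, deriv (T k) s = 1 / (1 + (c k * s) ^ 2) := fun k s => by
    have h1 : HasDerivAt (T k) ((c k)⁻¹ * (1 / (1 + (c k * s) ^ 2) * (c k * 1))) s :=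
      ((Real.hasDerivAt_arctan (c k * s)).comp s ((hasDerivAt_id s).const_mul (c k))).const_mul _
    rw [h1.deriv]
    have := (hc0 k).ne'
    field_simp
  have hTb : ∀ k s, |T k s| ≤ 2 * (c k)⁻¹ := fun k s => by
    rw [hT, abs_mul, abs_of_pos (inv_pos.2 (hc0 k)), mul_comm]
    refine mul_le_mul_of_nonneg_right ?_ (inv_pos.2 (hc0 k)).le
    have h1 := Real.pi_lt_four
    exact abs_le.2 ⟨by linarith [Real.neg_pi_div_two_lt_arctan (c k * s)],
      by linarith [Real.arctan_lt_pi_div_two (c k * s)]⟩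
  have hTb2 : ∀ k s, |T k s| ≤ 2 := fun k s => (hTb k s).trans (by
    have := inv_le_one_of_one_le₀ (hc1 k); linarith)
  have hTd1 : ∀ k s, |deriv (T k) s| ≤ 1 := fun k s => by
    rw [hTd, abs_of_nonneg (by positivity), div_le_one (by positivity)]
    nlinarith [sq_nonneg (c k * s)]
  have hT0 : ∀ s, Tendsto (fun k => T k s) atTop (𝓝 0) := fun s =>
    squeeze_zero_norm (fun k => hTb k s) (by simpa using hci.const_mul 2)
  have hTd0 : ∀ s, Tendsto (fun k => deriv (T k) s) atTop (𝓝 (({0} : Set ℝ).indicator 1 s)) := by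
    intro s
    by_cases hs : s = 0
    · simp [hs, hTd]
    · rw [indicator_of_notMem (by simpa using hs)]
      simp only [hTd]
      refine tendsto_const_nhds.div_atTop (tendsto_atTop_add_const_left _ _ ?_)
      have : Tendsto (fun k => c k * (c k * s ^ 2)) atTop atTop :=
        hct.atTop_mul_atTop₀ (hct.atTop_mul_const (by positivity))
      exact this.congr fun k => by ring
  have key : ∀ k, ∫ x, h x * (η x * T k (v x)) ∂(weightedVolume n φ) = _ := fun k =>
    integral_test_comp hφ hpp hr hh hWm hW hv hvX hX hdiv (hTs k) (C := 2) (hTb2 k)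
    (fun s => (hTd1 k s).trans one_le_two) hη hc
  have hηL : ∀ e, MemLp η e (weightedVolume n φ) := fun e =>
    memLp_of_continuous_of_hasCompactSupport hφ hη.continuous hc e
  have hhη : Integrable (fun x => h x * η x) (weightedVolume n φ) :=
    integrable_mul_of_memLp hr hh (hηL _)
  have hWX := integrable_inner_of_memLp hφ hpp hWm hW hvX.chartMeasurable hX
  have hWη := integrable_inner_of_memLp hφ hpp hWm hW (chartMeasurable_grad hη)
    (memLp_of_continuous_of_hasCompactSupport hφ (continuous_norm_grad hη)
      (hasCompactSupport_grad hc) _)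
  obtain ⟨B, hB⟩ := hc.exists_bound_of_continuous hη.continuous
  have hηWX : Integrable (fun x => η x * inner ℝ (W x) (X x)) (weightedVolume n φ) :=
    hWX.bdd_mul hη.continuous.aestronglyMeasurable (Eventually.of_forall hB)
  have hTv : ∀ k, AEStronglyMeasurable (fun x => T k (v x)) (weightedVolume n φ) := fun k =>
    (hTs k).continuous.comp_aestronglyMeasurable hv
  have hTv' : ∀ k, AEStronglyMeasurable (fun x => deriv (T k) (v x)) (weightedVolume n φ) := fun k =>
    ((hTs k).continuous_deriv (by simp)).comp_aestronglyMeasurable hv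
  have lim1 : Tendsto (fun k => ∫ x, h x * (η x * T k (v x)) ∂(weightedVolume n φ)) atTop
      (𝓝 (∫ _, (0 : ℝ) ∂(weightedVolume n φ))) := by
    refine tendsto_integral_of_dominated_convergence (fun x => 2 * ‖h x * η x‖)
      (fun k => hh.1.mul (hη.continuous.aestronglyMeasurable.mul (hTv k))) (hhη.norm.const_mul 2)
      (fun k => Eventually.of_forall fun x => ?_) (Eventually.of_forall fun x => ?_)
    · rw [← mul_assoc, norm_mul, mul_comm]
      exact mul_le_mul_of_nonneg_right (hTb2 k _) (norm_nonneg _)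
    · simpa using ((hT0 (v x)).const_mul (η x)).const_mul (h x)
  have lim2 : Tendsto (fun k => ∫ x, (η x * deriv (T k) (v x) * inner ℝ (W x) (X x) +
      T k (v x) * inner ℝ (W x) (grad n η x)) ∂(weightedVolume n φ)) atTop
      (𝓝 (∫ x, η x * (({0} : Set ℝ).indicator 1 (v x) * inner ℝ (W x) (X x))
        ∂(weightedVolume n φ))) := by
    refine tendsto_integral_of_dominated_convergence (fun x => 1 * ‖η x * inner ℝ (W x) (X x)‖ +
      2 * ‖inner ℝ (W x) (grad n η x)‖)
      (fun k => ((hη.continuous.aestronglyMeasurable.mul (hTv' k)).mul hWX.1).add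
        ((hTv k).mul hWη.1)) ((hηWX.norm.const_mul 1).add (hWη.norm.const_mul 2))
      (fun k => Eventually.of_forall fun x => ?_) (Eventually.of_forall fun x => ?_)
    · refine (norm_add_le _ _).trans (add_le_add ?_ ?_)
      · rw [mul_right_comm, norm_mul, mul_comm]
        exact mul_le_mul_of_nonneg_right (hTd1 k _) (norm_nonneg _)
      · rw [norm_mul]
        exact mul_le_mul_of_nonneg_right (hTb2 k _) (norm_nonneg _)
    · have := (((hTd0 (v x)).const_mul (η x)).mul_const (inner ℝ (W x) (X x))).add
        ((hT0 (v x)).mul_const (inner ℝ (W x) (grad n η x)))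
      simpa [mul_assoc] using this
  have h1 := tendsto_nhds_unique lim1 ((lim2.neg).congr fun k => (key k).symm)
  simpa using h1.symm

/-- The equation `div W = h` may be tested with `v`. -/
theorem integral_mul_eq_neg_integral_inner [SecondCountableTopology M] [CompleteSpace M]
    [IsRiemannianManifold (𝓡 n) M] (hφ : Continuous φ)
    (hpp : p.HolderConjugate p') (hr : r.HolderConjugate r')
    (hh : MemLp h (ENNReal.ofReal r) (weightedVolume n φ))
    (hWm : ChartMeasurable W)
    (hW : MemLp (fun x => ‖W x‖) (ENNReal.ofReal p') (weightedVolume n φ))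
    (hv : MemLp v (ENNReal.ofReal r') (weightedVolume n φ))
    (hvX : IsWeakGrad n v X)
    (hX : MemLp (fun x => ‖X x‖) (ENNReal.ofReal p) (weightedVolume n φ))
    (hdiv : ∀ ψ : M → ℝ, ContMDiff (𝓡 n) 𝓘(ℝ, ℝ) ∞ ψ → HasCompactSupport ψ →
      ∫ x, h x * ψ x ∂(weightedVolume n φ) =
        -∫ x, inner ℝ (W x) (grad n ψ x) ∂(weightedVolume n φ)) :
    ∫ x, h x * v x ∂(weightedVolume n φ) = -∫ x, inner ℝ (W x) (X x) ∂(weightedVolume n φ) := by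
  obtain ⟨η, hη, hc, hη2, hηg, hη1⟩ := exists_cutoffs n M
  have hWX := integrable_inner_of_memLp hφ hpp hWm hW hvX.chartMeasurable hX
  have hhv := integrable_mul_of_memLp hr hh hv
  have hχm : AEStronglyMeasurable (fun x => ({0} : Set ℝ).indicator (1 : ℝ → ℝ) (v x))
      (weightedVolume n φ) :=
    ((measurable_one.indicator (measurableSet_singleton 0)).comp_aemeasurable
      hv.1.aemeasurable).aestronglyMeasurable
  have hχ1 : ∀ s : ℝ, ‖({0} : Set ℝ).indicator (1 : ℝ → ℝ) s‖ ≤ 1 := fun s => by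
    by_cases hs : s = 0
    · simp [hs]
    · rw [indicator_of_notMem (by simpa using hs)]; simp
  have hχWX : Integrable (fun x => ({0} : Set ℝ).indicator (1 : ℝ → ℝ) (v x) * inner ℝ (W x) (X x))
      (weightedVolume n φ) := hWX.bdd_mul hχm (Eventually.of_forall fun x => hχ1 (v x))
  have hzero : ∫ x, ({0} : Set ℝ).indicator (1 : ℝ → ℝ) (v x) * inner ℝ (W x) (X x)
      ∂(weightedVolume n φ) = 0 := by
    have lim : Tendsto (fun k => ∫ x, η k x * (({0} : Set ℝ).indicator 1 (v x) *
        inner ℝ (W x) (X x)) ∂(weightedVolume n φ)) atTop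
        (𝓝 (∫ x, ({0} : Set ℝ).indicator (1 : ℝ → ℝ) (v x) * inner ℝ (W x) (X x)
          ∂(weightedVolume n φ))) := by
      refine tendsto_integral_of_dominated_convergence _
        (fun k => (hη k).continuous.aestronglyMeasurable.mul hχWX.1) (hχWX.norm.const_mul 2)
        (fun k => Eventually.of_forall fun x => ?_) (Eventually.of_forall fun x => ?_)
      · rw [norm_mul]; exact mul_le_mul_of_nonneg_right (hη2 k x) (norm_nonneg _)
      · simpa using (hη1 x).mul_const (({0} : Set ℝ).indicator 1 (v x) * inner ℝ (W x) (X x))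
    refine tendsto_nhds_unique lim (tendsto_const_nhds.congr fun k => ?_)
    exact (integral_indicator_zero_of_hasCompactSupport hφ hpp hr hh hWm hW hv.1 hvX hX hdiv (hη k)
      (hc k)).symm
  obtain ⟨C, T, hTs, hTle, hTa, hTC, hTt, hTd, hTd0⟩ := exists_truncations
  have hTv : ∀ m, AEStronglyMeasurable (fun x => T m (v x)) (weightedVolume n φ) := fun m =>
    (hTs m).continuous.comp_aestronglyMeasurable hv.1
  have hTv' : ∀ m, AEStronglyMeasurable (fun x => deriv (T m) (v x)) (weightedVolume n φ) := fun m =>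
    ((hTs m).continuous_deriv (by simp)).comp_aestronglyMeasurable hv.1
  have hid : ∀ m, ∫ x, h x * T m (v x) ∂(weightedVolume n φ) =
      -∫ x, deriv (T m) (v x) * inner ℝ (W x) (X x) ∂(weightedVolume n φ) := by
    intro m
    obtain ⟨B₀, hB₀⟩ := hTa m 0 le_rfl
    have hB₀' : ∀ s, |T m s| ≤ max B₀ C := fun s => by
      have := hB₀ s
      rw [Real.rpow_zero, mul_one] at this
      exact this.trans (le_max_left _ _)
    -- With this power, v in L^{r'} gives T_m(v) in L^p. Hence T_m(v) ‖W‖ is integrable and the term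
    -- with ∇η_k is O(1/k); for v in place of T_m(v) the product need not be integrable.
    obtain ⟨B, hB⟩ := hTa m (r' / p) (div_nonneg hr.symm.nonneg hpp.nonneg)
    have hTp : MemLp (fun x => T m (v x)) (ENNReal.ofReal p) (weightedVolume n φ) := by
      have h1 := memLp_abs_rpow (div_pos hr.symm.pos hpp.pos) hv
      rw [div_div_cancel₀ hr.symm.pos.ne'] at h1
      refine h1.of_le_mul (c := B) (hTv m) (Eventually.of_forall fun x => ?_)
      rw [Real.norm_eq_abs, Real.norm_eq_abs, abs_of_nonneg (Real.rpow_nonneg (abs_nonneg _) _)]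
      exact hB (v x)
    have hTW : Integrable (fun x => T m (v x) * ‖W x‖) (weightedVolume n φ) :=
      integrable_mul_of_memLp hpp hTp hW
    have hhT : Integrable (fun x => h x * T m (v x)) (weightedVolume n φ) :=
      hhv.mono (hh.1.mul (hTv m)) (Eventually.of_forall fun x => by
        rw [norm_mul, norm_mul]; exact mul_le_mul_of_nonneg_left (hTle m _) (norm_nonneg _))
    have hTWX : Integrable (fun x => deriv (T m) (v x) * inner ℝ (W x) (X x)) (weightedVolume n φ) :=
      hWX.bdd_mul (hTv' m) (Eventually.of_forall fun x => hTC m (v x))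
    have key : ∀ k, ∫ x, h x * (η k x * T m (v x)) ∂(weightedVolume n φ) = _ := fun k =>
      integral_test_comp hφ hpp hr hh hWm hW hv.1 hvX hX hdiv (hTs m) hB₀'
      (fun s => (hTC m s).trans (le_max_right _ _)) (hη k) (hc k)
    have lim1 : Tendsto (fun k => ∫ x, h x * (η k x * T m (v x)) ∂(weightedVolume n φ)) atTop
        (𝓝 (∫ x, h x * T m (v x) ∂(weightedVolume n φ))) := by
      refine tendsto_integral_of_dominated_convergence (fun x => 2 * ‖h x * T m (v x)‖)
        (fun k => hh.1.mul ((hη k).continuous.aestronglyMeasurable.mul (hTv m))) (hhT.norm.const_mul 2)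
        (fun k => Eventually.of_forall fun x => ?_) (Eventually.of_forall fun x => ?_)
      · rw [mul_left_comm, norm_mul]
        exact mul_le_mul_of_nonneg_right (hη2 k x) (norm_nonneg _)
      · simpa using ((hη1 x).mul_const (T m (v x))).const_mul (h x)
    have lim2 : Tendsto (fun k => ∫ x, (η k x * deriv (T m) (v x) * inner ℝ (W x) (X x) +
        T m (v x) * inner ℝ (W x) (grad n (η k) x)) ∂(weightedVolume n φ)) atTop
        (𝓝 (∫ x, deriv (T m) (v x) * inner ℝ (W x) (X x) ∂(weightedVolume n φ))) := by
      have hbd : ∀ k x, ‖T m (v x) * inner ℝ (W x) (grad n (η k) x)‖ ≤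
          ‖T m (v x) * ‖W x‖‖ * (5 / ((k : ℝ) + 1)) := fun k x => by
        rw [norm_mul, norm_mul, norm_norm, mul_assoc]
        refine mul_le_mul_of_nonneg_left ?_ (norm_nonneg _)
        exact (abs_real_inner_le_norm _ _).trans
          (mul_le_mul_of_nonneg_left (hηg k x) (norm_nonneg _))
      refine tendsto_integral_of_dominated_convergence
        (fun x => 2 * ‖deriv (T m) (v x) * inner ℝ (W x) (X x)‖ + ‖T m (v x) * ‖W x‖‖ * 5)
        (fun k => (((hη k).continuous.aestronglyMeasurable.mul (hTv' m)).mul hWX.1).add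
          ((hTv m).mul (aestronglyMeasurable_inner hφ hWm (chartMeasurable_grad (hη k)))))
        ((hTWX.norm.const_mul 2).add (hTW.norm.mul_const 5))
        (fun k => Eventually.of_forall fun x => ?_) (Eventually.of_forall fun x => ?_)
      · refine (norm_add_le _ _).trans (add_le_add ?_ ((hbd k x).trans ?_))
        · rw [mul_assoc, norm_mul]
          exact mul_le_mul_of_nonneg_right (hη2 k x) (norm_nonneg _)
        · refine mul_le_mul_of_nonneg_left ?_ (norm_nonneg _)
          exact div_le_self (by norm_num) (by simp)
      · have l1 : Tendsto (fun k => η k x * deriv (T m) (v x) * inner ℝ (W x) (X x)) atTop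
            (𝓝 (deriv (T m) (v x) * inner ℝ (W x) (X x))) := by
          simpa using ((hη1 x).mul_const (deriv (T m) (v x))).mul_const (inner ℝ (W x) (X x))
        have l3 : Tendsto (fun k : ℕ => 5 / ((k : ℝ) + 1)) atTop (𝓝 0) :=
          tendsto_const_nhds.div_atTop (tendsto_natCast_atTop_atTop.atTop_add tendsto_const_nhds)
        have l2 : Tendsto (fun k => T m (v x) * inner ℝ (W x) (grad n (η k) x)) atTop (𝓝 0) :=
          squeeze_zero_norm (fun k => hbd k x) (by simpa using l3.const_mul ‖T m (v x) * ‖W x‖‖)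
        simpa using l1.add l2
    exact tendsto_nhds_unique lim1 ((lim2.neg).congr fun k => (key k).symm)
  have lim1 : Tendsto (fun m => ∫ x, h x * T m (v x) ∂(weightedVolume n φ)) atTop
      (𝓝 (∫ x, h x * v x ∂(weightedVolume n φ))) := by
    refine tendsto_integral_of_dominated_convergence (fun x => ‖h x * v x‖)
      (fun m => hh.1.mul (hTv m)) hhv.norm
      (fun m => Eventually.of_forall fun x => ?_)
      (Eventually.of_forall fun x => (hTt (v x)).const_mul (h x))
    rw [norm_mul, norm_mul]
    exact mul_le_mul_of_nonneg_left (hTle m _) (norm_nonneg _)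
  -- T_m' tends to 1 away from 0 but is 0 at 0, so the limit omits the integral over {v = 0}, which
  -- is zero by `hzero`.
  have lim2 : Tendsto (fun m => ∫ x, deriv (T m) (v x) * inner ℝ (W x) (X x)
      ∂(weightedVolume n φ)) atTop
      (𝓝 (∫ x, (inner ℝ (W x) (X x) - ({0} : Set ℝ).indicator (1 : ℝ → ℝ) (v x) *
        inner ℝ (W x) (X x)) ∂(weightedVolume n φ))) := by
    refine tendsto_integral_of_dominated_convergence (fun x => C * ‖inner ℝ (W x) (X x)‖)
      (fun m => (hTv' m).mul hWX.1) (hWX.norm.const_mul C)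
      (fun m => Eventually.of_forall fun x => ?_) (Eventually.of_forall fun x => ?_)
    · rw [norm_mul]
      exact mul_le_mul_of_nonneg_right (hTC m _) (norm_nonneg _)
    · by_cases hx : v x = 0
      · simp [hx, hTd0]
      · rw [indicator_of_notMem (by simpa using hx)]
        simpa using (hTd (v x) hx).mul_const (inner ℝ (W x) (X x))
  have h1 := tendsto_nhds_unique lim1 ((lim2.neg).congr fun m => (hid m).symm)
  rw [h1, integral_sub hWX hχWX, hzero, sub_zero]

end Pairing

/-! ### Inequalities for the signed power -/

section SignedPower

variable {q : ℝ}

theorem abs_spow (hq : 0 < q) (a : ℝ) : |spow q a| = |a| ^ q := by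
  rw [spow, abs_mul, abs_of_nonneg (Real.rpow_nonneg (abs_nonneg _) _)]
  rcases eq_or_ne a 0 with rfl | ha
  · simp [Real.zero_rpow hq.ne']
  · rw [← Real.rpow_add_one (abs_ne_zero.2 ha), sub_add_cancel]

theorem spow_mul_self (hq : 0 < q) (a : ℝ) : spow q a * a = |a| ^ (q + 1) := by
  rcases eq_or_ne a 0 with rfl | ha
  · simp [Real.zero_rpow (by positivity : q + 1 ≠ 0)]
  · rw [spow, mul_assoc, ← abs_mul_abs_self, ← mul_assoc, ← Real.rpow_add_one (abs_ne_zero.2 ha),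
      ← Real.rpow_add_one (abs_ne_zero.2 ha), sub_add_cancel]

theorem spow_mul (c a : ℝ) : spow q (c * a) = spow q c * spow q a := by
  unfold spow
  rw [abs_mul, Real.mul_rpow (abs_nonneg _) (abs_nonneg _)]
  ring

theorem continuousAt_spow_one : ContinuousAt (spow q) 1 := by
  unfold spow
  refine ContinuousAt.mul ?_ continuousAt_id
  exact (continuous_abs.continuousAt).rpow_const (Or.inl (by norm_num))

theorem measurable_spow : Measurable (spow q) := by
  unfold spow
  fun_prop

/-- By homogeneity a = 1 unless a = 0. Near 1 continuity suffices; for |b - 1| ≥ d both 1 and |b|^q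
are bounded by multiples of |b - 1|^q. The argument is the same for q < 1 and q ≥ 1. -/
theorem abs_spow_sub_le (hq : 0 < q) {ε : ℝ} (hε : 0 < ε) :
    ∃ C, 0 ≤ C ∧ ∀ a b, |spow q b - spow q a| ≤ ε * |a| ^ q + C * |b - a| ^ q := by
  have hone : spow q 1 = 1 := by simp [spow]
  obtain ⟨d, hd, hdε⟩ := Metric.continuousAt_iff.1 (continuousAt_spow_one (q := q)) ε hε
  set C := d⁻¹ ^ q + (1 + d⁻¹) ^ q with hC
  have hd' : 0 < d⁻¹ := inv_pos.2 hd
  have hC1 : 1 ≤ C := by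
    have : 1 ≤ (1 + d⁻¹) ^ q := Real.one_le_rpow (by linarith) hq.le
    have := Real.rpow_nonneg hd'.le q
    linarith
  have h1 : ∀ b, |spow q b - 1| ≤ ε + C * |b - 1| ^ q := by
    intro b
    rcases lt_or_ge |b - 1| d with hb | hb
    · have := hdε (x := b) (by rwa [Real.dist_eq])
      rw [Real.dist_eq, hone] at this
      have : 0 ≤ C * |b - 1| ^ q := by positivity
      linarith
    · have hx : 0 < |b - 1| := hd.trans_le hb
      have hdx : 1 ≤ d⁻¹ * |b - 1| := by
        rw [inv_mul_eq_div, one_le_div hd]; exact hb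
      have e1 : 1 ≤ d⁻¹ ^ q * |b - 1| ^ q := by
        rw [← Real.mul_rpow hd'.le hx.le]; exact Real.one_le_rpow hdx hq.le
      have e2 : |b| ^ q ≤ (1 + d⁻¹) ^ q * |b - 1| ^ q := by
        rw [← Real.mul_rpow (by positivity) hx.le]
        refine Real.rpow_le_rpow (abs_nonneg _) ?_ hq.le
        have : |b| ≤ |b - 1| + 1 := by
          have := abs_add_le (b - 1) 1
          simpa using this
        nlinarith
      have e3 : |spow q b - 1| ≤ |b| ^ q + 1 := by
        refine (abs_sub _ _).trans ?_
        rw [abs_spow hq, abs_one]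
      rw [hC, add_mul]
      linarith
  refine ⟨C, by linarith, fun a b => ?_⟩
  rcases eq_or_ne a 0 with rfl | ha
  · have h0 : spow q 0 = 0 := by simp [spow]
    rw [h0, sub_zero, sub_zero, abs_spow hq, abs_zero, Real.zero_rpow hq.ne', mul_zero, zero_add]
    exact le_mul_of_one_le_left (by positivity) hC1
  · have e1 : spow q b = spow q a * spow q (b / a) := by rw [← spow_mul, mul_div_cancel₀ _ ha]
    have e2 : b - a = a * (b / a - 1) := by field_simp
    have e3 : spow q b - spow q a = spow q a * (spow q (b / a) - 1) := by rw [e1]; ring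
    rw [e3, e2, abs_mul, abs_mul, abs_spow hq, Real.mul_rpow (abs_nonneg _) (abs_nonneg _)]
    have := mul_le_mul_of_nonneg_left (h1 (b / a)) (Real.rpow_nonneg (abs_nonneg a) q)
    linarith

theorem holderConjugate_add_one (hq : 0 < q) : (q + 1).HolderConjugate ((q + 1) / q) := by
  rw [Real.holderConjugate_iff]
  refine ⟨by linarith, ?_⟩
  have : q + 1 ≠ 0 := by positivity
  field_simp
  ring

/-- The tangent inequality for the convex function |·|^(q+1), in the form of Young's inequality. -/
theorem spow_mul_sub_le (hq : 0 < q) (a b : ℝ) :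
    (q + 1) * (spow q a * (b - a)) ≤ |b| ^ (q + 1) - |a| ^ (q + 1) := by
  have h1 := Real.young_inequality_of_nonneg (abs_nonneg b)
    (Real.rpow_nonneg (abs_nonneg a) q) (holderConjugate_add_one hq)
  rw [← Real.rpow_mul (abs_nonneg a), mul_div_cancel₀ _ hq.ne'] at h1
  have h2 : spow q a * b ≤ |b| * |a| ^ q := by
    rw [← abs_spow hq a, mul_comm |b|, ← abs_mul]
    exact le_abs_self _
  have h3 := spow_mul_self hq a
  have h4 : (q + 1) * (|b| ^ (q + 1) / (q + 1) + |a| ^ (q + 1) / ((q + 1) / q)) =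
      |b| ^ (q + 1) + q * |a| ^ (q + 1) := by
    have : q + 1 ≠ 0 := by positivity
    field_simp
  have h5 := mul_le_mul_of_nonneg_left (h2.trans h1) (show 0 ≤ q + 1 by linarith)
  rw [h4] at h5
  have h6 : (q + 1) * (spow q a * (b - a)) = (q + 1) * (spow q a * b) - (q + 1) * |a| ^ (q + 1) := by
    rw [← h3]; ring
  rw [h6]
  linarith

end SignedPower

/-! ### Curves in L^r and the derivative of the energy -/

section LpCalculus

variable {α : Type*} [MeasurableSpace α] {μ : Measure α} {q : ℝ}

theorem memLp_spow (hq : 0 < q) {f : α → ℝ} (hf : MemLp f (ENNReal.ofReal (q + 1)) μ) :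
    MemLp (fun x => spow q (f x)) (ENNReal.ofReal ((q + 1) / q)) μ := by
  have h := memLp_abs_rpow hq hf
  refine h.of_le (measurable_spow.comp_aemeasurable hf.1.aemeasurable).aestronglyMeasurable
    (Eventually.of_forall fun x => ?_)
  rw [Real.norm_eq_abs, abs_spow hq]
  exact le_abs_self _

theorem eLpNorm_abs_rpow (hq : 0 < q) (f : α → ℝ) :
    eLpNorm (fun x => |f x| ^ q) (ENNReal.ofReal ((q + 1) / q)) μ =
      eLpNorm f (ENNReal.ofReal (q + 1)) μ ^ q := by
  have h := eLpNorm_norm_rpow (μ := μ) (p := ENNReal.ofReal ((q + 1) / q)) f hq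
  rw [← ENNReal.ofReal_mul (by positivity), div_mul_cancel₀ _ hq.ne'] at h
  exact h

/-- Continuity of f ↦ f^q from L^(q+1) to L^((q+1)/q). In the bound of `abs_spow_sub_le` the small
parameter is first chosen against the norm of f₀; the remaining term is a power of the norm of f_i -
f₀. -/
theorem tendsto_spow {ι : Type*} {l : Filter ι} (hq : 0 < q) {f : ι → α → ℝ} {f₀ : α → ℝ}
    (hf : ∀ᶠ i in l, MemLp (f i) (ENNReal.ofReal (q + 1)) μ)
    (hf₀ : MemLp f₀ (ENNReal.ofReal (q + 1)) μ)
    (h : Tendsto (fun i => eLpNorm (fun x => f i x - f₀ x) (ENNReal.ofReal (q + 1)) μ) l (𝓝 0)) :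
    Tendsto (fun i => eLpNorm (fun x => spow q (f i x) - spow q (f₀ x))
      (ENNReal.ofReal ((q + 1) / q)) μ) l (𝓝 0) := by
  refine ENNReal.tendsto_nhds_zero.2 fun ε hε => ?_
  set A := eLpNorm f₀ (ENNReal.ofReal (q + 1)) μ ^ q
  have hA : A ≠ ⊤ := ENNReal.rpow_ne_top_of_nonneg hq.le hf₀.2.ne
  obtain ⟨d, hd, hdA⟩ : ∃ d : ℝ, 0 < d ∧ ENNReal.ofReal d * A ≤ ε / 2 := by
    have h1 : Tendsto (fun d : ℝ => ENNReal.ofReal d * A) (𝓝[>] 0) (𝓝 (ENNReal.ofReal 0 * A)) :=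
      ENNReal.Tendsto.mul_const ((ENNReal.continuous_ofReal.tendsto 0).mono_left nhdsWithin_le_nhds)
        (Or.inr hA)
    rw [ENNReal.ofReal_zero, zero_mul] at h1
    have h2 := (ENNReal.tendsto_nhds_zero.1 h1 (ε / 2) (ENNReal.half_pos hε.ne')).and
      (self_mem_nhdsWithin (s := Ioi (0 : ℝ)))
    obtain ⟨d, hd1, hd2⟩ := h2.exists
    exact ⟨d, hd2, hd1⟩
  obtain ⟨C, hC, hCb⟩ := abs_spow_sub_le hq hd
  have h3 : Tendsto (fun i => ENNReal.ofReal C *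
      eLpNorm (fun x => f i x - f₀ x) (ENNReal.ofReal (q + 1)) μ ^ q) l (𝓝 0) := by
    have h4 := ENNReal.Tendsto.const_mul (a := ENNReal.ofReal C)
      ((ENNReal.continuous_rpow_const (y := q)).tendsto 0 |>.comp h) (Or.inr ENNReal.ofReal_ne_top)
    rw [ENNReal.zero_rpow_of_pos hq, mul_zero] at h4
    exact h4
  have hone : 1 ≤ ENNReal.ofReal ((q + 1) / q) :=
    ENNReal.one_le_ofReal.2 (holderConjugate_add_one hq).symm.lt.le
  filter_upwards [hf, ENNReal.tendsto_nhds_zero.1 h3 (ε / 2) (ENNReal.half_pos hε.ne')] with i hi hi2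
  have m1 : MemLp (fun x => |f₀ x| ^ q) (ENNReal.ofReal ((q + 1) / q)) μ := memLp_abs_rpow hq hf₀
  have m2 : MemLp (fun x => |f i x - f₀ x| ^ q) (ENNReal.ofReal ((q + 1) / q)) μ :=
    memLp_abs_rpow hq (hi.sub hf₀)
  calc eLpNorm (fun x => spow q (f i x) - spow q (f₀ x)) (ENNReal.ofReal ((q + 1) / q)) μ
      ≤ eLpNorm ((fun x => d * |f₀ x| ^ q) + fun x => C * |f i x - f₀ x| ^ q)
        (ENNReal.ofReal ((q + 1) / q)) μ :=
        eLpNorm_mono_real fun x => hCb (f₀ x) (f i x)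
    _ ≤ eLpNorm (fun x => d * |f₀ x| ^ q) (ENNReal.ofReal ((q + 1) / q)) μ +
        eLpNorm (fun x => C * |f i x - f₀ x| ^ q) (ENNReal.ofReal ((q + 1) / q)) μ :=
        eLpNorm_add_le (m1.1.const_mul d) (m2.1.const_mul C) hone
    _ = ENNReal.ofReal d * A + ENNReal.ofReal C *
        eLpNorm (fun x => f i x - f₀ x) (ENNReal.ofReal (q + 1)) μ ^ q := by
        have e1 : eLpNorm (fun x => d * |f₀ x| ^ q) (ENNReal.ofReal ((q + 1) / q)) μ =
            ENNReal.ofReal d * A := by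
          have := eLpNorm_const_smul d (fun x => |f₀ x| ^ q) (ENNReal.ofReal ((q + 1) / q)) μ
          rw [eLpNorm_abs_rpow hq, Real.enorm_eq_ofReal hd.le] at this
          exact this
        have e2 : eLpNorm (fun x => C * |f i x - f₀ x| ^ q) (ENNReal.ofReal ((q + 1) / q)) μ =
            ENNReal.ofReal C * eLpNorm (fun x => f i x - f₀ x) (ENNReal.ofReal (q + 1)) μ ^ q := by
          have := eLpNorm_const_smul C (fun x => |f i x - f₀ x| ^ q)
            (ENNReal.ofReal ((q + 1) / q)) μ
          rw [eLpNorm_abs_rpow hq, Real.enorm_eq_ofReal hC] at this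
          exact this
        rw [e1, e2]
    _ ≤ ε / 2 + ε / 2 := add_le_add hdA hi2
    _ = ε := ENNReal.add_halves ε

variable {J : Set ℝ} {u ut : ℝ → α → ℝ} {t : ℝ}

theorem HasLpDerivAt.tendsto {r : ℝ} (hr : 1 ≤ r) {w : α → ℝ}
    (hu : ∀ s ∈ J, MemLp (u s) (ENNReal.ofReal r) μ) (ht : t ∈ J)
    (hw : MemLp w (ENNReal.ofReal r) μ) (h : HasLpDerivAt μ r J u w t) :
    Tendsto (fun s => eLpNorm (fun x => u s x - u t x) (ENNReal.ofReal r) μ) (𝓝[J \ {t}] t) (𝓝 0) := by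
  have hone : 1 ≤ ENNReal.ofReal r := ENNReal.one_le_ofReal.2 hr
  have h1 : Tendsto (fun s => ENNReal.ofReal |s - t| *
      (eLpNorm (fun x => (u s x - u t x) / (s - t) - w x) (ENNReal.ofReal r) μ +
        eLpNorm w (ENNReal.ofReal r) μ)) (𝓝[J \ {t}] t) (𝓝 0) := by
    have e1 : Tendsto (fun s => ENNReal.ofReal |s - t|) (𝓝[J \ {t}] t) (𝓝 0) := by
      have : Continuous fun s => ENNReal.ofReal |s - t| :=
        ENNReal.continuous_ofReal.comp (by fun_prop)
      have h := this.tendsto t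
      simp only [sub_self, abs_zero, ENNReal.ofReal_zero] at h
      exact h.mono_left nhdsWithin_le_nhds
    have h2 := ENNReal.Tendsto.mul e1 (Or.inr (by simpa using hw.2.ne)) (h.add_const _)
      (Or.inr ENNReal.zero_ne_top)
    simpa using h2
  refine tendsto_of_tendsto_of_tendsto_of_le_of_le' tendsto_const_nhds h1
    (Eventually.of_forall fun _ => zero_le) ?_
  filter_upwards [self_mem_nhdsWithin] with s hs
  have hst : s - t ≠ 0 := sub_ne_zero.2 hs.2
  have hm : MemLp (fun x => (u s x - u t x) / (s - t) - w x) (ENNReal.ofReal r) μ := by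
    refine MemLp.sub ?_ hw
    have := ((hu s hs.1).sub (hu t ht)).const_mul (s - t)⁻¹
    simpa [div_eq_inv_mul] using this
  have e1 : (fun x => u s x - u t x) = (s - t) •
      ((fun x => (u s x - u t x) / (s - t) - w x) + w) := by
    ext x
    simp only [Pi.smul_apply, Pi.add_apply, smul_eq_mul, sub_add_cancel]
    field_simp
  rw [e1, eLpNorm_const_smul, Real.enorm_eq_ofReal_abs]
  gcongr
  exact eLpNorm_add_le hm.1 hw.1 hone

theorem HasLpDerivAt.tendsto_integral_mul {r r' : ℝ} (hr : r.HolderConjugate r') {w : α → ℝ}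
    (hu : ∀ s ∈ J, MemLp (u s) (ENNReal.ofReal r) μ) (ht : t ∈ J)
    (hw : MemLp w (ENNReal.ofReal r) μ) (h : HasLpDerivAt μ r J u w t) {v : ℝ → α → ℝ} {v₀ : α → ℝ}
    (hv : ∀ s ∈ J, MemLp (v s) (ENNReal.ofReal r') μ) (hv₀ : MemLp v₀ (ENNReal.ofReal r') μ)
    (hvt : Tendsto (fun s => eLpNorm (fun x => v s x - v₀ x) (ENNReal.ofReal r') μ)
      (𝓝[J \ {t}] t) (𝓝 0)) :
    Tendsto (fun s => ∫ x, (u s x - u t x) / (s - t) * v s x ∂μ) (𝓝[J \ {t}] t)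
      (𝓝 (∫ x, w x * v₀ x ∂μ)) := by
  refine ParabolicFrequency.tendsto_integral_mul hr ?_ ?_ hw hv₀ h hvt
  · filter_upwards [self_mem_nhdsWithin] with s hs
    have := ((hu s hs.1).sub (hu t ht)).const_mul (s - t)⁻¹
    simpa [div_eq_inv_mul] using this
  · filter_upwards [self_mem_nhdsWithin] with s hs using hv s hs.1

theorem hasDerivWithinAt_integral_mul {r r' : ℝ} (hr : r.HolderConjugate r') {w v : α → ℝ}
    (hu : ∀ s ∈ J, MemLp (u s) (ENNReal.ofReal r) μ) (ht : t ∈ J)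
    (hw : MemLp w (ENNReal.ofReal r) μ) (h : HasLpDerivAt μ r J u w t)
    (hv : MemLp v (ENNReal.ofReal r') μ) :
    HasDerivWithinAt (fun s => ∫ x, u s x * v x ∂μ) (∫ x, w x * v x ∂μ) J t := by
  rw [hasDerivWithinAt_iff_tendsto_slope]
  refine (h.tendsto_integral_mul hr hu ht hw (fun _ _ => hv) hv (by simpa using tendsto_const_nhds)).congr' ?_
  filter_upwards [self_mem_nhdsWithin] with s hs
  rw [slope_def_field, ← integral_sub (integrable_mul_of_memLp hr (hu s hs.1) hv)
    (integrable_mul_of_memLp hr (hu t ht) hv), ← integral_div]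
  congr 1
  ext x
  ring

theorem integrable_abs_rpow (hq : 0 < q) {f : α → ℝ} (hf : MemLp f (ENNReal.ofReal (q + 1)) μ) :
    Integrable (fun x => |f x| ^ (q + 1)) μ := by
  have := integrable_mul_of_memLp (holderConjugate_add_one hq) hf (memLp_spow hq hf)
  refine this.congr (Eventually.of_forall fun x => ?_)
  simp only
  rw [mul_comm, spow_mul_self hq]

/-- Convexity, used at t and at s, puts the increment of the energy between (q+1) ∫ v(t) (u(s) -
u(t)) and (q+1) ∫ v(s) (u(s) - u(t)), where v = u^q. The difference quotients of both have the same
limit, because v(s) → v(t) in the dual space. -/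
theorem hasDerivWithinAt_integral_abs_rpow (hq : 0 < q) {w : α → ℝ}
    (hu : ∀ s ∈ J, MemLp (u s) (ENNReal.ofReal (q + 1)) μ) (ht : t ∈ J)
    (hw : MemLp w (ENNReal.ofReal (q + 1)) μ) (h : HasLpDerivAt μ (q + 1) J u w t) :
    HasDerivWithinAt (fun s => ∫ x, |u s x| ^ (q + 1) ∂μ)
      ((q + 1) * ∫ x, w x * spow q (u t x) ∂μ) J t := by
  have hr := holderConjugate_add_one hq
  have hv : ∀ s ∈ J, MemLp (fun x => spow q (u s x)) (ENNReal.ofReal ((q + 1) / q)) μ :=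
    fun s hs => memLp_spow hq (hu s hs)
  have hvt : Tendsto (fun s => eLpNorm (fun x => spow q (u s x) - spow q (u t x))
      (ENNReal.ofReal ((q + 1) / q)) μ) (𝓝[J \ {t}] t) (𝓝 0) :=
    tendsto_spow hq (by filter_upwards [self_mem_nhdsWithin] with s hs using hu s hs.1) (hu t ht)
      (h.tendsto hr.lt.le hu ht hw)
  have l1 := (h.tendsto_integral_mul hr hu ht hw (v := fun _ x => spow q (u t x))
    (fun _ _ => hv t ht) (hv t ht)
    (by simpa using tendsto_const_nhds)).const_mul (q + 1)
  have l2 := (h.tendsto_integral_mul hr hu ht hw hv (hv t ht) hvt).const_mul (q + 1)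
  rw [hasDerivWithinAt_iff_tendsto_slope]
  -- Division by s - t exchanges the two bounds when s < t; minimum and maximum treat both sides at
  -- once.
  have l3 := l1.min l2
  have l4 := l1.max l2
  rw [min_self] at l3
  rw [max_self] at l4
  refine tendsto_of_tendsto_of_tendsto_of_le_of_le' l3 l4 ?_ ?_ <;>
  · filter_upwards [self_mem_nhdsWithin] with s hs
    have hIs := integrable_abs_rpow hq (hu s hs.1)
    have hIt := integrable_abs_rpow hq (hu t ht)
    have hd := (hu s hs.1).sub (hu t ht)
    have e : ∀ v : α → ℝ, (q + 1) * ∫ x, (u s x - u t x) / (s - t) * v x ∂μ =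
        (∫ x, (q + 1) * (v x * (u s x - u t x)) ∂μ) / (s - t) := fun v => by
      rw [integral_const_mul, mul_div_assoc, ← integral_div]
      congr 2
      ext x
      ring
    have lo : ∫ x, (q + 1) * (spow q (u t x) * (u s x - u t x)) ∂μ ≤
        (∫ x, |u s x| ^ (q + 1) ∂μ) - ∫ x, |u t x| ^ (q + 1) ∂μ := by
      rw [← integral_sub hIs hIt]
      exact integral_mono ((integrable_mul_of_memLp hr.symm (hv t ht) hd).const_mul _)
        (hIs.sub hIt) fun x => spow_mul_sub_le hq _ _
    have up : (∫ x, |u s x| ^ (q + 1) ∂μ) - ∫ x, |u t x| ^ (q + 1) ∂μ ≤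
        ∫ x, (q + 1) * (spow q (u s x) * (u s x - u t x)) ∂μ := by
      rw [← integral_sub hIs hIt]
      refine integral_mono (hIs.sub hIt)
        ((integrable_mul_of_memLp hr.symm (hv s hs.1) hd).const_mul _) fun x => ?_
      have := spow_mul_sub_le hq (u s x) (u t x)
      linarith
    rw [e, e, slope_def_field]
    have hst : s - t ≠ 0 := sub_ne_zero.2 hs.2
    rcases lt_or_gt_of_ne hst with hlt | hgt
    · first
      | exact (min_le_right _ _).trans (div_le_div_of_nonpos_of_le hlt.le up)
      | exact (div_le_div_of_nonpos_of_le hlt.le lo).trans (le_max_left _ _)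
    · first
      | exact (min_le_left _ _).trans (div_le_div_of_nonneg_right lo hgt.le)
      | exact (div_le_div_of_nonneg_right up hgt.le).trans (le_max_right _ _)

theorem integral_mul_spow_le (hq : 0 < q) {f g : α → ℝ} (hf : MemLp f (ENNReal.ofReal (q + 1)) μ)
    (hg : MemLp g (ENNReal.ofReal (q + 1)) μ) :
    ∫ x, f x * spow q (g x) ∂μ ≤
      (∫ x, |f x| ^ (q + 1) ∂μ) ^ (1 / (q + 1)) * (∫ x, |g x| ^ (q + 1) ∂μ) ^ (q / (q + 1)) := by
  have hr := holderConjugate_add_one hq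
  have h1 := integral_mul_norm_le_Lp_mul_Lq (μ := μ) hr hf (memLp_spow hq hg)
  have h2 : ∀ x, |spow q (g x)| ^ ((q + 1) / q) = |g x| ^ (q + 1) := fun x => by
    rw [abs_spow hq, ← Real.rpow_mul (abs_nonneg _), mul_div_cancel₀ _ hq.ne']
  simp only [Real.norm_eq_abs, h2, one_div_div] at h1
  refine le_trans ?_ h1
  refine integral_mono (integrable_mul_of_memLp hr hf (memLp_spow hq hg))
    ((integrable_mul_of_memLp hr hf (memLp_spow hq hg)).abs.congr
      (Eventually.of_forall fun x => abs_mul _ _)) fun x => ?_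
  simp only
  rw [← abs_mul]
  exact le_abs_self _

theorem LpContinuousAt.mono_diff {r : ℝ} (h : LpContinuousAt μ r J u t) :
    Tendsto (fun s => eLpNorm (fun x => u s x - u t x) (ENNReal.ofReal r) μ) (𝓝[J \ {t}] t) (𝓝 0) :=
  Tendsto.mono_left h (nhdsWithin_mono t sdiff_subset)

end LpCalculus

/-! ### Monotonicity and convexity from the energy relations -/

section Monotonicity

/-- The relations between the energies of a solution: `I` is the energy, `g ^ p` is minus its
dissipation, `P s t` is the pairing of the time derivative at `s` with `u ^ q` at `t`, and
`G s t` is the pairing of `u` at `s` with `u ^ q` at `t`. -/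
structure EnergyRelations (p q : ℝ) (J : Set ℝ) (I g : ℝ → ℝ) (P G : ℝ → ℝ → ℝ) : Prop where
  energy_nonneg : ∀ t, 0 ≤ I t
  diss_nonneg : ∀ t, 0 ≤ g t
  hasDerivWithinAt_energy : ∀ t ∈ J, HasDerivWithinAt I ((q + 1) * P t t) J t
  hasDerivWithinAt_pairing : ∀ t ∈ J, ∀ s ∈ J, HasDerivWithinAt (fun s => G s t) (P s t) J s
  pairing_le : ∀ t ∈ J, ∀ s ∈ J, G s t ≤ I s ^ (1 / (q + 1)) * I t ^ (q / (q + 1))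
  pairing_self : ∀ t ∈ J, G t t = I t
  deriv_pairing_ge : ∀ s ∈ J, ∀ t ∈ J, -(g s ^ (p - 1) * g t) ≤ P s t
  deriv_pairing_self : ∀ t ∈ J, P t t = -g t ^ p
  tendsto_deriv_pairing : ∀ t ∈ J, Tendsto (fun s => P t s) (𝓝[J] t) (𝓝 (P t t))

namespace EnergyRelations

variable {p q δ : ℝ} {J : Set ℝ} {I g : ℝ → ℝ} {P G : ℝ → ℝ → ℝ} {s t : ℝ}

theorem continuousOn_energy (h : EnergyRelations p q J I g P G) : ContinuousOn I J := fun t ht =>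
  (h.hasDerivWithinAt_energy t ht).continuousWithinAt

theorem antitoneOn_energy (h : EnergyRelations p q J I g P G) (hq : 0 < q) (hJ : J.OrdConnected) :
    AntitoneOn I J := by
  refine antitoneOn_of_hasDerivWithinAt_nonpos hJ.convex h.continuousOn_energy
    (f' := fun t => (q + 1) * P t t)
    (fun t ht => (h.hasDerivWithinAt_energy t (interior_subset ht)).mono interior_subset)
    fun t ht => ?_
  rw [h.deriv_pairing_self t (interior_subset ht)]
  have := Real.rpow_nonneg (h.diss_nonneg t) p
  nlinarith

theorem eventually_pos (h : EnergyRelations p q J I g P G) (ht : t ∈ J) (hI : 0 < I t) :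
    ∀ᶠ s in 𝓝[J] t, 0 < I s :=
  (h.continuousOn_energy t ht).eventually (lt_mem_nhds hI)

theorem ordConnected_pos (h : EnergyRelations p q J I g P G) (hq : 0 < q) (hJ : J.OrdConnected) :
    {t ∈ J | 0 < I t}.OrdConnected := by
  refine ⟨fun a ha b hb c hc => ?_⟩
  have hcJ := hJ.out ha.1 hb.1 hc
  exact ⟨hcJ, hb.2.trans_le (h.antitoneOn_energy hq hJ hcJ hb.1 hc.2)⟩

/-- As for a norm under weak convergence: g(t)^(p-1) g(s) ≥ -P(t,s), and the right side tends to
g(t)^p as s → t. The factor g(t)^(p-1) can be cancelled unless g(t) = 0, in which case nothing has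
to be shown. -/
theorem lowerSemicontinuousOn_diss (h : EnergyRelations p q J I g P G) :
    LowerSemicontinuousOn g J := by
  intro t ht c hc
  rcases eq_or_lt_of_le (h.diss_nonneg t) with h0 | h0
  · exact Eventually.of_forall fun s => (h0 ▸ hc).trans_le (h.diss_nonneg s)
  have hpow : 0 < g t ^ (p - 1) := Real.rpow_pos_of_pos h0 _
  have h1 : g t ^ p = g t ^ (p - 1) * g t := by rw [← Real.rpow_add_one h0.ne', sub_add_cancel]
  have h2 : P t t < -(g t ^ (p - 1) * c) := by
    rw [h.deriv_pairing_self t ht, h1]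
    nlinarith
  filter_upwards [(h.tendsto_deriv_pairing t ht).eventually (gt_mem_nhds h2), self_mem_nhdsWithin]
    with s hs hsJ
  have h3 := h.deriv_pairing_ge t ht s hsJ
  by_contra! hle
  nlinarith

/-- No derivative of g is available, only those of I and of the pairing with a frozen time b. The
comparison therefore needs a time b after which the quotient H exceeds H(b), and lower
semicontinuity provides one, the last minimum point. -/
theorem antitoneOn_normalized_diss (h : EnergyRelations p q J I g P G) (hq : 0 < q)
    (hJ : J.OrdConnected) :
    AntitoneOn (fun t => g t * I t ^ (-(q / (q + 1)))) {t ∈ J | 0 < I t} := by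
  set H : ℝ → ℝ := fun t => g t * I t ^ (-(q / (q + 1))) with hH
  intro t ht s hs hts
  by_contra! hlt
  have hlt' : t < s := lt_of_le_of_ne hts fun h => by simp [h] at hlt
  have hsub : Icc t s ⊆ {t ∈ J | 0 < I t} := (h.ordConnected_pos hq hJ).out ht hs
  have hsubJ : Icc t s ⊆ J := fun a ha => (hsub ha).1
  have hlsc : LowerSemicontinuousOn H (Icc t s) := by
    intro a ha c hc
    have hI : 0 < I a ^ (-(q / (q + 1))) := Real.rpow_pos_of_pos (hsub ha).2 _
    have hIc : ContinuousWithinAt (fun t => I t ^ (-(q / (q + 1)))) (Icc t s) a :=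
      ((h.continuousOn_energy a (hsubJ ha)).mono hsubJ).rpow_const (Or.inl (hsub ha).2.ne')
    rcases lt_or_ge c 0 with hc0 | hc0
    · filter_upwards [self_mem_nhdsWithin] with b hb
      exact hc0.trans_le (mul_nonneg (h.diss_nonneg b) (Real.rpow_nonneg (hsub hb).2.le _))
    · obtain ⟨k, hk1, hk2⟩ : ∃ k, c / I a ^ (-(q / (q + 1))) < k ∧ k < g a :=
        exists_between ((div_lt_iff₀ hI).2 hc)
      have hk0 : 0 < k := (div_nonneg hc0 hI.le).trans_lt hk1
      have e1 := (h.lowerSemicontinuousOn_diss a (hsubJ ha) k hk2).filter_mono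
        (nhdsWithin_mono a hsubJ)
      have hck : c / k < I a ^ (-(q / (q + 1))) := by
        rw [div_lt_iff₀ hI] at hk1
        rw [div_lt_iff₀ hk0]
        linarith
      filter_upwards [e1, hIc.eventually (lt_mem_nhds hck)] with b hb1 hb2
      rw [div_lt_iff₀ hk0] at hb2
      have : 0 < I b ^ (-(q / (q + 1))) := by
        have := div_nonneg hc0 hk0.le
        by_contra! hneg
        nlinarith
      simp only [hH]
      nlinarith
  obtain ⟨a₀, ha₀, hmin⟩ := hlsc.exists_isMinOn ⟨t, left_mem_Icc.2 hts⟩ isCompact_Icc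
  have hmin' : ∀ b ∈ Icc t s, H a₀ ≤ H b := fun b hb => hmin hb
  have hcl := hlsc.isCompact_inter_preimage_Iic isCompact_Icc (H a₀)
  -- The set where H equals its minimum is compact, so it has a greatest element. It is not s,
  -- because H(t) < H(s).
  obtain ⟨b, ⟨hbI, hbH⟩, hbmax⟩ := hcl.exists_isGreatest ⟨a₀, ha₀, show H a₀ ≤ H a₀ from le_rfl⟩
  have hbH : H b ≤ H a₀ := hbH
  have hbs : b < s := lt_of_le_of_ne hbI.2 fun hbs => by
    have := hmin' t (left_mem_Icc.2 hts)
    rw [hbs] at hbH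
    exact absurd (hbH.trans this) (not_le.2 hlt)
  have hgt : ∀ τ ∈ Ioc b s, H b < H τ := fun τ hτ => by
    by_contra! hle
    exact absurd (hbmax ⟨⟨hbI.1.trans hτ.1.le, hτ.2⟩, hle.trans hbH⟩) (not_le.2 hτ.1)
  have hbpos := hsub hbI
  have hr : 0 < q + 1 := by positivity
  set R := I b ^ (-(q / (q + 1))) with hR
  have hRpos : 0 < R := Real.rpow_pos_of_pos hbpos.2 _
  -- The defect in Hölder's inequality for G(τ, b), divided by I(b)^(q/(q+1)): it is nonnegative and
  -- zero at τ = b. Its derivative is at most -g(τ)^(p-1) (H(τ) - H(b)).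
  set F : ℝ → ℝ := fun τ => I τ ^ (1 / (q + 1)) - R * G τ b with hF
  have hbsub : Icc b s ⊆ Icc t s := Icc_subset_Icc hbI.1 le_rfl
  have hFd : ∀ τ ∈ Icc b s, HasDerivWithinAt F
      ((q + 1) * P τ τ * (1 / (q + 1)) * I τ ^ (1 / (q + 1) - 1) - R * P τ b) J τ := fun τ hτ =>
    ((h.hasDerivWithinAt_energy τ (hsubJ (hbsub hτ))).rpow_const
      (Or.inl (hsub (hbsub hτ)).2.ne')).sub
      ((h.hasDerivWithinAt_pairing b hbpos.1 τ (hsubJ (hbsub hτ))).const_mul R)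
  have hanti : StrictAntiOn F (Icc b s) := by
    refine strictAntiOn_of_deriv_neg (convex_Icc b s)
      (fun τ hτ => ((hFd τ hτ).continuousWithinAt).mono (hbsub.trans hsubJ)) fun τ hτ => ?_
    rw [interior_Icc] at hτ
    have hτ' := hbsub (Ioo_subset_Icc_self hτ)
    have hJτ : J ∈ 𝓝 τ := mem_of_superset (Icc_mem_nhds hτ.1 hτ.2) (hbsub.trans hsubJ)
    rw [((hFd τ (Ioo_subset_Icc_self hτ)).hasDerivAt hJτ).deriv]
    have h1 := hgt τ ⟨hτ.1, hτ.2.le⟩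
    have h2 := h.deriv_pairing_ge τ (hsubJ hτ') b hbpos.1
    have hHb : 0 ≤ H b := mul_nonneg (h.diss_nonneg b) hRpos.le
    have hIτ : 0 < I τ ^ (-(q / (q + 1))) := Real.rpow_pos_of_pos (hsub hτ').2 _
    have hg0 : 0 < g τ := by
      refine lt_of_le_of_ne (h.diss_nonneg τ) fun h0 => ?_
      simp only [hH, ← h0, zero_mul] at h1 hHb
      linarith
    have hpow : 0 < g τ ^ (p - 1) := Real.rpow_pos_of_pos hg0 _
    have h3 : g τ ^ p = g τ ^ (p - 1) * g τ := by rw [← Real.rpow_add_one hg0.ne', sub_add_cancel]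
    have h4 : (1 / (q + 1) - 1 : ℝ) = -(q / (q + 1)) := by field_simp; ring
    have h5 : (q + 1) * P τ τ * (1 / (q + 1)) = P τ τ := by field_simp
    rw [h5, h4, h.deriv_pairing_self τ (hsubJ hτ'), h3]
    have h6 := mul_lt_mul_of_pos_left h1 hpow
    have h7 := mul_le_mul_of_nonneg_left h2 hRpos.le
    simp only [hH] at h6
    rw [← hR] at h6
    nlinarith
  have hlast := hanti (left_mem_Icc.2 hbs.le) (right_mem_Icc.2 hbs.le) hbs
  have hFb : F b = 0 := by
    simp only [hF, hR]
    rw [h.pairing_self b hbpos.1, ← Real.rpow_add_one hbpos.2.ne']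
    have : -(q / (q + 1)) + 1 = 1 / (q + 1) := by field_simp; ring
    rw [this, sub_self]
  have hFs : 0 ≤ F s := by
    have h1 := h.pairing_le b hbpos.1 s hs.1
    have h2 := mul_le_mul_of_nonneg_left h1 hRpos.le
    have h3 : R * I b ^ (q / (q + 1)) = 1 := by
      rw [hR, ← Real.rpow_add hbpos.2, neg_add_cancel, Real.rpow_zero]
    simp only [hF]
    have h4 : R * (I s ^ (1 / (q + 1)) * I b ^ (q / (q + 1))) = I s ^ (1 / (q + 1)) := by
      rw [mul_left_comm, h3, mul_one]
    linarith
  linarith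

/-- The scale-invariant quotient `N I^{-δ/(q+1)}` is nondecreasing. -/
theorem monotoneOn_quotient (h : EnergyRelations p q J I g P G) (hp : 1 < p) (hq : 0 < q)
    (hδ : δ = q * (p - 1) - 1) (hJ : J.OrdConnected) :
    MonotoneOn (fun t => P t t / I t * I t ^ (-δ / (q + 1))) {t ∈ J | 0 < I t} := by
  have hr : 0 < q + 1 := by positivity
  -- The exponents of I agree, -1 - δ/(q+1) = -p q/(q+1), because δ + 1 = q (p - 1).
  have key : ∀ t ∈ {t ∈ J | 0 < I t}, P t t / I t * I t ^ (-δ / (q + 1)) =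
      -(g t * I t ^ (-(q / (q + 1)))) ^ p := fun t ht => by
    rw [h.deriv_pairing_self t ht.1, Real.mul_rpow (h.diss_nonneg t) (Real.rpow_nonneg ht.2.le _),
      ← Real.rpow_mul ht.2.le, neg_div, neg_mul, div_mul_eq_mul_div, mul_div_assoc,
      ← Real.rpow_sub_one ht.2.ne']
    congr 3
    rw [hδ]
    field_simp
    ring
  intro s hs t ht hst
  simp only
  rw [key s hs, key t ht]
  refine neg_le_neg (Real.rpow_le_rpow ?_ (h.antitoneOn_normalized_diss hq hJ hs ht hst) (by linarith))
  exact mul_nonneg (h.diss_nonneg t) (Real.rpow_nonneg ht.2.le _)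

theorem frequency_eq (ht : 0 < I t) :
    P t t / I t = P t t / I t * I t ^ (-δ / (q + 1)) * I t ^ (δ / (q + 1)) := by
  rw [mul_assoc, ← Real.rpow_add ht, neg_div, neg_add_cancel, Real.rpow_zero, mul_one]

/-- A discrete product rule for N = m E with m = N I^(-δ/(q+1)) and E = I^(δ/(q+1)). The slope of m
is nonnegative on either side of t and is multiplied by E(s) > 0; the other term, m(t) times the
slope of E, tends to δ N(t)². -/
theorem eventually_lt_slope (h : EnergyRelations p q J I g P G) (hp : 1 < p) (hq : 0 < q)
    (hδ : δ = q * (p - 1) - 1) (hJ : J.OrdConnected) (ht : t ∈ {t ∈ J | 0 < I t}) {c : ℝ}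
    (hc : c < δ * (P t t / I t) ^ 2) :
    ∀ᶠ s in 𝓝[J \ {t}] t, s ∈ {t ∈ J | 0 < I t} ∧ c < slope (fun s => P s s / I s) t s := by
  have hr : 0 < q + 1 := by positivity
  set m : ℝ → ℝ := fun t => P t t / I t * I t ^ (-δ / (q + 1)) with hm
  have hmono := h.monotoneOn_quotient hp hq hδ hJ
  have hE : HasDerivWithinAt (fun s => I s ^ (δ / (q + 1)))
      ((q + 1) * P t t * (δ / (q + 1)) * I t ^ (δ / (q + 1) - 1)) J t :=
    (h.hasDerivWithinAt_energy t ht.1).rpow_const (Or.inl ht.2.ne')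
  have hlim := ((hasDerivWithinAt_iff_tendsto_slope.1 hE).const_mul (m t))
  have hval : m t * ((q + 1) * P t t * (δ / (q + 1)) * I t ^ (δ / (q + 1) - 1)) =
      δ * (P t t / I t) ^ 2 := by
    have h1 := frequency_eq (q := q) (δ := δ) (P := P) ht.2
    rw [Real.rpow_sub_one ht.2.ne']
    have h2 : m t * ((q + 1) * P t t * (δ / (q + 1)) * (I t ^ (δ / (q + 1)) / I t)) =
        δ * (m t * I t ^ (δ / (q + 1))) * (P t t / I t) := by
      field_simp
    rw [h2, hm, ← h1]
    ring
  rw [hval] at hlim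
  have hpos : ∀ᶠ s in 𝓝[J \ {t}] t, 0 < I s :=
    (h.eventually_pos ht.1 ht.2).filter_mono (nhdsWithin_mono t sdiff_subset)
  filter_upwards [hlim.eventually (lt_mem_nhds hc), hpos, self_mem_nhdsWithin] with s hs hIs hsJ
  refine ⟨⟨hsJ.1, hIs⟩, hs.trans_le ?_⟩
  have hst : s - t ≠ 0 := sub_ne_zero.2 hsJ.2
  have hE0 : 0 < I s ^ (δ / (q + 1)) := Real.rpow_pos_of_pos hIs _
  have h1 : slope (fun s => P s s / I s) t s =
      (m s - m t) / (s - t) * I s ^ (δ / (q + 1)) +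
        m t * slope (fun s => I s ^ (δ / (q + 1))) t s := by
    rw [slope_def_field, slope_def_field, frequency_eq (q := q) (δ := δ) (P := P) hIs,
      frequency_eq (q := q) (δ := δ) (P := P) ht.2]
    simp only [hm]
    field_simp
    ring
  rw [h1]
  have h2 : 0 ≤ (m s - m t) / (s - t) := by
    rcases lt_or_gt_of_ne hst with hlt | hgt
    · exact div_nonneg_of_nonpos (sub_nonpos.2 (hmono ⟨hsJ.1, hIs⟩ ht (by linarith))) hlt.le
    · exact div_nonneg (sub_nonneg.2 (hmono ht ⟨hsJ.1, hIs⟩ (by linarith))) hgt.le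
  have := mul_nonneg h2 hE0.le
  linarith

theorem neBot_nhdsWithin_diff (hJ : J.OrdConnected) (hJ' : J.Nontrivial) (ht : t ∈ J) :
    (𝓝[J \ {t}] t).NeBot := by
  have h := hJ.isPreconnected.preperfect_of_nontrivial hJ' t ht
  rw [AccPt] at h
  rwa [sdiff_eq, inter_comm, nhdsWithin_inter']

theorem le_of_hasDerivWithinAt (h : EnergyRelations p q J I g P G) (hp : 1 < p) (hq : 0 < q)
    (hδ : δ = q * (p - 1) - 1) (hJ : J.OrdConnected) (hJ' : J.Nontrivial)
    (ht : t ∈ {t ∈ J | 0 < I t}) {N' : ℝ}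
    (hN' : HasDerivWithinAt (fun s => P s s / I s) N' J t) : δ * (P t t / I t) ^ 2 ≤ N' := by
  have := neBot_nhdsWithin_diff hJ hJ' ht.1
  by_contra! hlt
  obtain ⟨c, hc1, hc2⟩ := exists_between hlt
  refine absurd (ge_of_tendsto (hasDerivWithinAt_iff_tendsto_slope.1 hN') ?_) (not_le.2 hc1)
  filter_upwards [h.eventually_lt_slope hp hq hδ hJ ht hc2] with s hs using hs.2.le

/-- N is the product of the nonpositive nondecreasing quotient and of I^(δ/(q+1)), which is positive
and, for δ ≥ 0, nonincreasing. -/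
theorem monotoneOn_frequency (h : EnergyRelations p q J I g P G) (hp : 1 < p) (hq : 0 < q)
    (hδ : δ = q * (p - 1) - 1) (hJ : J.OrdConnected) (hδ0 : 0 ≤ δ) :
    MonotoneOn (fun t => P t t / I t) {t ∈ J | 0 < I t} := by
  intro s hs t ht hst
  simp only
  rw [frequency_eq (q := q) (δ := δ) (P := P) hs.2, frequency_eq (q := q) (δ := δ) (P := P) ht.2]
  have hr : 0 < q + 1 := by positivity
  have h1 := h.monotoneOn_quotient hp hq hδ hJ hs ht hst
  simp only at h1
  have h2 : I t ^ (δ / (q + 1)) ≤ I s ^ (δ / (q + 1)) :=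
    Real.rpow_le_rpow ht.2.le (h.antitoneOn_energy hq hJ hs.1 ht.1 hst) (by positivity)
  have h3 : P t t / I t * I t ^ (-δ / (q + 1)) ≤ 0 := by
    rw [h.deriv_pairing_self t ht.1, neg_div, neg_mul]
    have := Real.rpow_nonneg (h.diss_nonneg t) p
    have := Real.rpow_nonneg ht.2.le (-δ / (q + 1))
    have := ht.2
    rw [neg_nonpos]
    positivity
  have h4 : 0 < I s ^ (δ / (q + 1)) := Real.rpow_pos_of_pos hs.2 _
  nlinarith

/-- The derivative is a multiple of a nondecreasing function, with c = q + 1 for the logarithm and c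
= 1 for the power. Only the interior of S has to consist of times with I > 0, so S may end at an
extinction time. -/
theorem convexOn_of_hasDerivWithinAt (h : EnergyRelations p q J I g P G) (hp : 1 < p) (hq : 0 < q)
    (hδ : δ = q * (p - 1) - 1) (hJ : J.OrdConnected) {S : Set ℝ} (hS : Convex ℝ S) (hSJ : S ⊆ J)
    (hSi : interior S ⊆ {t ∈ J | 0 < I t}) {F : ℝ → ℝ} (hFc : ContinuousOn F S) {c : ℝ}
    (hc : 0 ≤ c)
    (hF : ∀ t ∈ {t ∈ J | 0 < I t},
      HasDerivWithinAt F (c * (P t t / I t * I t ^ (-δ / (q + 1)))) J t) :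
    ConvexOn ℝ S F := by
  have hd : ∀ t ∈ interior S, HasDerivAt F (c * (P t t / I t * I t ^ (-δ / (q + 1)))) t :=
    fun t ht => (hF t (hSi ht)).hasDerivAt
      (mem_of_superset (mem_interior_iff_mem_nhds.1 ht) hSJ)
  refine MonotoneOn.convexOn_of_deriv hS hFc
    (fun t ht => (hd t ht).differentiableAt.differentiableWithinAt) fun s hs t ht hst => ?_
  rw [(hd s hs).deriv, (hd t ht).deriv]
  exact mul_le_mul_of_nonneg_left (h.monotoneOn_quotient hp hq hδ hJ (hSi hs) (hSi ht) hst) hc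

theorem convexOn_log (h : EnergyRelations p q J I g P G) (hp : 1 < p) (hq : 0 < q)
    (hδ : δ = q * (p - 1) - 1) (hJ : J.OrdConnected) (hδ0 : δ = 0) :
    ConvexOn ℝ {t ∈ J | 0 < I t} fun t => Real.log (I t) := by
  have hd : ∀ t ∈ {t ∈ J | 0 < I t}, HasDerivWithinAt (fun t => Real.log (I t))
      ((q + 1) * (P t t / I t * I t ^ (-δ / (q + 1)))) J t := fun t ht => by
    have := (h.hasDerivWithinAt_energy t ht.1).log ht.2.ne'
    convert this using 1
    rw [hδ0, neg_zero, zero_div, Real.rpow_zero, mul_one, mul_div_assoc]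
  exact h.convexOn_of_hasDerivWithinAt hp hq hδ hJ (h.ordConnected_pos hq hJ).convex
    (fun _ hτ => hτ.1) interior_subset
    (fun _ hτ => (hd _ hτ).continuousWithinAt.mono fun _ h => h.1) (by positivity) hd

theorem hasDerivWithinAt_power (h : EnergyRelations p q J I g P G) (hq : 0 < q) (hδ0 : δ ≠ 0)
    (ht : t ∈ {t ∈ J | 0 < I t}) : HasDerivWithinAt (fun t => -δ⁻¹ * I t ^ (-δ / (q + 1)))
      (1 * (P t t / I t * I t ^ (-δ / (q + 1)))) J t := by
  have hr : q + 1 ≠ 0 := by positivity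
  have h1 := ((h.hasDerivWithinAt_energy t ht.1).rpow_const (p := -δ / (q + 1))
    (Or.inl ht.2.ne')).const_mul (-δ⁻¹)
  refine h1.congr_deriv ?_
  rw [Real.rpow_sub_one ht.2.ne']
  field_simp

theorem convexOn_power (h : EnergyRelations p q J I g P G) (hp : 1 < p) (hq : 0 < q)
    (hδ : δ = q * (p - 1) - 1) (hJ : J.OrdConnected) (hδ0 : δ ≠ 0) :
    ConvexOn ℝ {t ∈ J | 0 < I t} fun t => -δ⁻¹ * I t ^ (-δ / (q + 1)) :=
  h.convexOn_of_hasDerivWithinAt hp hq hδ hJ (h.ordConnected_pos hq hJ).convex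
    (fun _ hτ => hτ.1) interior_subset
    (fun _ hτ => (h.hasDerivWithinAt_power hq hδ0 hτ).continuousWithinAt.mono fun _ h => h.1)
    zero_le_one fun _ ht => h.hasDerivWithinAt_power hq hδ0 ht

/-- For δ < 0 the function F is nonnegative, continuous, and zero wherever I is. The case to settle
is I(z) > 0 = I(y). With T the first zero after z, F is convex on [x, T] and F(T) = 0, so F(z) ≤ (T
- z)/(T - x) F(x); replacing T by y ≥ T only increases the coefficient, to a. -/
theorem convexOn_power_of_neg (h : EnergyRelations p q J I g P G) (hp : 1 < p) (hq : 0 < q)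
    (hδ : δ = q * (p - 1) - 1) (hJ : J.OrdConnected) (hδ0 : δ < 0) :
    ConvexOn ℝ J fun t => -δ⁻¹ * I t ^ (-δ / (q + 1)) := by
  set F : ℝ → ℝ := fun t => -δ⁻¹ * I t ^ (-δ / (q + 1)) with hF
  have hr : 0 < q + 1 := by positivity
  have hexp : 0 < -δ / (q + 1) := div_pos (neg_pos.2 hδ0) hr
  have hδi : 0 < -δ⁻¹ := neg_pos.2 (inv_lt_zero.2 hδ0)
  have hFc : ContinuousOn F J :=
    continuousOn_const.mul (h.continuousOn_energy.rpow_const fun _ _ => Or.inr hexp.le)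
  have hF0 : ∀ t, I t = 0 → F t = 0 := fun t ht => by
    simp only [hF]
    rw [ht, Real.zero_rpow hexp.ne', mul_zero]
  have hFn : ∀ t, 0 ≤ F t := fun t => mul_nonneg hδi.le (Real.rpow_nonneg (h.energy_nonneg t) _)
  have hanti := h.antitoneOn_energy hq hJ
  refine LinearOrder.convexOn_of_lt hJ.convex fun x hx y hy hxy a b ha hb hab => ?_
  have hsub : Icc x y ⊆ J := hJ.out hx hy
  set z := a • x + b • y with hz
  simp only [smul_eq_mul] at hz ⊢
  have ha' : a = 1 - b := by linarith
  have hzx : x < z := by rw [hz, ha']; nlinarith [mul_pos hb (sub_pos.2 hxy)]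
  have hzy : z < y := by
    rw [hz, show b = 1 - a by linarith]; nlinarith [mul_pos ha (sub_pos.2 hxy)]
  by_cases hz0 : I z = 0
  · have := hFn x
    have := hFn y
    change F z ≤ a * F x + b * F y
    rw [hF0 z hz0]
    positivity
  have hzpos : 0 < I z := lt_of_le_of_ne (h.energy_nonneg z) (Ne.symm hz0)
  have hzJ : z ∈ J := hsub ⟨hzx.le, hzy.le⟩
  rcases (h.energy_nonneg y).eq_or_lt with hy0 | hy0
  · have hcl : IsCompact {t ∈ Icc z y | I t = 0} := by
      have h1 : ContinuousOn I (Icc z y) :=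
        h.continuousOn_energy.mono ((Icc_subset_Icc hzx.le le_rfl).trans hsub)
      have h2 := h1.preimage_isClosed_of_isClosed isClosed_Icc (isClosed_singleton (x := (0 : ℝ)))
      exact isCompact_Icc.of_isClosed_subset h2 inter_subset_left
    obtain ⟨T, ⟨hT, hT0⟩, hTmin⟩ := hcl.exists_isLeast ⟨y, right_mem_Icc.2 hzy.le, hy0.symm⟩
    have hzT : z < T := lt_of_le_of_ne hT.1 fun h => hz0 (h ▸ hT0)
    have hTsub : Icc x T ⊆ J := (Icc_subset_Icc le_rfl hT.2).trans hsub
    have hconv : ConvexOn ℝ (Icc x T) F := by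
      refine h.convexOn_of_hasDerivWithinAt hp hq hδ hJ (convex_Icc x T) hTsub (fun τ hτ => ?_)
        (hFc.mono hTsub) zero_le_one fun t ht => h.hasDerivWithinAt_power hq hδ0.ne ht
      rw [interior_Icc] at hτ
      have hτJ := hTsub (Ioo_subset_Icc_self hτ)
      refine ⟨hτJ, ?_⟩
      rcases le_or_gt τ z with hle | hgt
      · exact hzpos.trans_le (hanti hτJ hzJ hle)
      · refine lt_of_le_of_ne (h.energy_nonneg τ) fun h0 => ?_
        exact absurd (hTmin ⟨⟨hgt.le, hτ.2.le.trans hT.2⟩, h0.symm⟩) (not_le.2 hτ.2)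
    have hxT : x < T := hzx.trans hzT
    have h1 := hconv.2 (left_mem_Icc.2 hxT.le) (right_mem_Icc.2 hxT.le)
      (show 0 ≤ (T - z) / (T - x) from div_nonneg (by linarith) (by linarith))
      (show 0 ≤ (z - x) / (T - x) from div_nonneg (by linarith) (by linarith))
      (by rw [← add_div, div_eq_one_iff_eq (by linarith)]; ring)
    have h2 : ((T - z) / (T - x)) • x + ((z - x) / (T - x)) • T = z := by
      have : T - x ≠ 0 := by linarith
      simp only [smul_eq_mul]
      field_simp
      ring
    rw [h2, hF0 T hT0, smul_zero, add_zero, smul_eq_mul] at h1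
    change F z ≤ a * F x + b * F y
    rw [hF0 y hy0.symm, mul_zero, add_zero]
    refine h1.trans (mul_le_mul_of_nonneg_right ?_ (hFn x))
    rw [div_le_iff₀ (by linarith)]
    have h3 : z = x + b * (y - x) := by rw [hz, show a = 1 - b by linarith]; ring
    have h4 : b * (y - x) ≥ b * (T - x) := mul_le_mul_of_nonneg_left (by linarith [hT.2]) hb.le
    have h5 : a = 1 - b := by linarith
    rw [h5]
    linarith
  · have hpos : ∀ τ ∈ Icc x y, 0 < I τ := fun τ hτ => hy0.trans_le (hanti (hsub hτ) hy hτ.2)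
    exact (h.convexOn_power hp hq hδ hJ hδ0.ne).2 ⟨hx, hpos x (left_mem_Icc.2 hxy.le)⟩ ⟨hy, hy0⟩
      ha.le hb.le hab

/-- Young's inequality p g(s)^(p-1) g(t) ≤ (p-1) g(s)^p + g(t)^p, that is, the tangent inequality
for the convex functional ‖·‖_p^p at ∇v(s). -/
theorem pairing_sub_le (h : EnergyRelations p q J I g P G) (hp : 1 < p) (hs : s ∈ J) (ht : t ∈ J) :
    p * (P s s - P s t) ≤ P s s - P t t := by
  have h1 := h.deriv_pairing_ge s hs t ht
  have hp0 : 0 < p - 1 := by linarith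
  have hconj : p.HolderConjugate (p / (p - 1)) := Real.HolderConjugate.conjExponent hp
  have h2 := Real.young_inequality_of_nonneg (h.diss_nonneg t)
    (Real.rpow_nonneg (h.diss_nonneg s) (p - 1)) hconj
  rw [← Real.rpow_mul (h.diss_nonneg s), mul_div_cancel₀ _ hp0.ne'] at h2
  rw [h.deriv_pairing_self s hs] at *
  rw [h.deriv_pairing_self t ht]
  have h3 : p * (g t ^ p / p + g s ^ p / (p / (p - 1))) = g t ^ p + (p - 1) * g s ^ p := by
    field_simp
  have h4 := mul_le_mul_of_nonneg_left h2 (show 0 ≤ p by linarith)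
  rw [h3] at h4
  nlinarith

end EnergyRelations

end Monotonicity

/-! ### Solutions satisfy the energy relations; differentiability of the frequency -/

section Solutions

set_option linter.unusedSectionVars false

/-- `pairing_sub_le` in both orders gives p (P(s,s) - P(s,t)) ≤ P(s,s) - P(t,t) ≤ p (P(t,s) -
P(t,t)). Divided by s - t, both ends tend to p A; the order reverses for s < t, whence the minimum
and maximum. -/
theorem EnergyRelations.hasDerivWithinAt_dissipation {p q A t : ℝ} {J : Set ℝ} {I g : ℝ → ℝ}
    {P G : ℝ → ℝ → ℝ} (h : EnergyRelations p q J I g P G) (hp : 1 < p) (ht : t ∈ J)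
    (h1 : Tendsto (fun s => (P s s - P s t) / (s - t)) (𝓝[J \ {t}] t) (𝓝 A))
    (h2 : Tendsto (fun s => (P t s - P t t) / (s - t)) (𝓝[J \ {t}] t) (𝓝 A)) :
    HasDerivWithinAt (fun s => P s s) (p * A) J t := by
  rw [hasDerivWithinAt_iff_tendsto_slope]
  have l1 := (h1.const_mul p).min (h2.const_mul p)
  have l2 := (h1.const_mul p).max (h2.const_mul p)
  rw [min_self] at l1
  rw [max_self] at l2
  refine tendsto_of_tendsto_of_tendsto_of_le_of_le' l1 l2 ?_ ?_ <;>
  · filter_upwards [self_mem_nhdsWithin] with s hs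
    have lo := h.pairing_sub_le hp hs.1 ht
    have up : P s s - P t t ≤ p * (P t s - P t t) := by linarith [h.pairing_sub_le hp ht hs.1]
    rw [slope_def_field, ← mul_div_assoc, ← mul_div_assoc]
    rcases lt_or_gt_of_ne (sub_ne_zero.2 hs.2 : s - t ≠ 0) with hlt | hgt
    · first
      | exact (min_le_right _ _).trans (div_le_div_of_nonpos_of_le hlt.le up)
      | exact (div_le_div_of_nonpos_of_le hlt.le lo).trans (le_max_left _ _)
    · first
      | exact (min_le_left _ _).trans (div_le_div_of_nonneg_right lo hgt.le)
      | exact (div_le_div_of_nonneg_right up hgt.le).trans (le_max_right _ _)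

theorem isWeakGrad_weakGrad {n : ℕ} {M : Type*} [MetricSpace M]
    [ChartedSpace (EuclideanSpace ℝ (Fin n)) M]
    [RiemannianBundle (fun x : M => TangentSpace (𝓡 n) x)] {f : M → ℝ}
    (h : ∃ X, IsWeakGrad n f X) : IsWeakGrad n f (weakGrad n f) := by
  rw [weakGrad, dif_pos h]
  exact h.choose_spec

variable {n : ℕ} {M : Type*} [MetricSpace M] [MeasurableSpace M] [BorelSpace M]
  [ChartedSpace (EuclideanSpace ℝ (Fin n)) M] [IsManifold (𝓡 n) ∞ M]
  [RiemannianBundle (fun x : M => TangentSpace (𝓡 n) x)]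
  [IsContMDiffRiemannianBundle (𝓡 n) ∞ (EuclideanSpace ℝ (Fin n))
      (fun x : M => TangentSpace (𝓡 n) x)]
  {φ : M → ℝ} {p q : ℝ}

theorem norm_rpow_smul_self {E : Type*} [NormedAddCommGroup E] [NormedSpace ℝ E] (hp : 1 < p)
    (X : E) : ‖‖X‖ ^ (p - 2) • X‖ = ‖X‖ ^ (p - 1) := by
  rw [norm_smul, Real.norm_eq_abs, abs_of_nonneg (Real.rpow_nonneg (norm_nonneg _) _)]
  rcases eq_or_ne ‖X‖ 0 with h | h
  · rw [h, mul_zero, Real.zero_rpow (by linarith)]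
  · rw [← Real.rpow_add_one h]
    congr 1
    ring

theorem norm_rpow_mul_inner_self {E : Type*} [NormedAddCommGroup E] [InnerProductSpace ℝ E]
    (hp : 1 < p) (X : E) : ‖X‖ ^ (p - 2) * inner ℝ X X = ‖X‖ ^ p := by
  rw [real_inner_self_eq_norm_sq]
  rcases eq_or_ne ‖X‖ 0 with h | h
  · rw [h, Real.zero_rpow (x := p) (by linarith)]
    ring
  · rw [sq, ← mul_assoc, ← Real.rpow_add_one h, ← Real.rpow_add_one h]
    congr 1
    ring

/-- W(s) is in the dual space L^(p/(p-1)), so the equation at time s can be tested with v(t). This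
gives P(s,t) = -∫ ⟨W(s), ∇v(t)⟩, from which the bound by g follows by Hölder and the diagonal value
by s = t. The other relations are calculus for the pairing of L^(q+1) with L^((q+1)/q). -/
theorem energyRelations [CompleteSpace M] [SecondCountableTopology M] [IsRiemannianManifold (𝓡 n) M]
    (hφ : Continuous φ) (hp : 1 < p) (hq : 0 < q) {J : Set ℝ} {u ut : ℝ → M → ℝ}
    (hA : StandingAssumption n φ p q J u ut) (hu : IsSolution n φ p q J u ut) :
    EnergyRelations p q J (energyI n φ q u) (fun t => (-energyD n φ p q u t) ^ (1 / p))
      (fun s t => ∫ x, ut s x * spow q (u t x) ∂(weightedVolume n φ))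
      (fun s t => ∫ x, u s x * spow q (u t x) ∂(weightedVolume n φ)) := by
  set μ := weightedVolume n φ with hμ
  set X : ℝ → ∀ x : M, TangentSpace (𝓡 n) x := fun t => weakGrad n (fun x => spow q (u t x)) with hX
  have hp0 : 0 < p := by linarith
  have hp1 : 0 < p - 1 := by linarith
  have hpp : p.HolderConjugate (p / (p - 1)) := Real.HolderConjugate.conjExponent hp
  have hr := holderConjugate_add_one hq
  have hum : ∀ s ∈ J, MemLp (u s) (ENNReal.ofReal (q + 1)) μ := fun s hs => by
    obtain ⟨_, _, h, _⟩ := (hA s hs).1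
    exact h
  have hutm : ∀ s ∈ J, MemLp (ut s) (ENNReal.ofReal (q + 1)) μ := fun s hs => by
    obtain ⟨_, _, h, _⟩ := (hA s hs).2.1
    exact h
  have hvm : ∀ s ∈ J, MemLp (fun x => spow q (u s x)) (ENNReal.ofReal ((q + 1) / q)) μ :=
    fun s hs => memLp_spow hq (hum s hs)
  have hXw : ∀ s ∈ J, IsWeakGrad n (fun x => spow q (u s x)) (X s) := fun s hs =>
    isWeakGrad_weakGrad (hA s hs).2.2.1
  have hXm : ∀ s ∈ J, MemLp (fun x => ‖X s x‖) (ENNReal.ofReal p) μ := fun s hs => (hA s hs).2.2.2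
  have hWm : ∀ s ∈ J, MemLp (fun x => ‖‖X s x‖ ^ (p - 2) • X s x‖) (ENNReal.ofReal (p / (p - 1))) μ :=
    fun s hs => by
      have h := memLp_abs_rpow hp1 (hXm s hs)
      simpa only [norm_rpow_smul_self hp, abs_norm] using h
  have hWc : ∀ s ∈ J, ChartMeasurable fun x => ‖X s x‖ ^ (p - 2) • X s x := fun s hs =>
    (hXw s hs).chartMeasurable.smul hφ
      (((hXm s hs).1.aemeasurable.pow_const (p - 2)).aestronglyMeasurable)
  have hpair : ∀ s ∈ J, ∀ t ∈ J, ∫ x, ut s x * spow q (u t x) ∂μ =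
      -∫ x, inner ℝ (‖X s x‖ ^ (p - 2) • X s x) (X t x) ∂μ := by
    intro s hs t ht
    refine integral_mul_eq_neg_integral_inner hφ hpp hr (hutm s hs) (hWc s hs) (hWm s hs) (hvm t ht)
      (hXw t ht) (hXm t ht) fun ψ hψ hψc => ?_
    rw [(hu s hs).2 ψ hψ hψc]
    simp only [real_inner_smul_left]
    rfl
  have hDdef : ∀ t, -energyD n φ p q u t = ∫ x, ‖X t x‖ ^ p ∂μ := fun t => neg_neg _
  have hD0 : ∀ t, 0 ≤ -energyD n φ p q u t := fun t => by
    rw [hDdef]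
    exact integral_nonneg fun x => Real.rpow_nonneg (norm_nonneg _) _
  have hself : ∀ t ∈ J, ∫ x, ut t x * spow q (u t x) ∂μ = energyD n φ p q u t := fun t ht => by
    rw [hpair t ht t ht]
    simp only [real_inner_smul_left, norm_rpow_mul_inner_self hp]
    rfl
  have hpow : ∀ t, ((-energyD n φ p q u t) ^ (1 / p)) ^ p = -energyD n φ p q u t := fun t => by
    rw [← Real.rpow_mul (hD0 t), one_div_mul_cancel hp0.ne', Real.rpow_one]
  refine ⟨fun t => integral_nonneg fun x => Real.rpow_nonneg (abs_nonneg _) _,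
    fun t => Real.rpow_nonneg (hD0 t) _, fun t ht => ?_, fun t ht s hs => ?_, fun t ht s hs => ?_,
    fun t ht => ?_, fun s hs t ht => ?_, fun t ht => ?_, fun t ht => ?_⟩
  · exact hasDerivWithinAt_integral_abs_rpow hq hum ht (hutm t ht) (hu t ht).1
  · exact hasDerivWithinAt_integral_mul hr hum hs (hutm s hs) (hu s hs).1 (hvm t ht)
  · exact integral_mul_spow_le hq (hum s hs) (hum t ht)
  · refine integral_congr_ae (Eventually.of_forall fun x => ?_)
    simp only
    rw [mul_comm, spow_mul_self hq]
  · rw [hpair s hs t ht, neg_le_neg_iff]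
    have h1 := integral_mul_norm_le_Lp_mul_Lq (μ := μ) hpp.symm (hWm s hs) (hXm t ht)
    have h2 : ∀ x, ‖‖‖X s x‖ ^ (p - 2) • X s x‖‖ ^ (p / (p - 1)) = ‖X s x‖ ^ p := fun x => by
      rw [norm_norm, norm_rpow_smul_self hp, ← Real.rpow_mul (norm_nonneg _),
        mul_div_cancel₀ _ hp1.ne']
    have h3 : ∀ x, ‖‖X t x‖‖ ^ p = ‖X t x‖ ^ p := fun x => by rw [norm_norm]
    simp only [h2, h3] at h1
    rw [← hDdef, ← hDdef, one_div_div, div_eq_mul_one_div, mul_comm (p - 1), Real.rpow_mul (hD0 s)] at h1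
    refine le_trans ?_ h1
    refine integral_mono (integrable_inner_of_memLp hφ hpp (hWc s hs) (hWm s hs)
      (hXw t ht).chartMeasurable (hXm t ht)) ?_ fun x => ?_
    · simpa only [norm_norm] using integrable_mul_of_memLp hpp.symm (hWm s hs) (hXm t ht)
    · simp only [norm_norm]
      exact real_inner_le_norm _ _
  · rw [hself t ht, hpow, neg_neg]
  · have hcont : Tendsto (fun s => eLpNorm (fun x => u s x - u t x) (ENNReal.ofReal (q + 1)) μ)
        (𝓝[J] t) (𝓝 0) := by
      -- The time derivative gives the limit along s ≠ t only; the point t itself is added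
      -- separately.
      rw [← insert_eq_of_mem ht, ← insert_sdiff_singleton, nhdsWithin_insert, tendsto_sup]
      refine ⟨?_, (hu t ht).1.tendsto hr.lt.le hum ht (hutm t ht)⟩
      rw [tendsto_pure_left]
      intro s hs
      simpa using mem_of_mem_nhds hs
    exact ParabolicFrequency.tendsto_integral_mul hr (Eventually.of_forall fun _ => hutm t ht)
      (by filter_upwards [self_mem_nhdsWithin] with s hs using hvm s hs) (hutm t ht) (hvm t ht)
      (by simpa using tendsto_const_nhds)
      (tendsto_spow hq (by filter_upwards [self_mem_nhdsWithin] with s hs using hum s hs) (hum t ht)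
        hcont)


theorem energyD_eq_pairing [CompleteSpace M] [SecondCountableTopology M]
    [IsRiemannianManifold (𝓡 n) M] (hφ : Continuous φ) (hp : 1 < p) (hq : 0 < q) {J : Set ℝ}
    {u ut : ℝ → M → ℝ} (hA : StandingAssumption n φ p q J u ut) (hu : IsSolution n φ p q J u ut)
    {t : ℝ} (ht : t ∈ J) :
    energyD n φ p q u t = ∫ x, ut t x * spow q (u t x) ∂(weightedVolume n φ) := by
  have h := (energyRelations hφ hp hq hA hu).deriv_pairing_self t ht
  have hD0 : 0 ≤ -energyD n φ p q u t := by
    rw [energyD, neg_neg]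
    exact integral_nonneg fun x => Real.rpow_nonneg (norm_nonneg _) _
  rw [← Real.rpow_mul hD0, one_div_mul_cancel (by linarith), Real.rpow_one, neg_neg] at h
  exact h.symm

/-- The two quotients needed for the dissipation are the integrals of (v(s) - v(t))/(s - t) against
u_t(s) and against u_t(t). Both tend to ∫ v_t u_t dμ, the first by the continuity of u_t. -/
theorem differentiableWithinAt_frequency [CompleteSpace M] [SecondCountableTopology M]
    [IsRiemannianManifold (𝓡 n) M] (hφ : Continuous φ) (hp : 1 < p) (hq : 0 < q) {J : Set ℝ}
    {u ut : ℝ → M → ℝ} (hA : StandingAssumption n φ p q J u ut) (hu : IsSolution n φ p q J u ut)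
    {t : ℝ} (ht : t ∈ posTimes n φ q J u)
    (hut : LpContinuousAt (weightedVolume n φ) (q + 1) J ut t) {vt : M → ℝ}
    (hvt : MemLp vt (ENNReal.ofReal ((q + 1) / q)) (weightedVolume n φ))
    (hd : HasLpDerivAt (weightedVolume n φ) ((q + 1) / q) J (fun s x => spow q (u s x)) vt t) :
    DifferentiableWithinAt ℝ (frequency n φ p q u) J t := by
  have h := energyRelations hφ hp hq hA hu
  have hr := holderConjugate_add_one hq
  have hutm : ∀ s ∈ J, MemLp (ut s) (ENNReal.ofReal (q + 1)) (weightedVolume n φ) := fun s hs => by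
    obtain ⟨_, _, h, _⟩ := (hA s hs).2.1
    exact h
  have hvm : ∀ s ∈ J, MemLp (fun x => spow q (u s x)) (ENNReal.ofReal ((q + 1) / q))
      (weightedVolume n φ) := fun s hs => by
    obtain ⟨_, _, h, _⟩ := (hA s hs).1
    exact memLp_spow hq h
  have hquot : ∀ s ∈ J, ∀ w : M → ℝ, MemLp w (ENNReal.ofReal (q + 1)) (weightedVolume n φ) →
      ∫ x, (spow q (u s x) - spow q (u t x)) / (s - t) * w x ∂(weightedVolume n φ) =
      (∫ x, w x * spow q (u s x) ∂(weightedVolume n φ) -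
        ∫ x, w x * spow q (u t x) ∂(weightedVolume n φ)) / (s - t) := by
    intro s hs w hw
    rw [← integral_sub (integrable_mul_of_memLp hr hw (hvm s hs))
      (integrable_mul_of_memLp hr hw (hvm t ht.1)), ← integral_div]
    congr 1
    ext x
    ring
  have l1 := hd.tendsto_integral_mul hr.symm hvm ht.1 hvt hutm (hutm t ht.1) hut.mono_diff
  have l2 := hd.tendsto_integral_mul hr.symm hvm ht.1 hvt (fun _ _ => hutm t ht.1) (hutm t ht.1)
    (by simpa using tendsto_const_nhds)
  have hD := h.hasDerivWithinAt_dissipation hp ht.1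
    (l1.congr' (by filter_upwards [self_mem_nhdsWithin] with s hs using hquot s hs.1 _ (hutm s hs.1)))
    (l2.congr' (by filter_upwards [self_mem_nhdsWithin] with s hs using hquot s hs.1 _ (hutm t ht.1)))
  have hI := h.hasDerivWithinAt_energy t ht.1
  refine (hD.div hI ht.2.ne').differentiableWithinAt.congr (fun s hs => ?_) ?_
  · simp only [frequency, energyD_eq_pairing hφ hp hq hA hu hs, Pi.div_apply]
  · simp only [frequency, energyD_eq_pairing hφ hp hq hA hu ht.1, Pi.div_apply]

end Solutions

end

end ParabolicFrequency

/-! ### The theorem -/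

open ParabolicFrequency in
theorem theorem1 (n : ℕ) (M : Type*) [MetricSpace M] [CompleteSpace M]
    [SecondCountableTopology M] [MeasurableSpace M] [BorelSpace M]
    [ChartedSpace (EuclideanSpace ℝ (Fin n)) M] [IsManifold (𝓡 n) ∞ M]
    [RiemannianBundle (fun x : M => TangentSpace (𝓡 n) x)]
    [IsContMDiffRiemannianBundle (𝓡 n) ∞ (EuclideanSpace ℝ (Fin n))
      (fun x : M => TangentSpace (𝓡 n) x)]
    [IsRiemannianManifold (𝓡 n) M]
    (φ : M → ℝ) (hφ : ContMDiff (𝓡 n) 𝓘(ℝ, ℝ) ∞ φ)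
    (p q : ℝ) (hp : 1 < p) (hq : 0 < q) (δ : ℝ) (hδ : δ = q * (p - 1) - 1)
    (J : Set ℝ) (hJ : J.OrdConnected) (hJ' : J.Nontrivial)
    (u ut : ℝ → M → ℝ)
    (hA : StandingAssumption n φ p q J u ut)
    (hu : IsSolution n φ p q J u ut) :
    -- the inequality `N' ≥ δ N ^ 2`, for the lower derivative of `N`
    (∀ t ∈ posTimes n φ q J u, ∀ c < δ * frequency n φ p q u t ^ 2,
      ∀ᶠ s in 𝓝[J \ {t}] t,
        s ∈ posTimes n φ q J u ∧ c < slope (frequency n φ p q u) t s) ∧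
    -- the inequality for the derivative of `N`, wherever it exists
    (∀ t ∈ posTimes n φ q J u, ∀ N' : ℝ,
      HasDerivWithinAt (frequency n φ p q u) N' J t → δ * frequency n φ p q u t ^ 2 ≤ N') ∧
    -- the derivative exists whenever `u_t` and `(u ^ q)_t` do in the natural sense
    (∀ t ∈ posTimes n φ q J u,
      LpContinuousAt (weightedVolume n φ) (q + 1) J ut t →
      (∃ vt : M → ℝ, MemLp vt (ENNReal.ofReal ((q + 1) / q)) (weightedVolume n φ) ∧
        HasLpDerivAt (weightedVolume n φ) ((q + 1) / q) J (fun s x => spow q (u s x)) vt t) →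
      DifferentiableWithinAt ℝ (frequency n φ p q u) J t) ∧
    (0 ≤ δ → MonotoneOn (frequency n φ p q u) (posTimes n φ q J u)) ∧
    (δ = 0 → ConvexOn ℝ (posTimes n φ q J u) (fun t => Real.log (energyI n φ q u t))) ∧
    (δ ≠ 0 → ConvexOn ℝ (posTimes n φ q J u)
      (fun t => -δ⁻¹ * energyI n φ q u t ^ (-δ / (q + 1)))) ∧
    -- for `δ < 0` the exponent is positive and the last function is convex on all of `J`
    (δ < 0 → ConvexOn ℝ J (fun t => -δ⁻¹ * energyI n φ q u t ^ (-δ / (q + 1)))) := by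
  have h := energyRelations hφ.continuous hp hq hA hu
  -- The identity D(s) = P(s,s) comes from the equation and is available only for s in J; slopes and
  -- derivatives are therefore transferred within J.
  have hN : ∀ s ∈ J, frequency n φ p q u s =
      (∫ x, ut s x * spow q (u s x) ∂(weightedVolume n φ)) / energyI n φ q u s := fun s hs => by
    rw [frequency, energyD_eq_pairing hφ.continuous hp hq hA hu hs]
  refine ⟨fun t ht c hc => ?_, fun t ht N' hN' => ?_, fun t ht hut hv => ?_, fun hδ0 => ?_,
    h.convexOn_log hp hq hδ hJ, h.convexOn_power hp hq hδ hJ, h.convexOn_power_of_neg hp hq hδ hJ⟩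
  · rw [hN t ht.1] at hc
    filter_upwards [h.eventually_lt_slope hp hq hδ hJ ht hc] with s hs
    refine ⟨hs.1, ?_⟩
    have := hs.2
    rw [slope_def_field] at this ⊢
    rwa [hN s hs.1.1, hN t ht.1]
  · rw [hN t ht.1]
    exact h.le_of_hasDerivWithinAt hp hq hδ hJ hJ' ht
      (hN'.congr (fun s hs => (hN s hs).symm) (hN t ht.1).symm)
  · obtain ⟨vt, hvt, hd⟩ := hv
    exact differentiableWithinAt_frequency hφ.continuous hp hq hA hu ht hut hvt hd
  · exact (h.monotoneOn_frequency hp hq hδ hJ hδ0).congr fun s hs => (hN s hs.1).symm
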